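/- **Notation.** For measurable $\Omega\subset\mathbb R^2$ let $|\Omega|$ be its area, $P(\Omega)$ its (De Giorgi) perimeter, and $\mathcal A_\pi:=\{\Omega\subset\mathbb R^2 \text{ measurable}:\ |\Omega|=\pi,\ P(\Omega)<\infty\}$. For $\lambda,\alpha>0$ and $\Omega\in\mathcal A_\pi$ put $$F_{\lambda,\alpha}(\Omega):=P(\Omega)-\frac{\lambda^2}{4\pi}\int_\Omega\int_{\mathbb R^2\setminus\Omega}\frac{e^{-\lambda\alpha|x-y|}}{|x-y|}\,dy\,dx .$$ A set is *regular* if it is bounded and open with boundary of class $C^\infty$. Closed curves are $1$-periodic maps $\gamma:\mathbb R\to\mathbb R^2$; $H^k(\mathbb S^1;\mathbb R^2)$ denotes the $1$-periodic functions in $H^k_{\rm loc}(\mathbb R;\mathbb R^2)$ (continuous representatives). Put $L(\gamma):=\int_0^1|\gamma'|\,dt$; $\gamma$ is regular if $\gamma'\neq0$ everywhere, and has constant speed if $|\gamma'|\equiv L(\gamma)$. With $y^\perp:=(-y_2,y_1)$, the winding number around $x\notin\gamma([0,1])$ is $\mathcal I(\gamma,x):=\frac1{2\pi}\int_0^1\frac{(\gamma(t)-x)^\perp\cdot\gamma'(t)}{|\gamma(t)-x|^2}\,dt$.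 The boundary of a regular set $\Omega$ is the disjoint union of the images of finitely many smooth Jordan curves; its *constant speed boundary curves* are such curves, parametrized with constant speed, oriented so that $-(\gamma')^\perp$ points out of $\Omega$, and enumerated by decreasing length. For a set $\Omega$ of finite perimeter let $\partial^*\Omega$ be its reduced boundary and $\Omega^*:=\{x:\ |B_r(x)\setminus\Omega|=0\text{ for some }r>0\}$. A finite family $\gamma=\{\gamma_i\}_{i\in I}\subset H^2(\mathbb S^1;\mathbb R^2)$, $I\subset\mathbb N$, belongs to $G(\Omega)$ if each $|\gamma_i'|$ is constant and, with $\Gamma:=\bigcup_{i\in I}\gamma_i([0,1])$ and $A^o_\gamma:=\{x\in\mathbb R^2\setminus\Gamma:\ \sum_{i\in I}\mathcal I(\gamma_i,x)\equiv1\ (\mathrm{mod}\ 2)\}$, $$\partial^*\Omega\subset\Gamma,\qquad \Omega^*=\operatorname{int}\left(A^o_\gamma\cup\Gamma\right).$$ **Proposition.** Let $\lambda_n>0$ and $\alpha_n>\frac1{\sqrt{2\pi}}$ be such that $\lambda_n\to\infty$ and $\sigma_n:=\lambda_n^2\left(1-\frac1{2\pi\alpha_n^2}\right)\to\sigma$ for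 some $\sigma>0$. Let $\Omega_n\in\mathcal A_\pi$ be regular sets with $\limsup_{n\to\infty}\lambda_n^2F_{\lambda_n,\alpha_n}(\Omega_n)<\infty$, and let $\{\gamma_{n,i}\}_{i=1}^{N_n}$ be the constant speed boundary curves of $\Omega_n$, enumerated by decreasing length. Suppose that $\chi_{\Omega_n}\to\chi_{\Omega_\infty}$ in $L^1(\mathbb R^2)$ for some $\Omega_\infty\in\mathcal A_\pi$. Then there exist a subsequence $(n_k)$, a finite set $I\subset\mathbb N$ with $I\subset\{1,\dots,N_{n_k}\}$ for all $k$, and a family $\{\gamma_{\infty,i}\}_{i\in I}\in G(\Omega_\infty)$ of regular constant speed curves in $H^2(\mathbb S^1;\mathbb R^2)$ such that for all $i\in I$ $$\gamma_{n_k,i}\to\gamma_{\infty,i}\quad\text{in } H^1(\mathbb S^1;\mathbb R^2)\qquad\text{as }k\to\infty .$$ -/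

import Mathlib

open Set Filter Topology MeasureTheory
open scoped ENNReal ContDiff

noncomputable section

/-- The Euclidean plane `ℝ²`. -/
abbrev Plane : Type := EuclideanSpace ℝ (Fin 2)

/-! ### Perimeter, admissible sets, the energy -/

/-- The divergence of a vector field on the plane. -/
def divergence (X : Plane → Plane) (x : Plane) : ℝ :=
  ∑ i : Fin 2, (fderiv ℝ X x (EuclideanSpace.single i 1)) i

/-- The (De Giorgi) perimeter: the supremum of `∫_Ω div X` over all `X ∈ C¹_c(ℝ²; ℝ²)` with
`|X| ≤ 1`. As `X` may be replaced by `-X`, truncating at `0` does not change the supremum. -/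
def perimeter (Ω : Set Plane) : ℝ≥0∞ :=
  ⨆ (X : Plane → Plane) (_ : ContDiff ℝ 1 X) (_ : HasCompactSupport X) (_ : ∀ x, ‖X x‖ ≤ 1),
    ENNReal.ofReal (∫ x in Ω, divergence X x)

/-- The class `𝒜_m` of (Lebesgue measurable) sets of area `m` and finite perimeter. -/
structure Admissible (m : ℝ) (Ω : Set Plane) : Prop where
  measurable : NullMeasurableSet Ω volume
  area : volume Ω = ENNReal.ofReal m
  finite_perimeter : perimeter Ω < ⊤

/-- The energy
`F_{λ,α}(Ω) = P(Ω) - λ²/(4π) ∫_Ω ∫_{Ωᶜ} exp(-λ α |x-y|) / |x-y| dy dx`. -/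
def energy (lam α : ℝ) (Ω : Set Plane) : ℝ :=
  (perimeter Ω).toReal - lam ^ 2 / (4 * Real.pi) *
    ∫ x in Ω, ∫ y in Ωᶜ, Real.exp (-(lam * α * ‖x - y‖)) / ‖x - y‖

/-- A regular set: a bounded open set with boundary of class `C^∞`, i.e. near each of its
boundary points the set is the strict sublevel set of a smooth function without critical points. -/
structure RegularSet (Ω : Set Plane) : Prop where
  isOpen : IsOpen Ω
  bounded : Bornology.IsBounded Ω
  smooth_boundary : ∀ x ∈ frontier Ω, ∃ (U : Set Plane) (f : Plane → ℝ),
    IsOpen U ∧ x ∈ U ∧ ContDiffOn ℝ ∞ f U ∧ (∀ y ∈ U, fderiv ℝ f y ≠ 0) ∧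
      Ω ∩ U = {y ∈ U | f y < 0}

/-! ### Closed curves: `1`-periodic maps `ℝ → ℝ²` -/

/-- `y^⊥ = (-y₂, y₁)`. -/
def perp (y : Plane) : Plane := !₂[-(y 1), y 0]

/-- The length `L(γ) = ∫₀¹ |γ'|`. -/
def curveLength (γ : ℝ → Plane) : ℝ := ∫ t in (0 : ℝ)..1, ‖deriv γ t‖

/-- The image `γ([0,1])`. -/
def curveImage (γ : ℝ → Plane) : Set Plane := γ '' Icc 0 1

/-- The winding number of `γ` around `x`. -/
def windingNumber (γ : ℝ → Plane) (x : Plane) : ℝ :=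
  1 / (2 * Real.pi) *
    ∫ t in (0 : ℝ)..1, inner ℝ (perp (γ t - x)) (deriv γ t) / ‖γ t - x‖ ^ 2

/-- `v` is the weak derivative of `u` on `ℝ`. -/
def HasWeakDeriv (u v : ℝ → Plane) : Prop :=
  LocallyIntegrable u volume ∧ LocallyIntegrable v volume ∧
    ∀ φ : ℝ → ℝ, ContDiff ℝ ∞ φ → HasCompactSupport φ →
      ∫ t, deriv φ t • u t = - ∫ t, φ t • v t

/-- `u ∈ L²_loc(ℝ; ℝ²)`. -/
def MemL2Loc (u : ℝ → Plane) : Prop :=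
  ∀ a b : ℝ, MemLp u 2 (volume.restrict (Icc a b))

/-- `γ ∈ H²(𝕊¹; ℝ²)`: a `1`-periodic function in `H²_loc(ℝ; ℝ²)`, where `γ` is the continuous
representative. Such a `γ` is of class `C¹`, so that `deriv γ` is its continuous derivative. -/
structure MemH2 (γ : ℝ → Plane) : Prop where
  continuous : Continuous γ
  periodic : Function.Periodic γ 1
  weakDeriv : ∃ g h : ℝ → Plane, HasWeakDeriv γ g ∧ HasWeakDeriv g h ∧
    MemL2Loc γ ∧ MemL2Loc g ∧ MemL2Loc h

/-- A closed curve is regular if its derivative vanishes nowhere. -/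
def RegularCurve (γ : ℝ → Plane) : Prop := ∀ t, deriv γ t ≠ 0

/-- Constant speed: `|γ'| ≡ L(γ)`. -/
def ConstantSpeed (γ : ℝ → Plane) : Prop := ∀ t, ‖deriv γ t‖ = curveLength γ

/-- The norm of `H¹(𝕊¹; ℝ²)`, for curves of class `C¹`. -/
def h1Norm (u : ℝ → Plane) : ℝ≥0∞ :=
  (∫⁻ t in Icc (0 : ℝ) 1, (‖u t‖ₑ ^ 2 + ‖deriv u t‖ₑ ^ 2)) ^ (1 / 2 : ℝ)

/-- `γ 0, …, γ (N - 1)` are the constant speed boundary curves of `Ω`, enumerated by decreasing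
length: smooth disjoint Jordan curves whose images decompose `∂Ω`, oriented so that
`-(γ i)'^⊥` points out of `Ω`. -/
structure IsBoundaryDecomposition (Ω : Set Plane) (N : ℕ) (γ : ℕ → ℝ → Plane) : Prop where
  smooth : ∀ i < N, ContDiff ℝ ∞ (γ i)
  periodic : ∀ i < N, Function.Periodic (γ i) 1
  simple : ∀ i < N, InjOn (γ i) (Ico 0 1)
  regular : ∀ i < N, RegularCurve (γ i)
  constantSpeed : ∀ i < N, ConstantSpeed (γ i)
  disjoint : ∀ i < N, ∀ j < N, i ≠ j → Disjoint (curveImage (γ i)) (curveImage (γ j))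
  boundary : frontier Ω = ⋃ i < N, curveImage (γ i)
  oriented : ∀ i < N, ∀ t : ℝ, ∀ᶠ s in 𝓝[>] (0 : ℝ),
    γ i t - s • perp (deriv (γ i) t) ∉ Ω ∧ γ i t + s • perp (deriv (γ i) t) ∈ Ω
  decreasing : ∀ i j, i ≤ j → j < N → curveLength (γ j) ≤ curveLength (γ i)

/-! ### Systems of boundary curves -/

/-- `μ = |Dχ_Ω|` and `ν` is the Radon–Nikodym density of `Dχ_Ω` with respect to it (a `μ`-a.e.
unit field, the inner normal), in the polar decomposition `Dχ_Ω = ν μ`. For a set of finite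
perimeter such a pair exists, `μ` is unique, and `ν` is unique `μ`-a.e. -/
structure IsPolarDecomposition (Ω : Set Plane) (μ : Measure Plane) (ν : Plane → Plane) :
    Prop where
  locallyFinite : IsLocallyFiniteMeasure μ
  measurable : Measurable ν
  unit : ∀ᵐ x ∂μ, ‖ν x‖ = 1
  gauss_green : ∀ X : Plane → Plane, ContDiff ℝ 1 X → HasCompactSupport X →
    ∫ x in Ω, divergence X x = - ∫ x, inner ℝ (X x) (ν x) ∂μ

/-- The (De Giorgi) reduced boundary `∂*Ω`: the points `x` of the support of `|Dχ_Ω|` at which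
the limit of `Dχ_Ω(B_r(x)) / |Dχ_Ω|(B_r(x))` as `r → 0` exists and is a unit vector. -/
def reducedBoundary (Ω : Set Plane) : Set Plane :=
  {x | ∃ (μ : Measure Plane) (ν : Plane → Plane), IsPolarDecomposition Ω μ ν ∧
    (∀ r > 0, 0 < μ (Metric.ball x r)) ∧
    ∃ n : Plane, ‖n‖ = 1 ∧
      Tendsto (fun r : ℝ => (μ (Metric.ball x r)).toReal⁻¹ • ∫ y in Metric.ball x r, ν y ∂μ)
        (𝓝[>] 0) (𝓝 n)}

/-- `Ω^* = {x | |B_r(x) \ Ω| = 0 for some r > 0}`. -/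
def essInterior (Ω : Set Plane) : Set Plane :=
  {x | ∃ r > 0, volume (Metric.ball x r \ Ω) = 0}

/-- The union `Γ` of the images of a finite family of curves. -/
def familyImage (I : Finset ℕ) (γ : ℕ → ℝ → Plane) : Set Plane :=
  ⋃ i ∈ I, curveImage (γ i)

/-- `A_γ^o`: the points off `Γ` around which the total winding number is an odd integer. -/
def oddWindingSet (I : Finset ℕ) (γ : ℕ → ℝ → Plane) : Set Plane :=
  {x | x ∉ familyImage I γ ∧ ∃ k : ℤ, ∑ i ∈ I, windingNumber (γ i) x = 2 * (k : ℝ) + 1}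

/-- `{γ i}_{i ∈ I} ∈ G(Ω)`: the finite family is a system of `H²` boundary curves of `Ω`. -/
structure IsBoundarySystem (Ω : Set Plane) (I : Finset ℕ) (γ : ℕ → ℝ → Plane) : Prop where
  memH2 : ∀ i ∈ I, MemH2 (γ i)
  reducedBoundary_subset : reducedBoundary Ω ⊆ familyImage I γ
  essInterior_eq : essInterior Ω = interior (oddWindingSet I γ ∪ familyImage I γ)
  constant_speed : ∀ i ∈ I, ∃ c : ℝ, ∀ t, ‖deriv (γ i) t‖ = c

end

/-! ### Linear algebra and measure theory of the plane -/

/-! Put β = λα. The nonlocal term is the integral over z of exp(-β|z|)/|z| times the area that the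
translation by z moves out of Ω. By the divergence theorem twice this area is at most the sum over
the boundary curves of ∫ |det(γ', z)|. Integrating over all z bounds the nonlocal term by 2/β² times
the total length, so the energy is at least (1 - 1/(2πα²)) times the total length. Since λ²(1 -
1/(2πα²)) → σ > 0, bounded rescaled energy bounds the total length.

Compactness needs more. A translation longer than δ hardly sees the oscillation of an arc shorter
than δ: up to the fraction δ/|z|, arcs may be replaced by their chords
(`abs_integral_segmentAverage_le`). Hence the energy also controls by how much inscribed polygons of
mesh δ = 1/λ are shorter than the curves (`nonlocal_le`, `le_energy`); this total defect is O(λ⁻²).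
The defect measures the oscillation of the tangent at scale 1/λ, so on a curve of length at least
1/λ the tangent smoothed at that scale has bounded Dirichlet energy and is L²-close to the true
tangent (`exists_regularized_tangent`). This replaces a curvature bound and is the source of H²
regularity in the limit.

The smoothed tangent has mean zero, so a Poincaré inequality excludes lengths between 1/λ and a
fixed c. Curves shorter than 1/λ have a degenerate one-chord polygon, so their length is all defect
and their total length is O(λ⁻²) (`short_or_long`). The number of long curves is bounded; along a
subsequence each of them escapes to infinity or converges in H¹ to a regular H² curve
(`exists_subseq_curve`).

The limit curves are tied to the limit set by winding numbers, which add up to χ_Ω off ∂Ω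
(`sum_windingNumber`). Escaping curves contribute 0 in the limit. Short curves contribute 0 in
L¹_loc, because the winding number of a curve of length L is an average of 1/|x - y| times a factor
at most L. Thus χ_{Ω∞} is a.e. the sum of the limit winding numbers
(`ae_indicator_eq_sum_windingNumber`), and the properties of a boundary system follow from the
continuity of that sum off the curves (`isBoundarySystem_of_ae`). -/

theorem plane_inner (a b : Plane) : inner ℝ a b = a 0 * b 0 + a 1 * b 1 := by
  simp [PiLp.inner_apply, Fin.sum_univ_two, mul_comm]

@[simp] theorem perp_apply_zero (y : Plane) : perp y 0 = -(y 1) := rfl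

@[simp] theorem perp_apply_one (y : Plane) : perp y 1 = y 0 := rfl

theorem plane_norm_sq (a : Plane) : ‖a‖ ^ 2 = a 0 ^ 2 + a 1 ^ 2 := by
  rw [← real_inner_self_eq_norm_sq, plane_inner]; ring

theorem perp_add (a b : Plane) : perp (a + b) = perp a + perp b := by
  ext i; fin_cases i <;> simp; ring

theorem perp_smul (c : ℝ) (a : Plane) : perp (c • a) = c • perp a := by
  ext i; fin_cases i <;> simp

/-- The rotation `y ↦ y^⊥` as a continuous linear map. -/
noncomputable def perpL : Plane →L[ℝ] Plane :=
  LinearMap.toContinuousLinearMap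
    { toFun := perp, map_add' := perp_add, map_smul' := perp_smul }

@[simp] theorem perpL_apply (y : Plane) : perpL y = perp y := rfl

theorem continuous_perp : Continuous perp := perpL.continuous

theorem norm_perp (a : Plane) : ‖perp a‖ = ‖a‖ := by
  have h : ‖perp a‖ ^ 2 = ‖a‖ ^ 2 := by rw [plane_norm_sq, plane_norm_sq]; simp; ring
  exact (sq_eq_sq₀ (norm_nonneg _) (norm_nonneg _)).1 h

theorem inner_perp_left (a b : Plane) : inner ℝ (perp a) b = -inner ℝ a (perp b) := by
  rw [plane_inner, plane_inner]; simp

theorem inner_perp_perp (a b : Plane) : inner ℝ (perp a) (perp b) = inner ℝ a b := by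
  rw [plane_inner, plane_inner]; simp; ring

theorem inner_perp_self (a : Plane) : inner ℝ (perp a) a = 0 := by
  rw [plane_inner]; simp; ring

theorem plane_eq_smul_single (v : Plane) :
    v = v 0 • EuclideanSpace.single (0 : Fin 2) (1 : ℝ) +
      v 1 • EuclideanSpace.single (1 : Fin 2) (1 : ℝ) := by
  ext i; fin_cases i <;> simp

/-- Derivation property of the determinant: `det(a,b) tr A = det(A a, b) + det(a, A b)`. -/
theorem inner_perp_mul_trace (A : Plane →L[ℝ] Plane) (a b : Plane) :
    inner ℝ (perp a) b * ∑ i : Fin 2, (A (EuclideanSpace.single i 1)) i =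
      inner ℝ (perp (A a)) b + inner ℝ (perp a) (A b) := by
  have h : ∀ v : Plane, ∀ i, A v i = v 0 * A (EuclideanSpace.single 0 1) i +
      v 1 * A (EuclideanSpace.single 1 1) i := by
    intro v i
    conv_lhs => rw [plane_eq_smul_single v]
    simp
  simp only [plane_inner, perp_apply_zero, perp_apply_one, Fin.sum_univ_two]
  rw [h a 0, h a 1, h b 0, h b 1]
  ring

/-- The measurable identification of the plane with `ℝ × ℝ`. -/
noncomputable def planeEquiv : Plane ≃ᵐ ℝ × ℝ :=
  (MeasurableEquiv.toLp 2 (Fin 2 → ℝ)).symm.trans MeasurableEquiv.finTwoArrow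

@[simp] theorem planeEquiv_apply (x : Plane) : planeEquiv x = (x 0, x 1) := rfl

@[simp] theorem planeEquiv_symm_apply (p : ℝ × ℝ) : planeEquiv.symm p = !₂[p.1, p.2] := by
  rw [MeasurableEquiv.symm_apply_eq]; simp

theorem planeEquiv_volume_preserving : MeasurePreserving planeEquiv volume volume :=
  (volume_preserving_finTwoArrow ℝ).comp
    (EuclideanSpace.volume_preserving_symm_measurableEquiv_toLp (Fin 2))

theorem setIntegral_plane_prod {f : Plane → ℝ} (A B : Set ℝ) :
    ∫ x in {x : Plane | x 0 ∈ A ∧ x 1 ∈ B}, f x = ∫ p in A ×ˢ B, f !₂[p.1, p.2] := by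
  have h := planeEquiv_volume_preserving.setIntegral_preimage_emb
    planeEquiv.measurableEmbedding (fun p => f !₂[p.1, p.2]) (A ×ˢ B)
  rw [← h]
  have e : planeEquiv ⁻¹' A ×ˢ B = {x : Plane | x 0 ∈ A ∧ x 1 ∈ B} := by
    ext x; simp
  rw [e]
  congr 1
  ext x
  congr 1
  ext i; fin_cases i <;> simp

theorem lintegral_plane (f : Plane → ℝ≥0∞) :
    ∫⁻ x, f x = ∫⁻ p : ℝ × ℝ, f !₂[p.1, p.2] := by
  have h := (planeEquiv_volume_preserving.symm).lintegral_comp_emb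
    planeEquiv.symm.measurableEmbedding f
  rw [← h]
  simp


/-! ### The divergence theorem -/

/-- The map `(t, s) ↦ γ t + s n`, on the plane. -/
noncomputable def stripMap (γ : ℝ → Plane) (n : Plane) (x : Plane) : Plane := γ (x 0) + x 1 • n

/-- The differential of `stripMap`. -/
noncomputable def stripDeriv (v n : Plane) : Plane →L[ℝ] Plane :=
  (EuclideanSpace.proj (0 : Fin 2) : Plane →L[ℝ] ℝ).smulRight v +
    (EuclideanSpace.proj (1 : Fin 2) : Plane →L[ℝ] ℝ).smulRight n

theorem stripDeriv_apply (v n x : Plane) : stripDeriv v n x = x 0 • v + x 1 • n := rfl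

theorem stripDeriv_det (v n : Plane) : (stripDeriv v n).det = inner ℝ (perp v) n := by
  have h : (stripDeriv v n).det = LinearMap.det (stripDeriv v n : Plane →ₗ[ℝ] Plane) := rfl
  rw [h, ← LinearMap.det_toMatrix (EuclideanSpace.basisFun (Fin 2) ℝ).toBasis, Matrix.det_fin_two]
  simp [LinearMap.toMatrix_apply, stripDeriv_apply, plane_inner]
  ring

theorem hasStrictFDerivAt_stripMap {γ : ℝ → Plane} (hγ : ContDiff ℝ 1 γ) (n x : Plane) :
    HasStrictFDerivAt (stripMap γ n) (stripDeriv (deriv γ (x 0)) n) x := by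
  have h0 : HasStrictFDerivAt (fun x : Plane => x 0)
      (EuclideanSpace.proj (0 : Fin 2) : Plane →L[ℝ] ℝ) x :=
    (EuclideanSpace.proj (0 : Fin 2) : Plane →L[ℝ] ℝ).hasStrictFDerivAt
  have h1 : HasStrictFDerivAt (fun x : Plane => x 1)
      (EuclideanSpace.proj (1 : Fin 2) : Plane →L[ℝ] ℝ) x :=
    (EuclideanSpace.proj (1 : Fin 2) : Plane →L[ℝ] ℝ).hasStrictFDerivAt
  have hg : HasStrictDerivAt γ (deriv γ (x 0)) (x 0) :=
    (hγ.contDiffAt).hasStrictDerivAt (by norm_num)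
  have h2 := hg.hasStrictFDerivAt.comp x h0
  have h3 := h1.smul_const n
  refine (h2.add h3).congr_fderiv ?_
  ext v i
  simp [stripDeriv]

theorem divergence_eq_trace (X : Plane → Plane) (x : Plane) :
    divergence X x = ∑ i : Fin 2, (fderiv ℝ X x (EuclideanSpace.single i 1)) i := rfl

theorem setIntegral_Ioo_eq_intervalIntegral {f : ℝ → ℝ} {a b : ℝ} (h : a ≤ b) :
    ∫ x in Ioo a b, f x = ∫ x in a..b, f x := by
  rw [intervalIntegral.integral_of_le h, integral_Ioc_eq_integral_Ioo]

/-- The divergence theorem on one side of an arc, for fields vanishing on the rest of the boundary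
of the strip. -/
theorem integral_divergence_strip {γ : ℝ → Plane} (hγ : ContDiff ℝ 1 γ) (n : Plane)
    {t₁ t₂ η : ℝ} (ht : t₁ ≤ t₂) (hη : 0 ≤ η)
    (hinj : ∀ x y : Plane, x 0 ∈ Icc t₁ t₂ → y 0 ∈ Icc t₁ t₂ →
      stripMap γ n x = stripMap γ n y → x = y)
    (hpos : ∀ t ∈ Icc t₁ t₂, 0 < inner ℝ (perp (deriv γ t)) n)
    {X : Plane → Plane} (hX : ContDiff ℝ 1 X)
    (h1 : ∀ s ∈ Icc 0 η, X (γ t₁ + s • n) = 0) (h2 : ∀ s ∈ Icc 0 η, X (γ t₂ + s • n) = 0)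
    (h3 : ∀ t ∈ Icc t₁ t₂, X (γ t + η • n) = 0) :
    ∫ x in stripMap γ n '' {x : Plane | x 0 ∈ Ioo t₁ t₂ ∧ x 1 ∈ Ioo 0 η}, divergence X x =
      -∫ t in t₁..t₂, inner ℝ (perp (deriv γ t)) (X (γ t)) := by
  have hγ' : Continuous (deriv γ) := hγ.continuous_deriv le_rfl
  have hγc : Continuous γ := hγ.continuous
  have hDX : Continuous (fderiv ℝ X) := hX.continuous_fderiv (by norm_num)
  have hmeas : MeasurableSet {x : Plane | x 0 ∈ Ioo t₁ t₂ ∧ x 1 ∈ Ioo 0 η} := by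
    have := planeEquiv.measurable (measurableSet_Ioo.prod measurableSet_Ioo :
      MeasurableSet (Ioo t₁ t₂ ×ˢ Ioo 0 η))
    exact this
  rw [integral_image_eq_integral_abs_det_fderiv_smul volume hmeas
    (f' := fun x => stripDeriv (deriv γ (x 0)) n)
    (fun x _ => (hasStrictFDerivAt_stripMap hγ n x).hasFDerivAt.hasFDerivWithinAt)
    (fun x hx y hy h => hinj x y (Ioo_subset_Icc_self hx.1) (Ioo_subset_Icc_self hy.1) h)]
  -- The Jacobian det(γ', n) times the pulled-back divergence splits as ∂ₜ det(X, n) + ∂ₛ det(γ',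
  -- X), since n is constant and γ' does not depend on s. Only one derivative of γ enters, and each
  -- term is integrated by the fundamental theorem of calculus.
  set P : ℝ → ℝ → ℝ := fun t s => inner ℝ (perp (fderiv ℝ X (γ t + s • n) (deriv γ t))) n with hP
  set Q : ℝ → ℝ → ℝ := fun t s => inner ℝ (perp (deriv γ t)) (fderiv ℝ X (γ t + s • n) n) with hQ
  have hPc : Continuous (Function.uncurry P) := by
    simp only [hP, Function.uncurry_def]
    have : Continuous fun p : ℝ × ℝ => fderiv ℝ X (γ p.1 + p.2 • n) (deriv γ p.1) := by
      refine Continuous.clm_apply (hDX.comp ?_) (hγ'.comp continuous_fst)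
      fun_prop
    exact (continuous_perp.comp this).inner continuous_const
  have hQc : Continuous (Function.uncurry Q) := by
    simp only [hQ, Function.uncurry_def]
    have : Continuous fun p : ℝ × ℝ => fderiv ℝ X (γ p.1 + p.2 • n) n := by
      refine Continuous.clm_apply (hDX.comp ?_) continuous_const
      fun_prop
    exact (continuous_perp.comp (hγ'.comp continuous_fst)).inner this
  have e1 : ∫ x in {x : Plane | x 0 ∈ Ioo t₁ t₂ ∧ x 1 ∈ Ioo 0 η},
      |(stripDeriv (deriv γ (x 0)) n).det| • divergence X (stripMap γ n x) =
      ∫ x in {x : Plane | x 0 ∈ Ioo t₁ t₂ ∧ x 1 ∈ Ioo 0 η}, (P (x 0) (x 1) + Q (x 0) (x 1)) := by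
    refine setIntegral_congr_fun hmeas fun x hx => ?_
    have hp := hpos (x 0) (Ioo_subset_Icc_self hx.1)
    simp only [stripDeriv_det, abs_of_pos hp, smul_eq_mul]
    rw [divergence_eq_trace, inner_perp_mul_trace]
    rfl
  rw [e1, setIntegral_plane_prod (f := fun x => P (x 0) (x 1) + Q (x 0) (x 1))]
  have hsub : Ioo t₁ t₂ ×ˢ Ioo 0 η ⊆ Icc t₁ t₂ ×ˢ Icc 0 η :=
    prod_mono Ioo_subset_Icc_self Ioo_subset_Icc_self
  have hK : IsCompact (Icc t₁ t₂ ×ˢ Icc 0 η) := isCompact_Icc.prod isCompact_Icc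
  have iP : IntegrableOn (Function.uncurry P) (Ioo t₁ t₂ ×ˢ Ioo 0 η) :=
    (hPc.continuousOn.integrableOn_compact hK).mono_set hsub
  have iQ : IntegrableOn (Function.uncurry Q) (Ioo t₁ t₂ ×ˢ Ioo 0 η) :=
    (hQc.continuousOn.integrableOn_compact hK).mono_set hsub
  have e2 : ∫ p in Ioo t₁ t₂ ×ˢ Ioo 0 η,
      (P ((!₂[p.1, p.2] : Plane) 0) ((!₂[p.1, p.2] : Plane) 1) +
        Q ((!₂[p.1, p.2] : Plane) 0) ((!₂[p.1, p.2] : Plane) 1)) =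
      (∫ p in Ioo t₁ t₂ ×ˢ Ioo 0 η, Function.uncurry P p) +
        ∫ p in Ioo t₁ t₂ ×ˢ Ioo 0 η, Function.uncurry Q p := by
    rw [← integral_add iP iQ]
    rfl
  rw [e2]
  have dX : ∀ x, HasFDerivAt X (fderiv ℝ X x) x := fun x =>
    (hX.differentiable (by norm_num) x).hasFDerivAt
  have dγ : ∀ t, HasDerivAt γ (deriv γ t) t := fun t =>
    (hγ.differentiable (by norm_num) t).hasDerivAt
  have eP : ∫ p in Ioo t₁ t₂ ×ˢ Ioo 0 η, Function.uncurry P p = 0 := by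
    rw [Measure.volume_eq_prod] at iP ⊢
    rw [IntegrableOn, ← Measure.prod_restrict] at iP
    rw [← Measure.prod_restrict, integral_prod_symm _ iP]
    refine (setIntegral_congr_fun measurableSet_Ioo (g := fun _ => (0 : ℝ)) fun s hs => ?_).trans
      (by simp)
    simp only [Function.uncurry_apply_pair]
    rw [setIntegral_Ioo_eq_intervalIntegral ht]
    have hd : ∀ t ∈ uIcc t₁ t₂, HasDerivAt (fun t => inner ℝ (perp (X (γ t + s • n))) n) (P t s) t := by
      intro t _
      have a1 : HasDerivAt (fun t => γ t + s • n) (deriv γ t) t := (dγ t).add_const _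
      have a2 := (dX (γ t + s • n)).comp_hasDerivAt t a1
      have a3 := perpL.hasFDerivAt.comp_hasDerivAt t a2
      have a4 := a3.inner ℝ (hasDerivAt_const t n)
      simpa [hP, Function.comp_def] using a4
    rw [intervalIntegral.integral_eq_sub_of_hasDerivAt hd]
    · rw [h1 s (Ioo_subset_Icc_self hs), h2 s (Ioo_subset_Icc_self hs), sub_self]
    · exact (hPc.comp (continuous_id.prodMk continuous_const)).intervalIntegrable _ _
  have eQ : ∫ p in Ioo t₁ t₂ ×ˢ Ioo 0 η, Function.uncurry Q p =
      -∫ t in t₁..t₂, inner ℝ (perp (deriv γ t)) (X (γ t)) := by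
    rw [Measure.volume_eq_prod] at iQ ⊢
    rw [setIntegral_prod _ iQ, ← setIntegral_Ioo_eq_intervalIntegral ht, ← integral_neg]
    refine setIntegral_congr_fun measurableSet_Ioo fun t ht' => ?_
    simp only [Function.uncurry_apply_pair]
    rw [setIntegral_Ioo_eq_intervalIntegral hη]
    have hd : ∀ s ∈ uIcc 0 η,
        HasDerivAt (fun s => inner ℝ (perp (deriv γ t)) (X (γ t + s • n))) (Q t s) s := by
      intro s _
      have a1 : HasDerivAt (fun s : ℝ => γ t + s • n) n s := by
        simpa using ((hasDerivAt_id s).smul_const n).const_add (γ t)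
      have a2 := (dX (γ t + s • n)).comp_hasDerivAt s a1
      have a4 := (hasDerivAt_const s (perp (deriv γ t))).inner ℝ a2
      simpa [hQ, Function.comp_def] using a4
    rw [intervalIntegral.integral_eq_sub_of_hasDerivAt hd]
    · rw [h3 t (Ioo_subset_Icc_self ht')]; simp
    · exact (hQc.comp (continuous_const.prodMk continuous_id)).intervalIntegrable _ _
  rw [eP, eQ, zero_add]

theorem inter_frontier_nonempty_of_isPreconnected {E : Type*} [TopologicalSpace E] {s t : Set E}
    (hs : IsPreconnected s) (h1 : (s ∩ t).Nonempty) (h2 : (s ∩ tᶜ).Nonempty) :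
    (s ∩ frontier t).Nonempty := by
  by_contra hcon
  rw [not_nonempty_iff_eq_empty] at hcon
  have hmem : ∀ x ∈ s, x ∈ closure t → x ∈ interior t := fun x hx hc => by
    by_contra hi
    exact hcon.subset ⟨hx, hc, hi⟩
  obtain ⟨x, hx, hxt⟩ := h1
  obtain ⟨y, hy, hyt⟩ := h2
  obtain ⟨z, -, hz1, hz2⟩ := hs (interior t) (closure t)ᶜ isOpen_interior
    isClosed_closure.isOpen_compl
    (fun z hz => by
      by_cases hc : z ∈ closure t
      · exact Or.inl (hmem z hz hc)
      · exact Or.inr hc)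
    ⟨x, hx, hmem x hx (subset_closure hxt)⟩
    ⟨y, hy, fun hc => hyt (interior_subset (hmem y hy hc))⟩
  exact hz2 (subset_closure (interior_subset hz1))

namespace IsBoundaryDecomposition

variable {Ω : Set Plane} {N : ℕ} {γ : ℕ → ℝ → Plane}

theorem contDiff_one (h : IsBoundaryDecomposition Ω N γ) {i : ℕ} (hi : i < N) :
    ContDiff ℝ 1 (γ i) := (h.smooth i hi).of_le (by norm_cast)

theorem continuous_deriv (h : IsBoundaryDecomposition Ω N γ) {i : ℕ} (hi : i < N) :
    Continuous (deriv (γ i)) := (h.contDiff_one hi).continuous_deriv le_rfl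

theorem mem_curveImage (h : IsBoundaryDecomposition Ω N γ) {i : ℕ} (hi : i < N) (t : ℝ) :
    γ i t ∈ curveImage (γ i) := by
  refine ⟨Int.fract t, ⟨Int.fract_nonneg t, (Int.fract_lt_one t).le⟩, ?_⟩
  have := (h.periodic i hi).sub_zsmul_eq (x := t) ⌊t⌋
  rwa [zsmul_one] at this

theorem mem_frontier (h : IsBoundaryDecomposition Ω N γ) {i : ℕ} (hi : i < N) (t : ℝ) :
    γ i t ∈ frontier Ω := by
  rw [h.boundary]
  exact mem_iUnion₂.2 ⟨i, hi, h.mem_curveImage hi t⟩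

theorem exists_int_of_eq (h : IsBoundaryDecomposition Ω N γ) {i : ℕ} (hi : i < N) {s t : ℝ}
    (hst : γ i s = γ i t) : ∃ k : ℤ, s = t + k := by
  have e : ∀ t, γ i (Int.fract t) = γ i t := fun t => by
    have := (h.periodic i hi).sub_zsmul_eq (x := t) ⌊t⌋
    rwa [zsmul_one] at this
  have h1 := h.simple i hi ⟨Int.fract_nonneg s, Int.fract_lt_one s⟩
    ⟨Int.fract_nonneg t, Int.fract_lt_one t⟩ (by rw [e, e, hst])
  refine ⟨⌊s⌋ - ⌊t⌋, ?_⟩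
  push_cast
  have a := Int.fract_add_floor s
  have b := Int.fract_add_floor t
  linarith

theorem isCompact_curveImage (h : IsBoundaryDecomposition Ω N γ) {i : ℕ} (hi : i < N) :
    IsCompact (curveImage (γ i)) := isCompact_Icc.image (h.smooth i hi).continuous

/-- The divergence theorem for fields supported near a boundary point. -/
theorem integral_divergence_of_tsupport_subset_nhds (h : IsBoundaryDecomposition Ω N γ)
    (hΩ : IsOpen Ω) {i : ℕ} (hi : i < N) (t₀ : ℝ) :
    ∃ W ∈ 𝓝 (γ i t₀), ∀ X : Plane → Plane, ContDiff ℝ 1 X → tsupport X ⊆ W →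
      ∫ x in Ω, divergence X x =
        -∑ j ∈ Finset.range N, ∫ t in (0 : ℝ)..1, inner ℝ (perp (deriv (γ j) t)) (X (γ j t)) := by
  set g := γ i with hg
  have hg1 : ContDiff ℝ 1 g := h.contDiff_one hi
  have hgc : Continuous g := hg1.continuous
  have hg' : Continuous (deriv g) := h.continuous_deriv hi
  set e := deriv g t₀ with he
  -- The strip is swept in the fixed direction n, not along the varying normal. Sliding along n
  -- leaves ⟨·, e⟩ unchanged, while ⟨γ, e⟩ is strictly increasing near t₀; this makes the strip
  -- coordinates injective.
  set n := perp e with hn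
  have hepos : 0 < inner ℝ (deriv g t₀) e := by
    rw [← he, real_inner_self_eq_norm_sq]
    have := h.regular i hi t₀
    positivity
  have hev : ∀ᶠ t in 𝓝 t₀, 0 < inner ℝ (deriv g t) e :=
    (hg'.inner continuous_const).continuousAt.eventually_const_lt hepos
  obtain ⟨ε₁, hε₁, hε₁'⟩ := Metric.eventually_nhds_iff.1 hev
  obtain ⟨ε₀, hε₀, hε₀h, hε₀pos⟩ : ∃ ε₀ : ℝ, 0 < ε₀ ∧ ε₀ < 1 / 2 ∧
      ∀ t ∈ Icc (t₀ - ε₀) (t₀ + ε₀), 0 < inner ℝ (deriv g t) e := by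
    refine ⟨min (ε₁ / 2) (1 / 4), by positivity, by
      linarith [min_le_right (ε₁ / 2) (1 / 4 : ℝ)], fun t ht => hε₁' ?_⟩
    rw [Real.dist_eq, abs_lt]
    have := min_le_left (ε₁ / 2) (1 / 4 : ℝ)
    constructor <;> linarith [ht.1, ht.2]
  have hmono : StrictMonoOn (fun t => inner ℝ (g t) e) (Icc (t₀ - ε₀) (t₀ + ε₀)) := by
    refine strictMonoOn_of_deriv_pos (convex_Icc _ _)
      (hgc.inner continuous_const).continuousOn fun t ht => ?_
    rw [interior_Icc] at ht
    have hd : HasDerivAt (fun t => inner ℝ (g t) e) (inner ℝ (deriv g t) e) t := by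
      simpa using ((hg1.differentiable (by norm_num) t).hasDerivAt.inner ℝ (hasDerivAt_const t e))
    rw [hd.deriv]
    exact hε₀pos t (Ioo_subset_Icc_self ht)
  have hn0 : n ≠ 0 := by
    rw [hn, ← norm_ne_zero_iff, norm_perp, norm_ne_zero_iff]
    exact h.regular i hi t₀
  have hinj : ∀ x y : Plane, x 0 ∈ Icc (t₀ - ε₀) (t₀ + ε₀) → y 0 ∈ Icc (t₀ - ε₀) (t₀ + ε₀) →
      stripMap g n x = stripMap g n y → x = y := by
    intro x y hx hy hxy
    have h1 : inner ℝ (g (x 0)) e = inner ℝ (g (y 0)) e := by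
      have := congrArg (fun z => inner ℝ z e) hxy
      simpa [stripMap, inner_add_left, inner_smul_left, hn, inner_perp_self] using this
    have h0 : x 0 = y 0 := hmono.injOn hx hy h1
    have h2 : x 1 • n = y 1 • n := by
      have := hxy
      simp only [stripMap, h0] at this
      exact add_left_cancel this
    have h3 : x 1 = y 1 := smul_left_injective ℝ hn0 h2
    ext k; fin_cases k
    · exact h0
    · exact h3
  -- a neighbourhood meeting the boundary only in the arc
  set C : Set Plane := (⋃ j ∈ (Finset.range N).erase i, curveImage (γ j)) ∪
    g '' Icc (t₀ + ε₀) (t₀ + 1 - ε₀) with hC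
  have hCc : IsCompact C := by
    refine IsCompact.union ?_ (isCompact_Icc.image hgc)
    refine Finset.isCompact_biUnion _ fun j hj => h.isCompact_curveImage ?_
    exact Finset.mem_range.1 (Finset.mem_of_mem_erase hj)
  have hpC : g t₀ ∉ C := by
    rintro (hp | ⟨t, ht, hp⟩)
    · obtain ⟨j, hj, hp⟩ := mem_iUnion₂.1 hp
      obtain ⟨hji, hj⟩ := Finset.mem_erase.1 hj
      exact disjoint_left.1 (h.disjoint j (Finset.mem_range.1 hj) i hi hji) hp
        (h.mem_curveImage hi t₀)
    · obtain ⟨k, hk⟩ := h.exists_int_of_eq hi hp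
      have a1 : (0 : ℝ) < k := by linarith [ht.1]
      have a2 : (k : ℝ) < 1 := by linarith [ht.2]
      have a3 : 0 < k := by exact_mod_cast a1
      have a4 : k < 1 := by exact_mod_cast a2
      omega
  have hfr : ∀ y ∈ frontier Ω, y ∉ C → ∃ t ∈ Ioo (t₀ - ε₀) (t₀ + ε₀), g t = y := by
    intro y hy hyC
    rw [h.boundary] at hy
    obtain ⟨j, hj, t, ht, rfl⟩ := mem_iUnion₂.1 hy
    have hji : j = i := by
      by_contra hji
      exact hyC (Or.inl (mem_iUnion₂.2
        ⟨j, Finset.mem_erase.2 ⟨hji, Finset.mem_range.2 hj⟩, t, ht, rfl⟩))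
    subst hji
    obtain ⟨k, hk, -⟩ := existsUnique_add_zsmul_mem_Ico (zero_lt_one' ℝ) t (t₀ - ε₀)
    have hper : g (t + k • (1 : ℝ)) = g t := (h.periodic j hi).zsmul k t
    refine ⟨t + k • (1 : ℝ), ⟨?_, ?_⟩, hper⟩
    -- The left end t₀ - ε₀ gives the same point as t₀ + 1 - ε₀, which is the right end of the
    -- complementary arc and so lies in C.
    · refine lt_of_le_of_ne hk.1 fun heq => hyC (Or.inr ⟨t₀ - ε₀ + 1, ⟨by linarith, by linarith⟩, ?_⟩)
      rw [hg, h.periodic j hi, heq]; exact hper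
    · by_contra hlt
      refine hyC (Or.inr ⟨_, ⟨not_lt.1 hlt, ?_⟩, hper⟩)
      linarith [hk.2]
  have hcont : Continuous (fun p : ℝ × ℝ => g p.1 + p.2 • n) := by fun_prop
  have hV : ∀ᶠ p in 𝓝 ((t₀, 0) : ℝ × ℝ), g p.1 + p.2 • n ∉ C := by
    refine hcont.continuousAt.eventually (hCc.isClosed.isOpen_compl.mem_nhds ?_)
    simpa using hpC
  obtain ⟨ε₂, hε₂, hball⟩ := Metric.eventually_nhds_iff.1 hV
  obtain ⟨ε, hε, hεε₀, hεC⟩ : ∃ ε : ℝ, 0 < ε ∧ ε < ε₀ ∧ ∀ t ∈ Ioo (t₀ - ε) (t₀ + ε),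
      ∀ s ∈ Ioo (-ε) ε, g t + s • n ∉ C := by
    refine ⟨min (ε₀ / 2) ε₂, by positivity, by
      linarith [min_le_left (ε₀ / 2) ε₂], fun t ht s hs => hball (y := (t, s)) ?_⟩
    have := min_le_right (ε₀ / 2) ε₂
    rw [Prod.dist_eq, max_lt_iff, Real.dist_eq, Real.dist_eq, abs_lt, abs_lt]
    refine ⟨⟨?_, ?_⟩, ⟨?_, ?_⟩⟩ <;> simp only <;> linarith [ht.1, ht.2, hs.1, hs.2]
  have hsubIcc : Icc (t₀ - ε) (t₀ + ε) ⊆ Icc (t₀ - ε₀) (t₀ + ε₀) :=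
    Icc_subset_Icc (by linarith) (by linarith)
  have hkey : ∀ t ∈ Ioo (t₀ - ε) (t₀ + ε), ∀ s ∈ Ioo (-ε) ε, g t + s • n ∈ frontier Ω → s = 0 := by
    intro t ht s hs hf
    obtain ⟨t', ht', heq⟩ := hfr _ hf (hεC t ht s hs)
    have := hinj !₂[t, s] !₂[t', 0] (hsubIcc (Ioo_subset_Icc_self ht)) (Ioo_subset_Icc_self ht')
      (by simp [stripMap, heq])
    simpa using congrArg (fun v : Plane => v 1) this
  have hor := h.oriented i hi t₀
  obtain ⟨s₀, ⟨hs₀1, hs₀2⟩, hs₀0, hs₀ε⟩ :=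
    (hor.and (Ioo_mem_nhdsGT hε)).exists
  -- The half box s > 0 is connected and misses the boundary, and the orientation puts one of its
  -- points inside Ω. The half box s < 0 is treated likewise.
  have hup : ∀ t ∈ Ioo (t₀ - ε) (t₀ + ε), ∀ s ∈ Ioo 0 ε, g t + s • n ∈ Ω := by
    have hconn : IsPreconnected ((fun p : ℝ × ℝ => g p.1 + p.2 • n) ''
        (Ioo (t₀ - ε) (t₀ + ε) ×ˢ Ioo 0 ε)) :=
      (isPreconnected_Ioo.prod isPreconnected_Ioo).image _ hcont.continuousOn
    intro t ht s hs
    by_contra hcon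
    obtain ⟨y, ⟨⟨t', s'⟩, ⟨ht', hs'⟩, rfl⟩, hyf⟩ := inter_frontier_nonempty_of_isPreconnected hconn (t := Ω)
      ⟨_, ⟨(t₀, s₀), ⟨⟨by simp; linarith, by simp; linarith⟩, hs₀0, hs₀ε⟩, rfl⟩, hs₀2⟩
      ⟨_, ⟨(t, s), ⟨ht, hs⟩, rfl⟩, hcon⟩
    have := hkey t' ht' s' ⟨by linarith [hs'.1], hs'.2⟩ hyf
    exact hs'.1.ne' this
  have hdown : ∀ t ∈ Ioo (t₀ - ε) (t₀ + ε), ∀ s ∈ Ioo (-ε) 0, g t + s • n ∉ Ω := by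
    have hconn : IsPreconnected ((fun p : ℝ × ℝ => g p.1 + p.2 • n) ''
        (Ioo (t₀ - ε) (t₀ + ε) ×ˢ Ioo (-ε) 0)) :=
      (isPreconnected_Ioo.prod isPreconnected_Ioo).image _ hcont.continuousOn
    intro t ht s hs hcon
    obtain ⟨y, ⟨⟨t', s'⟩, ⟨ht', hs'⟩, rfl⟩, hyf⟩ := inter_frontier_nonempty_of_isPreconnected hconn (t := Ω)
      ⟨_, ⟨(t, s), ⟨ht, hs⟩, rfl⟩, hcon⟩
      ⟨_, ⟨(t₀, -s₀), ⟨⟨by simp; linarith, by simp; linarith⟩, by simp; linarith,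
        by simpa using hs₀0⟩, rfl⟩, by
        simp only [mem_compl_iff, neg_smul, ← sub_eq_add_neg]; exact hs₀1⟩
    have := hkey t' ht' s' ⟨hs'.1, by linarith [hs'.2]⟩ hyf
    exact hs'.2.ne this
  set Q : Set Plane := {x : Plane | x 0 ∈ Ioo (t₀ - ε) (t₀ + ε) ∧ x 1 ∈ Ioo (-ε) ε} with hQ
  have hQo : IsOpen Q := by
    have c0 : Continuous fun x : Plane => x 0 := by fun_prop
    have c1 : Continuous fun x : Plane => x 1 := by fun_prop
    exact (isOpen_Ioo.preimage c0).inter (isOpen_Ioo.preimage c1)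
  set x₀ : Plane := !₂[t₀, 0] with hx₀
  have hx₀Q : x₀ ∈ Q := by
    refine ⟨⟨?_, ?_⟩, ⟨?_, ?_⟩⟩ <;> simp [hx₀, hε]
  have hΨx₀ : stripMap g n x₀ = g t₀ := by simp [stripMap, hx₀]
  have hW : stripMap g n '' Q ∈ 𝓝 (g t₀) := by
    have hdet : (stripDeriv (deriv g t₀) n).det ≠ 0 := by
      rw [stripDeriv_det, hn, inner_perp_perp]; exact hepos.ne'
    have hs := hasStrictFDerivAt_stripMap hg1 n x₀
    have hsurj : (stripDeriv (deriv g (x₀ 0)) n).range = ⊤ := by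
      rw [LinearMap.range_eq_top]
      have : IsUnit (LinearMap.det (stripDeriv (deriv g t₀) n : Plane →ₗ[ℝ] Plane)) :=
        isUnit_iff_ne_zero.2 hdet
      exact (LinearMap.equivOfDetNeZero _ this.ne_zero).surjective
    have := hs.map_nhds_eq_of_surj hsurj
    rw [← hΨx₀, ← this]
    exact image_mem_map (hQo.mem_nhds hx₀Q)
  refine ⟨_, hW, fun X hX hXW => ?_⟩
  have hXout : ∀ y, y ∉ stripMap g n '' Q → X y = 0 := fun y hy =>
    image_eq_zero_of_notMem_tsupport fun hy' => hy (hXW hy')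
  have hdivout : ∀ y, y ∉ stripMap g n '' Q → divergence X y = 0 := by
    intro y hy
    have : fderiv ℝ X y = 0 := by
      by_contra hne
      exact hy (hXW (support_fderiv_subset ℝ hne))
    simp [divergence, this]
  have hnotQ : ∀ t ∈ Icc (t₀ - ε) (t₀ + ε), ∀ s : ℝ,
      ¬(t ∈ Ioo (t₀ - ε) (t₀ + ε) ∧ s ∈ Ioo (-ε) ε) → X (g t + s • n) = 0 := by
    intro t ht s hts
    refine hXout _ ?_
    rintro ⟨x, hx, hxeq⟩
    have := hinj x !₂[t, s] (hsubIcc (Ioo_subset_Icc_self hx.1)) (hsubIcc ht)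
      (by rw [hxeq]; simp [stripMap])
    rw [this] at hx
    exact hts hx
  set Qp : Set Plane := {x : Plane | x 0 ∈ Ioo (t₀ - ε) (t₀ + ε) ∧ x 1 ∈ Ioo 0 ε} with hQp
  have hle : t₀ - ε ≤ t₀ + ε := by linarith
  have hstrip := integral_divergence_strip hg1 n hle hε.le
    (fun x y hx hy => hinj x y (hsubIcc hx) (hsubIcc hy))
    (fun t ht => by rw [hn, inner_perp_perp]; exact hε₀pos t (hsubIcc ht)) hX
    (fun s _ => hnotQ _ (left_mem_Icc.2 hle) s (by simp))
    (fun s _ => hnotQ _ (right_mem_Icc.2 hle) s (by simp))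
    (fun t ht => hnotQ t ht ε (by simp))
  have hset : ∫ x in Ω, divergence X x = ∫ x in stripMap g n '' Qp, divergence X x := by
    symm
    have hsub : stripMap g n '' Qp ⊆ Ω := by
      rintro _ ⟨x, hx, rfl⟩; exact hup _ hx.1 _ hx.2
    refine (setIntegral_eq_of_subset_of_forall_sdiff_eq_zero hΩ.measurableSet hsub ?_).symm
    rintro y ⟨hyΩ, hy⟩
    refine hdivout y ?_
    rintro ⟨x, hx, rfl⟩
    rcases lt_trichotomy (x 1) 0 with h1 | h1 | h1
    · exact hdown _ hx.1 _ ⟨hx.2.1, h1⟩ hyΩ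
    · have hf : g (x 0) ∈ frontier Ω := h.mem_frontier hi _
      have : stripMap g n x = g (x 0) := by simp [stripMap, h1]
      rw [this] at hyΩ
      exact (hΩ.inter_frontier_eq.subset ⟨hyΩ, hf⟩).elim
    · exact hy ⟨x, ⟨hx.1, h1, hx.2.2⟩, rfl⟩
  rw [hset, hstrip, Finset.sum_eq_single_of_mem i (Finset.mem_range.2 hi)]
  · congr 1
    have hper : Function.Periodic (fun t => inner ℝ (perp (deriv g t)) (X (g t))) 1 := by
      intro t
      have hd : deriv g (t + 1) = deriv g t := by
        rw [← deriv_comp_add_const]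
        congr 1
        ext1 s
        exact h.periodic i hi s
      have hp : g (t + 1) = g t := h.periodic i hi t
      simp only [hd, hp]
    -- Centring the period at t₀ makes it contain the short arc; a parameter in it whose image lies
    -- on that arc differs from the arc's parameter by an integer in (-1, 1).
    have e1 := hper.intervalIntegral_add_eq 0 (t₀ - 1 / 2)
    simp only [zero_add] at e1
    rw [← hg, e1, intervalIntegral.integral_of_le hle, intervalIntegral.integral_of_le (by linarith)]
    refine (setIntegral_eq_of_subset_of_forall_sdiff_eq_zero measurableSet_Ioc
      (Ioc_subset_Ioc (by linarith) (by linarith)) ?_).symm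
    rintro t ⟨ht, ht'⟩
    rw [hXout (g t), inner_zero_right]
    rintro ⟨x, hx, hxeq⟩
    have hf : stripMap g n x ∈ frontier Ω := by rw [hxeq]; exact h.mem_frontier hi t
    have h10 := hkey _ hx.1 _ hx.2 hf
    have : g (x 0) = g t := by rw [← hxeq]; simp [stripMap, h10]
    obtain ⟨k, hk⟩ := h.exists_int_of_eq hi this
    have hx1 := hx.1.1
    have hx2 := hx.1.2
    have a1 : (-1 : ℝ) < k := by linarith [ht.2]
    have a2 : (k : ℝ) < 1 := by linarith [ht.1]
    have a3 : -1 < k := by exact_mod_cast a1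
    have a4 : k < 1 := by exact_mod_cast a2
    have a5 : k = 0 := by omega
    rw [a5] at hk
    refine ht' ⟨?_, ?_⟩ <;> simp at hk <;> linarith
  · intro j hj hji
    refine intervalIntegral.integral_zero_ae (Eventually.of_forall fun t _ => ?_)
    rw [hXout (γ j t), inner_zero_right]
    rintro ⟨x, hx, hxeq⟩
    refine hεC _ hx.1 _ hx.2 (Or.inl (mem_iUnion₂.2 ⟨j, Finset.mem_erase.2 ⟨hji, hj⟩, ?_⟩))
    change stripMap g n x ∈ _
    rw [hxeq]
    exact h.mem_curveImage (Finset.mem_range.1 hj) t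

end IsBoundaryDecomposition


/-! ### From local to global divergence theorem by a partition of unity. -/

theorem divergence_eq_zero_of_notMem_tsupport {X : Plane → Plane} {x : Plane}
    (hx : x ∉ tsupport X) : divergence X x = 0 := by
  have : fderiv ℝ X x = 0 := by
    by_contra hne
    exact hx (support_fderiv_subset ℝ hne)
  simp [divergence, this]

theorem continuous_divergence {X : Plane → Plane} (hX : ContDiff ℝ 1 X) :
    Continuous (divergence X) := by
  have hDX : Continuous (fderiv ℝ X) := hX.continuous_fderiv (by norm_num)
  unfold divergence
  refine continuous_finsetSum _ fun i _ => ?_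
  have : Continuous fun x => fderiv ℝ X x (EuclideanSpace.single i 1) :=
    hDX.clm_apply continuous_const
  fun_prop

theorem integrable_divergence {X : Plane → Plane} (hX : ContDiff ℝ 1 X)
    (hc : HasCompactSupport X) : Integrable (divergence X) := by
  refine (continuous_divergence hX).integrable_of_hasCompactSupport ?_
  exact HasCompactSupport.intro hc fun x hx => divergence_eq_zero_of_notMem_tsupport hx

/-- The support lies in an open square, which is itself a strip over a straight segment; the field
vanishes on all four sides, so the strip formula has no boundary term. -/
theorem integral_divergence_eq_zero {X : Plane → Plane} (hX : ContDiff ℝ 1 X)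
    (hc : HasCompactSupport X) : ∫ x, divergence X x = 0 := by
  obtain ⟨R, hR0, hR⟩ := hc.isBounded.subset_ball_lt 0 (0 : Plane)
  have hcoord : ∀ (x : Plane) (i : Fin 2), |x i| ≤ ‖x‖ := fun x i => PiLp.norm_apply_le x i
  have hout : ∀ (x : Plane) (i : Fin 2), R ≤ |x i| → x ∉ tsupport X := by
    intro x i hi hx
    have := hR hx
    rw [Metric.mem_ball, dist_zero_right] at this
    linarith [hcoord x i]
  have hX0 : ∀ (x : Plane) (i : Fin 2), R ≤ |x i| → X x = 0 := fun x i hi =>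
    image_eq_zero_of_notMem_tsupport (hout x i hi)
  set n : Plane := EuclideanSpace.single (1 : Fin 2) (1 : ℝ) with hn
  set c : Plane := EuclideanSpace.single (1 : Fin 2) (-R) with hcdef
  set e : Plane := EuclideanSpace.single (0 : Fin 2) (1 : ℝ) with he
  set g : ℝ → Plane := fun t => t • e + c with hg
  have hg1 : ContDiff ℝ 1 g := by fun_prop
  have hgd : ∀ t, deriv g t = e := fun t => by
    have : HasDerivAt g ((1 : ℝ) • e) t := ((hasDerivAt_id t).smul_const e).add_const c
    simpa using this.deriv
  have hc0 : ∀ t s : ℝ, (g t + s • n) 0 = t := fun t s => by simp [hg, he, hcdef, hn]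
  have hc1 : ∀ t s : ℝ, (g t + s • n) 1 = -R + s := fun t s => by simp [hg, he, hcdef, hn]
  have h := integral_divergence_strip hg1 n (t₁ := -R) (t₂ := R) (η := 2 * R) (by linarith)
    (by linarith)
    (fun x y _ _ hxy => by
      ext i; fin_cases i
      · have := congrArg (fun v : Plane => v 0) hxy
        simp only [stripMap, hc0] at this
        exact this
      · have := congrArg (fun v : Plane => v 1) hxy
        simp only [stripMap, hc1, add_right_inj] at this
        exact this)
    (fun t _ => by rw [hgd]; simp [plane_inner, he, hn]) hX
    (fun s _ => hX0 _ 0 (by rw [hc0, abs_neg]; exact le_abs_self R))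
    (fun s _ => hX0 _ 0 (by rw [hc0]; exact le_abs_self R))
    (fun t _ => hX0 _ 1 (by rw [hc1]; exact le_trans (by linarith) (le_abs_self _)))
  have hr : ∫ t in (-R)..R, inner ℝ (perp (deriv g t)) (X (g t)) = 0 := by
    refine intervalIntegral.integral_zero_ae (Eventually.of_forall fun t _ => ?_)
    have : X (g t) = 0 := hX0 _ 1 (by
      have := hc1 t 0
      rw [zero_smul, add_zero, add_zero] at this
      rw [this, abs_neg]; exact le_abs_self R)
    rw [this, inner_zero_right]
  rw [hr, neg_zero] at h
  rw [← h]
  symm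
  refine setIntegral_eq_integral_of_forall_compl_eq_zero fun x hx => ?_
  refine divergence_eq_zero_of_notMem_tsupport fun hxs => hx ?_
  have h0 : |x 0| < R := not_le.1 fun hcon => hout x 0 hcon hxs
  have h1 : |x 1| < R := not_le.1 fun hcon => hout x 1 hcon hxs
  rw [abs_lt] at h0 h1
  refine ⟨!₂[x 0, x 1 + R], ⟨⟨by simpa using h0.1, by simpa using h0.2⟩, ⟨?_, ?_⟩⟩, ?_⟩
  · simp; linarith
  · simp; linarith
  · ext i; fin_cases i
    · exact hc0 _ _
    · refine (hc1 _ _).trans ?_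
      simp

theorem divergence_sum {ι : Type*} (s : Finset ι) (X : ι → Plane → Plane) {x : Plane}
    (hX : ∀ i ∈ s, DifferentiableAt ℝ (X i) x) :
    divergence (fun y => ∑ i ∈ s, X i y) x = ∑ i ∈ s, divergence (X i) x := by
  simp only [divergence]
  rw [fderiv_fun_sum hX, Finset.sum_comm]
  refine Finset.sum_congr rfl fun i _ => ?_
  simp

theorem exists_partitionOfUnity {K : Set Plane} (hK : IsClosed K)
    (W : Plane → Set Plane) (hWo : ∀ p, IsOpen (W p)) (hKW : K ⊆ ⋃ p, W p) :
    ∃ f : Plane → Plane → ℝ, (∀ i, ContDiff ℝ 1 (f i)) ∧ (∀ i, tsupport (f i) ⊆ W i) ∧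
      ∀ x ∈ K, ∑ᶠ i, f i x = 1 := by
  obtain ⟨f, hf⟩ := SmoothPartitionOfUnity.exists_isSubordinate (modelWithCornersSelf ℝ Plane)
    hK W hWo hKW
  exact ⟨fun i => f i, fun i => ((f i).contMDiff.contDiff).of_le (by norm_cast), fun i => hf i,
    fun x hx => f.sum_eq_one hx⟩

/-- A compactly supported `C¹` field is a finite sum of fields subordinate to an open cover. -/
theorem exists_sum_eq_of_isOpen_cover {X : Plane → Plane} (hX : ContDiff ℝ 1 X)
    (hc : HasCompactSupport X) (W : Plane → Set Plane) (hWo : ∀ p, IsOpen (W p))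
    (hWp : ∀ p, p ∈ W p) :
    ∃ (T : Finset Plane) (Y : Plane → Plane → Plane), (∀ i, ContDiff ℝ 1 (Y i)) ∧
      (∀ i, HasCompactSupport (Y i) ∧ tsupport (Y i) ⊆ W i) ∧ ∀ x, X x = ∑ i ∈ T, Y i x := by
  obtain ⟨T, hT⟩ := hc.isCompact.elim_finite_subcover W hWo
    fun x _ => mem_iUnion.2 ⟨x, hWp x⟩
  -- Emptying the sets whose index is outside T forces the corresponding functions to vanish, so
  -- that the locally finite sum is a sum over T.
  obtain ⟨f, hfd, hf, hf1⟩ := exists_partitionOfUnity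
    (isClosed_tsupport X) (fun i : Plane => {x | i ∈ T ∧ x ∈ W i})
    (fun i => isOpen_const.and (hWo i))
    (fun x hx => by
      obtain ⟨i, hi, hxi⟩ := mem_iUnion₂.1 (hT hx)
      exact mem_iUnion.2 ⟨i, hi, hxi⟩)
  have hf0 : ∀ i x, i ∉ T → f i x = 0 := fun i x hi =>
    image_eq_zero_of_notMem_tsupport fun hx => hi (hf i hx).1
  refine ⟨T, fun i x => f i x • X x, fun i => (hfd i).smul hX, fun i =>
    ⟨HasCompactSupport.intro hc fun x hx => ?_, ?_⟩, fun x => ?_⟩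
  · simp only [image_eq_zero_of_notMem_tsupport hx, smul_zero]
  · refine subset_trans (closure_mono fun x hx => ?_) ((hf i).trans fun x hx => hx.2)
    rw [Function.mem_support] at hx ⊢
    intro h0; exact hx (by simp [h0])
  · rw [← Finset.sum_smul]
    by_cases hx : x ∈ tsupport X
    · have := hf1 x hx
      rw [finsum_eq_sum_of_support_subset _ (s := T) (fun i hi => by
        by_contra hiT
        exact hi (hf0 i x hiT))] at this
      rw [this, one_smul]
    · simp only [image_eq_zero_of_notMem_tsupport hx, smul_zero]

namespace IsBoundaryDecomposition

variable {Ω : Set Plane} {N : ℕ} {γ : ℕ → ℝ → Plane}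

/-- The divergence theorem for fields supported near a given point. -/
theorem exists_isOpen_integral_divergence (h : IsBoundaryDecomposition Ω N γ)
    (hΩ : IsOpen Ω) (p : Plane) : ∃ W : Set Plane, IsOpen W ∧ p ∈ W ∧ ∀ X : Plane → Plane,
      ContDiff ℝ 1 X → HasCompactSupport X → tsupport X ⊆ W → ∫ x in Ω, divergence X x =
        -∑ j ∈ Finset.range N,
          ∫ t in (0 : ℝ)..1, inner ℝ (perp (deriv (γ j) t)) (X (γ j t)) := by
  by_cases hp : p ∈ frontier Ω
  · have hp' := hp
    rw [h.boundary] at hp'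
    obtain ⟨i, hi, t, -, rfl⟩ := mem_iUnion₂.1 hp'
    obtain ⟨W, hW, hWX⟩ := h.integral_divergence_of_tsupport_subset_nhds hΩ hi t
    obtain ⟨V, hVW, hV, hpV⟩ := mem_nhds_iff.1 hW
    exact ⟨V, hV, hpV, fun X hX _ hXV => hWX X hX (hXV.trans hVW)⟩
  · have hzero : ∀ X : Plane → Plane, tsupport X ⊆ (frontier Ω)ᶜ → ∑ j ∈ Finset.range N,
        ∫ t in (0 : ℝ)..1, inner ℝ (perp (deriv (γ j) t)) (X (γ j t)) = 0 := by
      intro X hXs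
      refine Finset.sum_eq_zero fun j hj => ?_
      refine intervalIntegral.integral_zero_ae (Eventually.of_forall fun t _ => ?_)
      rw [image_eq_zero_of_notMem_tsupport fun hmem =>
        hXs hmem (h.mem_frontier (Finset.mem_range.1 hj) t), inner_zero_right]
    by_cases hpΩ : p ∈ Ω
    · refine ⟨Ω, hΩ, hpΩ, fun X hX hc hXΩ => ?_⟩
      rw [hzero X (hXΩ.trans fun x hx hf => (hΩ.inter_frontier_eq.subset ⟨hx, hf⟩).elim), neg_zero,
        ← integral_divergence_eq_zero hX hc]
      exact setIntegral_eq_integral_of_forall_compl_eq_zero fun x hx =>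
        divergence_eq_zero_of_notMem_tsupport fun hxs => hx (hXΩ hxs)
    · refine ⟨(closure Ω)ᶜ, isClosed_closure.isOpen_compl, fun hcl => hp ?_,
        fun X hX hc hXΩ => ?_⟩
      · rw [hΩ.frontier_eq]; exact ⟨hcl, hpΩ⟩
      · rw [hzero X (hXΩ.trans (compl_subset_compl.2 frontier_subset_closure)), neg_zero]
        refine setIntegral_eq_zero_of_forall_eq_zero fun x hx =>
          divergence_eq_zero_of_notMem_tsupport fun hxs => hXΩ hxs (subset_closure hx)

/-- The divergence theorem. -/
theorem integral_divergence (h : IsBoundaryDecomposition Ω N γ)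
    (hΩ : IsOpen Ω) {X : Plane → Plane} (hX : ContDiff ℝ 1 X) (hc : HasCompactSupport X) :
    ∫ x in Ω, divergence X x =
      -∑ j ∈ Finset.range N, ∫ t in (0 : ℝ)..1, inner ℝ (perp (deriv (γ j) t)) (X (γ j t)) := by
  choose W hWo hWp hWX using h.exists_isOpen_integral_divergence hΩ
  obtain ⟨T, Y, hY, hYs, hsum⟩ := exists_sum_eq_of_isOpen_cover hX hc W hWo hWp
  have hYc : ∀ i, HasCompactSupport (Y i) := fun i => (hYs i).1
  have hi : ∀ i, ∫ x in Ω, divergence (Y i) x = -∑ j ∈ Finset.range N,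
        ∫ t in (0 : ℝ)..1, inner ℝ (perp (deriv (γ j) t)) (Y i (γ j t)) := fun i =>
    hWX i _ (hY i) (hYc i) (hYs i).2
  have e1 : ∀ x, divergence X x = ∑ i ∈ T, divergence (Y i) x := fun x => by
    have hXeq : X = fun x => ∑ i ∈ T, Y i x := funext hsum
    rw [hXeq]
    exact divergence_sum _ _ fun i _ => (hY i).differentiable (by norm_num) x
  simp_rw [e1]
  rw [integral_finsetSum _ fun i _ => (integrable_divergence (hY i) (hYc i)).integrableOn]
  simp_rw [hi]
  rw [Finset.sum_neg_distrib, Finset.sum_comm]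
  congr 1
  refine Finset.sum_congr rfl fun j hj => ?_
  have hj' := Finset.mem_range.1 hj
  rw [← intervalIntegral.integral_finsetSum]
  · refine intervalIntegral.integral_congr fun t _ => ?_
    simp only [← inner_sum]
    rw [← hsum (γ j t)]
  · intro i _
    refine Continuous.intervalIntegrable ?_ _ _
    have h1 := h.continuous_deriv hj'
    have h2 := (h.contDiff_one hj').continuous
    exact (continuous_perp.comp h1).inner ((hY i).continuous.comp h2)

end IsBoundaryDecomposition


/-! ### Winding numbers of boundary curves -/

theorem divergence_radial {q : ℝ → ℝ} (hq : Differentiable ℝ q) (x y : Plane) :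
    divergence (fun y => q (‖y - x‖ ^ 2) • (y - x)) y =
      2 * (q (‖y - x‖ ^ 2) + ‖y - x‖ ^ 2 * deriv q (‖y - x‖ ^ 2)) := by
  have h1 : HasFDerivAt (fun y : Plane => y - x) (ContinuousLinearMap.id ℝ Plane) y :=
    (hasFDerivAt_id y).sub_const x
  have h2 : HasFDerivAt (fun y : Plane => ‖y - x‖ ^ 2)
      (2 • (innerSL ℝ (y - x)).comp (ContinuousLinearMap.id ℝ Plane)) y := h1.norm_sq
  have h3 := (hq (‖y - x‖ ^ 2)).hasDerivAt.comp_hasFDerivAt y h2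
  have h4 := h3.smul h1
  have h5 : fderiv ℝ (fun y => q (‖y - x‖ ^ 2) • (y - x)) y = _ := h4.fderiv
  rw [divergence, h5]
  simp only [Fin.sum_univ_two]
  simp [plane_inner]
  rw [plane_norm_sq]
  simp
  ring

/-- A smooth transition from `0` on `(-∞, c / 2]` to `1` on `[c, ∞)`. -/
noncomputable def cutoffStep (c u : ℝ) : ℝ := Real.smoothTransition (2 / c * u - 1)

theorem contDiff_cutoffStep (c : ℝ) : ContDiff ℝ 2 (cutoffStep c) := by
  have : ContDiff ℝ 2 Real.smoothTransition := Real.smoothTransition.contDiff (n := 2)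
  exact this.comp (by fun_prop)

theorem cutoffStep_eq_zero {c u : ℝ} (hc : 0 < c) (hu : u ≤ c / 2) : cutoffStep c u = 0 := by
  refine Real.smoothTransition.zero_of_nonpos ?_
  have : 2 / c * u ≤ 2 / c * (c / 2) := by gcongr
  have e : 2 / c * (c / 2) = 1 := by field_simp
  linarith

theorem cutoffStep_eq_one {c u : ℝ} (hc : 0 < c) (hu : c ≤ u) : cutoffStep c u = 1 := by
  refine Real.smoothTransition.one_of_one_le ?_
  have : 2 / c * c ≤ 2 / c * u := by gcongr
  have e : 2 / c * c = 2 := by field_simp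
  linarith

theorem cutoffStep_monotone {c : ℝ} (hc : 0 < c) : Monotone (cutoffStep c) := fun u v h =>
  Real.smoothTransition.monotone (by
    have : 2 / c * u ≤ 2 / c * v := by gcongr
    linarith)

/-- The numerator vanishes for u ≤ c / 2, which removes the pole at 0. -/
theorem contDiff_cutoffStep_div {c : ℝ} (hc : 0 < c) :
    ContDiff ℝ 2 (fun u => cutoffStep c u / u) := by
  rw [contDiff_iff_contDiffAt]
  intro u
  by_cases hu : u < c / 2
  · have : (fun u => cutoffStep c u / u) =ᶠ[𝓝 u] fun _ => 0 := by
      filter_upwards [eventually_lt_nhds hu] with v hv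
      rw [cutoffStep_eq_zero hc hv.le, zero_div]
    exact contDiffAt_const.congr_of_eventuallyEq this
  · have hu0 : u ≠ 0 := by
      have : 0 < c / 2 := by positivity
      linarith [not_lt.1 hu] |> fun h : 0 < u => h.ne'
    exact (contDiff_cutoffStep c).contDiffAt.div contDiffAt_id hu0

theorem deriv_cutoffStep_eq_zero {c u : ℝ} (hc : 0 < c) (hu : c < u) :
    deriv (cutoffStep c) u = 0 := by
  have : cutoffStep c =ᶠ[𝓝 u] fun _ => 1 := by
    filter_upwards [eventually_gt_nhds hu] with v hv
    exact cutoffStep_eq_one hc hv.le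
  rw [this.deriv_eq, deriv_const]

/-- The field (y - x)/|y - x|² is divergence free off x, so only the variation of the cutoff h
contributes. This comes out of u · (h u / u) = h u, which holds at u = 0 too because h vanishes
there. -/
theorem divergence_cutoffStep {c : ℝ} (hc : 0 < c) (x y : Plane) :
    divergence (fun y => (cutoffStep c (‖y - x‖ ^ 2) / ‖y - x‖ ^ 2) • (y - x)) y =
      2 * deriv (cutoffStep c) (‖y - x‖ ^ 2) := by
  have hq : Differentiable ℝ (fun u => cutoffStep c u / u) :=
    (contDiff_cutoffStep_div hc).differentiable (by norm_num)
  rw [divergence_radial hq]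
  congr 1
  set u := ‖y - x‖ ^ 2
  have he : cutoffStep c = fun u => u * (cutoffStep c u / u) := by
    ext1 v
    by_cases hv : v = 0
    · rw [hv, zero_mul, cutoffStep_eq_zero hc (by positivity)]
    · field_simp
  conv_rhs => rw [he]
  have := ((hasDerivAt_id u).mul (hq u).hasDerivAt).deriv
  simp only [id, one_mul] at this
  exact this.symm

/-- In polar coordinates this is 2π times the total increment, equal to 1, of r ↦ h(r²) for the
cutoff h. -/
theorem integral_deriv_cutoffStep {c : ℝ} (hc : 0 < c) :
    ∫ y : Plane, 2 * deriv (cutoffStep c) (‖y‖ ^ 2) = 2 * Real.pi := by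
  rw [integral_fun_norm_addHaar volume (fun r => 2 * deriv (cutoffStep c) (r ^ 2))]
  have hb : (volume : Measure Plane).real (Metric.ball 0 1) = Real.pi := by
    rw [Measure.real, EuclideanSpace.volume_ball_fin_two]
    simp [Real.pi_pos.le]
  have hd : ∀ r ∈ Ici (0 : ℝ), HasDerivAt (fun r => cutoffStep c (r ^ 2))
      (r ^ (Module.finrank ℝ Plane - 1) • (2 * deriv (cutoffStep c) (r ^ 2))) r := by
    intro r _
    have h1 : HasDerivAt (cutoffStep c) (deriv (cutoffStep c) (r ^ 2)) (r ^ 2) :=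
      ((contDiff_cutoffStep c).differentiable (by norm_num) _).hasDerivAt
    have h2 := HasDerivAt.comp (h := fun r : ℝ => r ^ 2) r h1 (hasDerivAt_pow 2 r)
    refine h2.congr_deriv ?_
    simp
    ring
  have hnn : ∀ r ∈ Ioi (0 : ℝ),
      0 ≤ r ^ (Module.finrank ℝ Plane - 1) • (2 * deriv (cutoffStep c) (r ^ 2)) := by
    intro r hr
    have : 0 ≤ deriv (cutoffStep c) (r ^ 2) := (cutoffStep_monotone hc).deriv_nonneg
    have hr' : 0 < r := hr
    rw [smul_eq_mul]; positivity
  have hl : Tendsto (fun r : ℝ => cutoffStep c (r ^ 2)) atTop (𝓝 1) := by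
    refine tendsto_const_nhds.congr' ?_
    filter_upwards [(tendsto_pow_atTop (n := 2) (by norm_num)).eventually_ge_atTop c] with r hr
    exact (cutoffStep_eq_one hc hr).symm
  rw [integral_Ioi_of_hasDerivAt_of_nonneg' hd hnn hl, hb]
  rw [cutoffStep_eq_zero hc (by rw [zero_pow two_ne_zero]; positivity)]
  simp

namespace IsBoundaryDecomposition

variable {Ω : Set Plane} {N : ℕ} {γ : ℕ → ℝ → Plane}

/-- Off the boundary, the total winding number of the boundary curves is the indicator of the
set. -/
theorem sum_windingNumber (h : IsBoundaryDecomposition Ω N γ) (hΩ : IsOpen Ω)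
    (hb : Bornology.IsBounded Ω) {x : Plane} (hx : x ∉ frontier Ω) :
    ∑ i ∈ Finset.range N, windingNumber (γ i) x = Ω.indicator (fun _ => (1 : ℝ)) x := by
  obtain ⟨ρ, hρ, hball⟩ : ∃ ρ > 0, Metric.ball x (2 * ρ) ⊆ (frontier Ω)ᶜ := by
    obtain ⟨r, hr, hr'⟩ := Metric.isOpen_iff.1 isClosed_frontier.isOpen_compl x hx
    exact ⟨r / 2, by positivity, by rwa [mul_div_cancel₀ r (by norm_num)]⟩
  have hc : 0 < ρ ^ 2 := by positivity
  have hfar : ∀ y, y ∉ Metric.ball x (2 * ρ) → ρ ^ 2 < ‖y - x‖ ^ 2 := by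
    intro y hy
    rw [Metric.mem_ball, dist_eq_norm, not_lt] at hy
    nlinarith
  -- On the boundary Y is (y - x)/|y - x|², whose flux through a curve is 2π times the winding
  -- number up to sign. Its divergence is a bump of mass 2π inside a ball around x that lies either
  -- in Ω or outside it.
  set Y : Plane → Plane := fun y =>
    (cutoffStep (ρ ^ 2) (‖y - x‖ ^ 2) / ‖y - x‖ ^ 2) • (y - x) with hY
  have hYc : ContDiff ℝ 1 Y := by
    have h1 : ContDiff ℝ 1 (fun y : Plane => ‖y - x‖ ^ 2) :=
      (contDiff_id.sub contDiff_const).norm_sq ℝ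
    have h2 : ContDiff ℝ 1 (fun u => cutoffStep (ρ ^ 2) u / u) :=
      (contDiff_cutoffStep_div hc).of_le (by norm_num)
    exact (h2.comp h1).smul (contDiff_id.sub contDiff_const)
  obtain ⟨R, hR0, hR⟩ := hb.subset_ball_lt 0 (0 : Plane)
  let b : ContDiffBump (0 : Plane) := ⟨R, R + 1, hR0, by linarith⟩
  set X : Plane → Plane := fun y => b y • Y y with hX
  have hXc : ContDiff ℝ 1 X := b.contDiff.smul hYc
  have hXs : HasCompactSupport X :=
    HasCompactSupport.intro b.hasCompactSupport fun y hy => by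
      simp only [hX, image_eq_zero_of_notMem_tsupport hy, zero_smul]
  have hXY : ∀ y ∈ closure Ω, X y = Y y := by
    intro y hy
    have : y ∈ Metric.closedBall (0 : Plane) R :=
      closure_minimal (hR.trans Metric.ball_subset_closedBall) Metric.isClosed_closedBall hy
    simp only [hX]
    rw [b.one_of_mem_closedBall this, one_smul]
  have hdiv : ∀ y ∈ Ω, divergence X y = 2 * deriv (cutoffStep (ρ ^ 2)) (‖y - x‖ ^ 2) := by
    intro y hy
    rw [← divergence_cutoffStep hc]
    have : X =ᶠ[𝓝 y] Y := by
      filter_upwards [hΩ.mem_nhds hy] with z hz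
      exact hXY z (subset_closure hz)
    unfold divergence
    rw [this.fderiv_eq]
  have hGG := h.integral_divergence hΩ hXc hXs
  have hflux : ∀ i ∈ Finset.range N,
      ∫ t in (0 : ℝ)..1, inner ℝ (perp (deriv (γ i) t)) (X (γ i t)) =
        -(2 * Real.pi * windingNumber (γ i) x) := by
    intro i hi
    have hi' := Finset.mem_range.1 hi
    rw [windingNumber, ← mul_assoc, mul_one_div_cancel (by positivity), one_mul,
      ← intervalIntegral.integral_neg]
    refine intervalIntegral.integral_congr fun t _ => ?_
    have hf := h.mem_frontier hi' t
    have hfar' : γ i t ∉ Metric.ball x (2 * ρ) := fun hmem => hball hmem hf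
    rw [hXY _ (frontier_subset_closure hf)]
    simp only [hY]
    rw [cutoffStep_eq_one hc (hfar _ hfar').le, inner_smul_right, inner_perp_left,
      real_inner_comm]
    ring
  rw [Finset.sum_congr rfl hflux, Finset.sum_neg_distrib, neg_neg, ← Finset.mul_sum,
    setIntegral_congr_fun hΩ.measurableSet hdiv] at hGG
  have hconn : IsPreconnected (Metric.ball x (2 * ρ)) := (convex_ball x (2 * ρ)).isPreconnected
  have hxb : x ∈ Metric.ball x (2 * ρ) := Metric.mem_ball_self (by positivity)
  have hpi : (2 * Real.pi) ≠ 0 := by positivity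
  by_cases hxΩ : x ∈ Ω
  · have hsub : Metric.ball x (2 * ρ) ⊆ Ω := by
      intro y hy
      by_contra hyΩ
      obtain ⟨z, hz, hzf⟩ := inter_frontier_nonempty_of_isPreconnected hconn (t := Ω)
        ⟨x, hxb, hxΩ⟩ ⟨y, hy, hyΩ⟩
      exact hball hz hzf
    rw [setIntegral_eq_integral_of_forall_compl_eq_zero fun y hy => by
      rw [deriv_cutoffStep_eq_zero hc (hfar y fun hmem => hy (hsub hmem)), mul_zero],
      integral_sub_right_eq_self (fun y : Plane => 2 * deriv (cutoffStep (ρ ^ 2)) (‖y‖ ^ 2)) x,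
      integral_deriv_cutoffStep hc] at hGG
    rw [indicator_of_mem hxΩ]
    have := mul_left_cancel₀ hpi ((mul_one _).trans hGG)
    exact this.symm
  · have hout : ∀ y ∈ Ω, y ∉ Metric.ball x (2 * ρ) := by
      intro y hyΩ hy
      obtain ⟨z, hz, hzf⟩ := inter_frontier_nonempty_of_isPreconnected hconn (t := Ω)
        ⟨y, hy, hyΩ⟩ ⟨x, hxb, hxΩ⟩
      exact hball hz hzf
    rw [setIntegral_eq_zero_of_forall_eq_zero fun y hy => by
      rw [deriv_cutoffStep_eq_zero hc (hfar y (hout y hy)), mul_zero]] at hGG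
    rw [indicator_of_notMem hxΩ]
    exact (mul_eq_zero.1 hGG.symm).resolve_left hpi

end IsBoundaryDecomposition


/-! ### The perimeter is at least the total length of the boundary curves -/

theorem periodic_deriv {f : ℝ → Plane} {c : ℝ} (hf : Function.Periodic f c) :
    Function.Periodic (deriv f) c := fun t => by
  rw [← deriv_comp_add_const]
  congr 1
  ext1 s
  exact hf s

namespace IsBoundaryDecomposition

variable {Ω : Set Plane} {N : ℕ} {γ : ℕ → ℝ → Plane}

theorem curveLength_pos (h : IsBoundaryDecomposition Ω N γ) {i : ℕ} (hi : i < N) :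
    0 < curveLength (γ i) := by
  rw [← h.constantSpeed i hi 0]
  exact norm_pos_iff.2 (h.regular i hi 0)

/-- The requirements on the value at a given point cut out a convex set, and near a boundary point
the constant unit outer normal of that point meets them all. A partition of unity glues these local
constants; the loss ε lets one constant vector serve a whole neighbourhood. -/
theorem exists_contDiff_near_normal (h : IsBoundaryDecomposition Ω N γ) {ε : ℝ} (hε : 0 < ε) :
    ∃ X : Plane → Plane, ContDiff ℝ 1 X ∧ (∀ x, ‖X x‖ ≤ 1) ∧ ∀ i < N, ∀ t,
      (1 - ε) * curveLength (γ i) ≤ -inner ℝ (perp (deriv (γ i) t)) (X (γ i t)) := by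
  set S : Plane → Set Plane := fun x => {v | ‖v‖ ≤ 1 ∧ ∀ i < N, ∀ t, γ i t = x →
    (1 - ε) * curveLength (γ i) ≤ -inner ℝ (perp (deriv (γ i) t)) v} with hS
  have hconv : ∀ x, Convex ℝ (S x) := by
    intro x v hv w hw a b ha hb hab
    refine ⟨?_, fun i hi t ht => ?_⟩
    · have := convex_closedBall (0 : Plane) 1
      have := this (by simpa using hv.1) (by simpa using hw.1) ha hb hab
      simpa using this
    · have h1 := hv.2 i hi t ht
      have h2 := hw.2 i hi t ht
      rw [inner_add_right, inner_smul_right, inner_smul_right]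
      have h3 := mul_le_mul_of_nonneg_left h1 ha
      have h4 := mul_le_mul_of_nonneg_left h2 hb
      have h5 : (1 - ε) * curveLength (γ i) =
          a * ((1 - ε) * curveLength (γ i)) + b * ((1 - ε) * curveLength (γ i)) := by
        rw [← add_mul, hab, one_mul]
      linarith
  have hloc : ∀ x : Plane, ∃ c : Plane, ∀ᶠ y in 𝓝 x, c ∈ S y := by
    intro x
    by_cases hx : x ∈ frontier Ω
    · have hx' := hx
      rw [h.boundary] at hx'
      obtain ⟨i₀, hi₀, t₀, -, rfl⟩ := mem_iUnion₂.1 hx'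
      have hL := h.curveLength_pos hi₀
      set c : Plane := -((curveLength (γ i₀))⁻¹ • perp (deriv (γ i₀) t₀)) with hc
      -- The compact set of boundary points at which c fails, or only just succeeds. It misses the
      -- centre, and its complement is the neighbourhood sought.
      set B : Set Plane := ⋃ i ∈ Finset.range N, γ i '' (Icc 0 1 ∩
        {t | -inner ℝ (perp (deriv (γ i) t)) c ≤ (1 - ε) * curveLength (γ i)}) with hB
      have hBc : IsCompact B := by
        refine Finset.isCompact_biUnion _ fun i hi => ?_
        have hi' := Finset.mem_range.1 hi
        refine IsCompact.image (isCompact_Icc.inter_right ?_) (h.contDiff_one hi').continuous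
        exact isClosed_le ((continuous_perp.comp (h.continuous_deriv hi')).inner
          continuous_const).neg continuous_const
      have hxB : γ i₀ t₀ ∉ B := by
        intro hmem
        obtain ⟨i, hi, t, ⟨-, ht⟩, heq⟩ := mem_iUnion₂.1 hmem
        have hi' := Finset.mem_range.1 hi
        have hii : i = i₀ := by
          by_contra hne
          refine disjoint_left.1 (h.disjoint i hi' i₀ hi₀ hne) (h.mem_curveImage hi' t) ?_
          rw [heq]; exact h.mem_curveImage hi₀ t₀
        subst hii
        obtain ⟨k, hk⟩ := h.exists_int_of_eq hi₀ heq
        have hd : deriv (γ i) t = deriv (γ i) t₀ := by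
          have := (periodic_deriv (h.periodic i hi₀)).int_mul k t₀
          rw [mul_one] at this
          rw [hk, this]
        rw [mem_ofPred_eq, hd, hc, inner_neg_right, neg_neg, inner_smul_right, inner_perp_perp,
          real_inner_self_eq_norm_sq, h.constantSpeed i hi₀] at ht
        have : (curveLength (γ i))⁻¹ * curveLength (γ i) ^ 2 = curveLength (γ i) := by
          field_simp
        rw [this] at ht
        nlinarith
      refine ⟨c, ?_⟩
      filter_upwards [hBc.isClosed.isOpen_compl.mem_nhds hxB] with y hy
      refine ⟨?_, fun i hi t ht => ?_⟩
      · rw [hc, norm_neg, norm_smul, norm_perp, h.constantSpeed i₀ hi₀, norm_inv, Real.norm_eq_abs,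
          abs_of_pos hL, inv_mul_cancel₀ hL.ne']
      · by_contra hlt
        refine hy (mem_iUnion₂.2 ⟨i, Finset.mem_range.2 hi, Int.fract t,
          ⟨⟨Int.fract_nonneg t, (Int.fract_lt_one t).le⟩, ?_⟩, ?_⟩)
        · have := (periodic_deriv (h.periodic i hi)).sub_zsmul_eq (x := t) ⌊t⌋
          rw [zsmul_one] at this
          rw [mem_ofPred_eq, Int.fract, this]
          exact (not_le.1 hlt).le
        · have := (h.periodic i hi).sub_zsmul_eq (x := t) ⌊t⌋
          rw [zsmul_one] at this
          rw [Int.fract, this, ht]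
    · refine ⟨0, ?_⟩
      filter_upwards [isClosed_frontier.isOpen_compl.mem_nhds hx] with y hy
      exact ⟨by simp, fun i hi t ht => (hy (ht ▸ h.mem_frontier hi t)).elim⟩
  obtain ⟨g, hg⟩ := exists_contMDiffMap_forall_mem_convex_of_local_const (n := 1)
    (modelWithCornersSelf ℝ Plane) hconv hloc
  exact ⟨g, g.contMDiff.contDiff, fun x => (hg x).1, fun i hi t => (hg _).2 i hi t rfl⟩

/-- A field close to the outer normal, cut off outside a ball containing Ω, is admissible in the
supremum and yields (1 - ε) times the total length. This inequality is the one required for bounding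
the energy from below. -/
theorem sum_curveLength_le_perimeter (h : IsBoundaryDecomposition Ω N γ) (hΩ : IsOpen Ω)
    (hb : Bornology.IsBounded Ω) :
    ENNReal.ofReal (∑ i ∈ Finset.range N, curveLength (γ i)) ≤ perimeter Ω := by
  obtain ⟨R, hR0, hR⟩ := hb.subset_ball_lt 0 (0 : Plane)
  let b : ContDiffBump (0 : Plane) := ⟨R, R + 1, hR0, by linarith⟩
  have hbf : ∀ y ∈ frontier Ω, b y = 1 := fun y hy =>
    b.one_of_mem_closedBall (closure_minimal (hR.trans Metric.ball_subset_closedBall)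
      Metric.isClosed_closedBall (frontier_subset_closure hy))
  have key : ∀ ε ∈ Ioo (0 : ℝ) 1, ENNReal.ofReal
      ((1 - ε) * ∑ i ∈ Finset.range N, curveLength (γ i)) ≤ perimeter Ω := by
    intro ε hε
    obtain ⟨X, hX, hX1, hXn⟩ := h.exists_contDiff_near_normal hε.1
    have hXc : ContDiff ℝ 1 (fun y => b y • X y) := b.contDiff.smul hX
    have hXs : HasCompactSupport (fun y => b y • X y) :=
      HasCompactSupport.intro b.hasCompactSupport fun y hy => by
        simp only [image_eq_zero_of_notMem_tsupport hy, zero_smul]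
    have hX2 : ∀ y, ‖b y • X y‖ ≤ 1 := fun y => by
      rw [norm_smul, Real.norm_eq_abs, abs_of_nonneg b.nonneg]
      exact mul_le_one₀ b.le_one (norm_nonneg _) (hX1 y)
    have hle : ENNReal.ofReal (∫ x in Ω, divergence (fun y => b y • X y) x) ≤ perimeter Ω := by
      unfold perimeter
      exact le_iSup₂_of_le (fun y => b y • X y) hXc (le_iSup₂_of_le hXs hX2 le_rfl)
    refine le_trans (ENNReal.ofReal_le_ofReal ?_) hle
    rw [h.integral_divergence hΩ hXc hXs, ← Finset.sum_neg_distrib, Finset.mul_sum]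
    refine Finset.sum_le_sum fun i hi => ?_
    have hi' := Finset.mem_range.1 hi
    have e : (1 - ε) * curveLength (γ i) = ∫ _ in (0 : ℝ)..1, (1 - ε) * curveLength (γ i) := by
      simp
    rw [e, ← intervalIntegral.integral_neg]
    refine intervalIntegral.integral_mono (by norm_num) (by simp) ?_ fun t => ?_
    · refine Continuous.intervalIntegrable (Continuous.neg ?_) _ _
      exact (continuous_perp.comp (h.continuous_deriv hi')).inner
        (hXc.continuous.comp (h.contDiff_one hi').continuous)
    · simp only
      rw [hbf _ (h.mem_frontier hi' t), one_smul]
      exact hXn i hi' t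
  have hlim : Tendsto (fun ε : ℝ => ENNReal.ofReal
      ((1 - ε) * ∑ i ∈ Finset.range N, curveLength (γ i))) (𝓝[>] 0)
      (𝓝 (ENNReal.ofReal ((1 - 0) * ∑ i ∈ Finset.range N, curveLength (γ i)))) := by
    refine Tendsto.mono_left (Continuous.tendsto ?_ 0) nhdsWithin_le_nhds
    exact ENNReal.continuous_ofReal.comp (by fun_prop)
  rw [sub_zero, one_mul] at hlim
  refine le_of_tendsto hlim ?_
  filter_upwards [Ioo_mem_nhdsGT (zero_lt_one' ℝ)] with ε hε using key ε hε

end IsBoundaryDecomposition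


/-! ### Nonlocal estimate along arcs -/

/-- The average of `φ` over the segment `[x - z, x]`. -/
noncomputable def segmentAverage (φ : Plane → ℝ) (z x : Plane) : ℝ :=
  ∫ s in (0 : ℝ)..1, φ (x - s • z)

theorem continuous_segmentAverage {φ : Plane → ℝ} (hφ : Continuous φ) (z : Plane) :
    Continuous (segmentAverage φ z) := by
  unfold segmentAverage
  refine intervalIntegral.continuous_parametric_intervalIntegral_of_continuous' ?_ 0 1
  simp only [Function.uncurry_def]
  fun_prop

theorem abs_segmentAverage_le {φ : Plane → ℝ} (h1 : ∀ x, |φ x| ≤ 1)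
    (z x : Plane) : |segmentAverage φ z x| ≤ 1 := by
  unfold segmentAverage
  have := intervalIntegral.norm_integral_le_of_norm_le_const (a := 0) (b := 1) (C := 1)
    (f := fun s : ℝ => φ (x - s • z)) (fun s _ => h1 _)
  simpa using this

theorem abs_integral_mul_le_of_le_one {f w : ℝ → ℝ} (hf : Continuous f) (hw : Continuous w)
    {a b c : ℝ} (hab : a ≤ b) (h1 : ∀ t ∈ Icc a b, |f t| ≤ c) :
    |∫ t in a..b, f t * w t| ≤ c * ∫ t in a..b, |w t| := by
  rw [← intervalIntegral.integral_const_mul]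
  refine (intervalIntegral.abs_integral_le_integral_abs hab).trans ?_
  refine intervalIntegral.integral_mono_on hab ?_ ?_ fun t ht => ?_
  · exact (hf.mul hw).abs.intervalIntegrable _ _
  · exact (continuous_const.mul hw.abs).intervalIntegrable _ _
  · rw [abs_mul]
    exact mul_le_mul_of_nonneg_right (h1 t ht) (abs_nonneg _)

/-- Over an arc of diameter at most `κ |z|`, replacing the arc by its chord changes the
`φ`-weighted flux of `z` by little. -/
theorem abs_integral_segmentAverage_le {γ : ℝ → Plane} (hγ : ContDiff ℝ 1 γ) {a b : ℝ}
    (hab : a ≤ b) {z : Plane} (hz : z ≠ 0) {φ : Plane → ℝ} (hφ : Continuous φ)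
    (h1 : ∀ x, |φ x| ≤ 1) {κ : ℝ} (hκ1 : κ ≤ 1)
    (hosc : κ = 1 ∨ ∀ s ∈ Icc a b, ∀ t ∈ Icc a b, ‖γ s - γ t‖ ≤ κ * ‖z‖) :
    |∫ t in a..b, segmentAverage φ z (γ t) * inner ℝ (perp (deriv γ t)) z| ≤
      (1 - κ) * |inner ℝ (perp (γ b - γ a)) z| +
        κ * ∫ t in a..b, |inner ℝ (perp (deriv γ t)) z| := by
  have hγc : Continuous γ := hγ.continuous
  have hγ' : Continuous (deriv γ) := hγ.continuous_deriv le_rfl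
  have hf := continuous_segmentAverage hφ z
  set w : ℝ → ℝ := fun t => inner ℝ (perp (deriv γ t)) z with hw
  have hwc : Continuous w := (continuous_perp.comp hγ').inner continuous_const
  -- The value κ = 1 serves translations that are short compared with the arc: the chord gets weight
  -- zero and the bound |φ| ≤ 1 is enough.
  rcases hosc with rfl | hosc
  · simpa using abs_integral_mul_le_of_le_one (hf.comp hγc) hwc hab
      (fun t _ => abs_segmentAverage_le h1 z (γ t))
  have hr : 0 < ‖z‖ := norm_pos_iff.2 hz
  have hr2 : 0 < ‖z‖ ^ 2 := by positivity
  -- In the coordinates A along z and β along z^⊥, measured in units of |z|, the segment average is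
  -- the integral of `ψ β` over the window [A - 1, A]. Along the arc A varies by at most κ, so all
  -- windows share [A₀ + κ - 1, A₀]. The shared part is a function G of β alone; its flux depends on
  -- the end points only and so sees just the chord. The unshared parts have total length κ.
  set A : ℝ → ℝ := fun t => inner ℝ (γ t) z / ‖z‖ ^ 2 with hA
  set β : ℝ → ℝ := fun t => inner ℝ (γ t) (perp z) / ‖z‖ ^ 2 with hβ
  have hAc : Continuous A := (hγc.inner continuous_const).div_const _
  have hβc : Continuous β := (hγc.inner continuous_const).div_const _
  have hdec : ∀ t, γ t = A t • z + β t • perp z := by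
    intro t
    have hn := plane_norm_sq z
    have hne : z 0 ^ 2 + z 1 ^ 2 ≠ 0 := by rw [← hn]; exact hr2.ne'
    ext i
    fin_cases i
    · simp [hA, hβ, plane_inner, hn]
      field_simp
      ring
    · simp [hA, hβ, plane_inner, hn]
      field_simp
      ring
  obtain ⟨t₀, ht₀, hmin⟩ := isCompact_Icc.exists_isMinOn (nonempty_Icc.2 hab) hAc.continuousOn
  set A₀ := A t₀ with hA₀
  have hA1 : ∀ t ∈ Icc a b, A₀ ≤ A t := fun t ht => hmin ht
  have hA2 : ∀ t ∈ Icc a b, A t ≤ A₀ + κ := by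
    intro t ht
    have e : A t - A₀ = inner ℝ (γ t - γ t₀) z / ‖z‖ ^ 2 := by
      rw [inner_sub_left, sub_div]
    have h2 : inner ℝ (γ t - γ t₀) z ≤ κ * ‖z‖ * ‖z‖ :=
      (real_inner_le_norm _ _).trans
        (mul_le_mul_of_nonneg_right (hosc t ht t₀ ht₀) (norm_nonneg _))
    have h3 : inner ℝ (γ t - γ t₀) z / ‖z‖ ^ 2 ≤ κ := by
      rw [div_le_iff₀ hr2]; linarith
    linarith
  set ψ : ℝ → ℝ → ℝ := fun β σ => φ (σ • z + β • perp z) with hψ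
  have hψc : Continuous (Function.uncurry ψ) := by
    simp only [hψ, Function.uncurry_def]; fun_prop
  have hψi : ∀ β c d, IntervalIntegrable (ψ β) volume c d := fun β c d =>
    (hψc.comp (continuous_const.prodMk continuous_id)).intervalIntegrable _ _
  set G : ℝ → ℝ := fun β => ∫ σ in (A₀ + κ - 1)..A₀, ψ β σ with hG
  have hGc : Continuous G :=
    intervalIntegral.continuous_parametric_intervalIntegral_of_continuous' hψc _ _
  have hbd : ∀ β c d, c ≤ d → |∫ σ in c..d, ψ β σ| ≤ d - c := by
    intro β c d hcd
    have := intervalIntegral.norm_integral_le_of_norm_le_const (a := c) (b := d) (C := 1)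
      (f := ψ β) (fun s _ => h1 _)
    rw [Real.norm_eq_abs, one_mul, abs_of_nonneg (sub_nonneg.2 hcd)] at this
    exact this
  have hfG : ∀ t, segmentAverage φ z (γ t) = ∫ σ in (A t - 1)..(A t), ψ (β t) σ := by
    intro t
    have : ∀ s : ℝ, φ (γ t - s • z) = ψ (β t) (A t - s) := by
      intro s
      simp only [hψ]
      congr 1
      rw [hdec t]
      module
    unfold segmentAverage
    simp_rw [this]
    rw [intervalIntegral.integral_comp_sub_left (fun σ => ψ (β t) σ) (A t), sub_zero]
  have hrest : ∀ t ∈ Icc a b, |segmentAverage φ z (γ t) - G (β t)| ≤ κ := by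
    intro t ht
    have a1 := hA1 t ht
    have a2 := hA2 t ht
    have e : segmentAverage φ z (γ t) - G (β t) =
        (∫ σ in (A t - 1)..(A₀ + κ - 1), ψ (β t) σ) + ∫ σ in A₀..(A t), ψ (β t) σ := by
      rw [hfG t, hG]
      simp only
      rw [← intervalIntegral.integral_add_adjacent_intervals (hψi _ (A t - 1) (A₀ + κ - 1))
        (hψi _ (A₀ + κ - 1) (A t)),
        ← intervalIntegral.integral_add_adjacent_intervals (hψi _ (A₀ + κ - 1) A₀)
        (hψi _ A₀ (A t))]
      ring
    rw [e]
    refine (abs_add_le _ _).trans ?_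
    linarith [hbd (β t) (A t - 1) (A₀ + κ - 1) (by linarith), hbd (β t) A₀ (A t) a1]
  have hwβ : ∀ t, HasDerivAt β (-(w t) / ‖z‖ ^ 2) t := by
    intro t
    have hd : HasDerivAt γ (deriv γ t) t := (hγ.differentiable (by norm_num) t).hasDerivAt
    have h2 := (hd.inner ℝ (hasDerivAt_const t (perp z))).div_const (‖z‖ ^ 2)
    refine h2.congr_deriv ?_
    simp only [inner_zero_right, zero_add, hw]
    rw [inner_perp_left, neg_neg]
  have hmain : ∫ t in a..b, G (β t) * w t = -(‖z‖ ^ 2 * ∫ x in (β a)..(β b), G x) := by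
    rw [← intervalIntegral.integral_comp_mul_deriv (fun t _ => hwβ t)
      (hwc.neg.div_const _).continuousOn hGc, ← intervalIntegral.integral_const_mul,
      ← intervalIntegral.integral_neg]
    refine intervalIntegral.integral_congr fun t _ => ?_
    simp only [Function.comp]
    field_simp
  have hGb : ∀ x, |G x| ≤ 1 - κ := fun x => by
    have := hbd x (A₀ + κ - 1) A₀ (by linarith)
    linarith
  have hm2 : |∫ t in a..b, G (β t) * w t| ≤ (1 - κ) * |inner ℝ (perp (γ b - γ a)) z| := by
    rw [hmain, abs_neg, abs_mul, abs_of_pos hr2]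
    have := intervalIntegral.norm_integral_le_of_norm_le_const (a := β a) (b := β b)
      (C := 1 - κ) (f := G) (fun s _ => hGb s)
    rw [Real.norm_eq_abs] at this
    have e : |β b - β a| = |inner ℝ (perp (γ b - γ a)) z| / ‖z‖ ^ 2 := by
      simp only [hβ]
      rw [← sub_div, ← inner_sub_left, inner_perp_left, abs_neg, abs_div, abs_of_pos hr2]
    rw [e] at this
    calc ‖z‖ ^ 2 * |∫ x in (β a)..(β b), G x|
        ≤ ‖z‖ ^ 2 * ((1 - κ) * (|inner ℝ (perp (γ b - γ a)) z| / ‖z‖ ^ 2)) := by gcongr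
      _ = _ := by field_simp
  have hm3 := abs_integral_mul_le_of_le_one
    (f := fun t => segmentAverage φ z (γ t) - G (β t)) ((hf.comp hγc).sub (hGc.comp hβc)) hwc hab
    hrest
  have hsplit : ∫ t in a..b, segmentAverage φ z (γ t) * w t =
      (∫ t in a..b, G (β t) * w t) +
        ∫ t in a..b, (segmentAverage φ z (γ t) - G (β t)) * w t := by
    rw [← intervalIntegral.integral_add]
    · refine intervalIntegral.integral_congr fun t _ => ?_
      ring
    · exact ((hGc.comp hβc).mul hwc).intervalIntegrable _ _
    · exact (((hf.comp hγc).sub (hGc.comp hβc)).mul hwc).intervalIntegrable _ _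
  rw [hsplit]
  exact (abs_add_le _ _).trans (add_le_add hm2 hm3)

/-- The sum of `|det(c_j, z)|` over the `m` chords `c_j` of `γ` with break points `u + j / m`. -/
noncomputable def chordFlux (γ : ℝ → Plane) (m : ℕ) (u : ℝ) (z : Plane) : ℝ :=
  ∑ j ∈ Finset.range m, |inner ℝ (perp (γ (u + (j + 1 : ℕ) / m) - γ (u + j / m))) z|

/-- The length of the closed polygon with vertices `γ (u + j / m)`. -/
noncomputable def chordLength (γ : ℝ → Plane) (m : ℕ) (u : ℝ) : ℝ :=
  ∑ j ∈ Finset.range m, ‖γ (u + (j + 1 : ℕ) / m) - γ (u + j / m)‖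

theorem norm_sub_le_of_norm_deriv_eq {γ : ℝ → Plane} (hγ : ContDiff ℝ 1 γ) {L : ℝ}
    (hL : ∀ t, ‖deriv γ t‖ = L) (s t : ℝ) : ‖γ s - γ t‖ ≤ L * |s - t| := by
  have := Convex.norm_image_sub_le_of_norm_deriv_le (𝕜 := ℝ) (f := γ) (s := univ) (C := L)
    (fun x _ => hγ.differentiable (by norm_num) x) (fun x _ => (hL x).le) convex_univ
    (mem_univ t) (mem_univ s)
  simpa [Real.norm_eq_abs] using this

/-- The m arcs have length L / m ≤ δ, so the estimate for one arc applies to each with κ = min 1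
(δ/|z|). -/
theorem abs_integral_segmentAverage_closed_le {γ : ℝ → Plane} (hγ : ContDiff ℝ 1 γ)
    (hper : Function.Periodic γ 1) {L : ℝ} (hL : ∀ t, ‖deriv γ t‖ = L) {m : ℕ} (hm : 0 < m)
    (u : ℝ) {δ : ℝ} (hδ : L / m ≤ δ) {z : Plane} (hz : z ≠ 0) {φ : Plane → ℝ}
    (hφ : Continuous φ) (h1 : ∀ x, |φ x| ≤ 1) :
    |∫ t in (0 : ℝ)..1, segmentAverage φ z (γ t) * inner ℝ (perp (deriv γ t)) z| ≤
      (1 - min 1 (δ / ‖z‖)) * chordFlux γ m u z +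
        min 1 (δ / ‖z‖) * ∫ t in (0 : ℝ)..1, |inner ℝ (perp (deriv γ t)) z| := by
  have hγc : Continuous γ := hγ.continuous
  have hγ' : Continuous (deriv γ) := hγ.continuous_deriv le_rfl
  have hf := continuous_segmentAverage hφ z
  have hwc : Continuous (fun t => inner ℝ (perp (deriv γ t)) z) :=
    (continuous_perp.comp hγ').inner continuous_const
  have hL0 : 0 ≤ L := (hL 0) ▸ norm_nonneg _
  have hm' : (0 : ℝ) < m := by exact_mod_cast hm
  set κ := min 1 (δ / ‖z‖) with hκ
  have hr : 0 < ‖z‖ := norm_pos_iff.2 hz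
  have hpart : ∀ F : ℝ → ℝ, Continuous F → Function.Periodic F 1 → ∫ t in (0 : ℝ)..1, F t =
      ∑ j ∈ Finset.range m, ∫ t in (u + (j : ℝ) / m)..(u + (j + 1 : ℕ) / m), F t := by
    intro F hF hFp
    rw [intervalIntegral.sum_integral_adjacent_intervals (a := fun j : ℕ => u + (j : ℝ) / m)
      (fun k _ => hF.intervalIntegrable _ _)]
    have := hFp.intervalIntegral_add_eq 0 u
    rw [zero_add] at this
    rw [this]
    simp [hm'.ne']
  have hdp := periodic_deriv hper
  rw [hpart (fun t => segmentAverage φ z (γ t) * inner ℝ (perp (deriv γ t)) z)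
    ((hf.comp hγc).mul hwc) (fun t => by simp only [hper t, hdp t]),
    hpart (fun t => |inner ℝ (perp (deriv γ t)) z|) hwc.abs (fun t => by simp only [hdp t]),
    chordFlux, Finset.mul_sum, Finset.mul_sum, ← Finset.sum_add_distrib]
  refine (Finset.abs_sum_le_sum_abs _ _).trans (Finset.sum_le_sum fun j _ => ?_)
  have hjle : u + (j : ℝ) / m ≤ u + ((j + 1 : ℕ) : ℝ) / m := by
    push_cast; gcongr; linarith
  refine abs_integral_segmentAverage_le hγ hjle hz hφ h1 (min_le_left _ _) ?_
  rcases le_total 1 (δ / ‖z‖) with hle | hle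
  · left; rw [hκ, min_eq_left hle]
  · right
    intro s hs t ht
    rw [hκ, min_eq_right hle, div_mul_cancel₀ _ hr.ne']
    refine (norm_sub_le_of_norm_deriv_eq hγ hL s t).trans (le_trans ?_ hδ)
    have : |s - t| ≤ 1 / m := by
      have e : ((j + 1 : ℕ) : ℝ) / m = (j : ℝ) / m + 1 / m := by push_cast; ring
      rw [e] at hs ht
      rw [abs_le]
      constructor <;> linarith [hs.1, hs.2, ht.1, ht.2]
    calc L * |s - t| ≤ L * (1 / m) := by gcongr
      _ = L / m := by ring


/-! ### Area moved by a translation as a boundary flux. -/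

theorem divergence_smul_const {f : Plane → ℝ} (z : Plane) {x : Plane}
    (hf : DifferentiableAt ℝ f x) : divergence (fun y => f y • z) x = fderiv ℝ f x z := by
  have h := hf.hasFDerivAt.smul_const z
  rw [divergence, h.fderiv]
  conv_rhs => rw [plane_eq_smul_single z]
  simp only [Fin.sum_univ_two]
  simp
  ring

namespace IsBoundaryDecomposition

variable {Ω : Set Plane} {N : ℕ} {γ : ℕ → ℝ → Plane}

/-- The difference φ(x) - φ(x - z) is the integral over s ∈ [0, 1] of the derivative of φ along z at
x - s z, that is, of the divergence of the field φ(· - s z) z. The divergence theorem and Fubini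
carry the average over s to the boundary curves. -/
theorem integral_sub_translate (h : IsBoundaryDecomposition Ω N γ) (hΩ : IsOpen Ω)
    (hb : Bornology.IsBounded Ω) {φ : Plane → ℝ} (hφ : ContDiff ℝ 1 φ)
    (hφc : HasCompactSupport φ) (z : Plane) :
    ∫ x in Ω, (φ x - φ (x - z)) = -∑ i ∈ Finset.range N, ∫ t in (0 : ℝ)..1,
      segmentAverage φ z (γ i t) * inner ℝ (perp (deriv (γ i) t)) z := by
  have hdφ : Continuous (fderiv ℝ φ) := hφ.continuous_fderiv (by norm_num)
  have hshift : ∀ s : ℝ, ∫ x in Ω, fderiv ℝ φ (x - s • z) z = -∑ i ∈ Finset.range N,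
      ∫ t in (0 : ℝ)..1, φ (γ i t - s • z) * inner ℝ (perp (deriv (γ i) t)) z := by
    intro s
    have hc1 : ContDiff ℝ 1 (fun x => φ (x - s • z)) :=
      hφ.comp (contDiff_id.sub contDiff_const)
    have hX : ContDiff ℝ 1 (fun x => φ (x - s • z) • z) := hc1.smul contDiff_const
    have hXc : HasCompactSupport (fun x => φ (x - s • z) • z) := by
      have h1 : HasCompactSupport (fun x => φ (x - s • z)) :=
        hφc.comp_homeomorph (Homeomorph.subRight (s • z))
      exact HasCompactSupport.intro h1 fun y hy => by
        rw [image_eq_zero_of_notMem_tsupport hy, zero_smul]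
    have := h.integral_divergence hΩ hX hXc
    rw [setIntegral_congr_fun (g := fun x => fderiv ℝ φ (x - s • z) z) hΩ.measurableSet
      fun x _ => ?_] at this
    · rw [this]
      simp only [inner_smul_right]
    · simp only
      rw [divergence_smul_const z (hc1.differentiable (by norm_num) x)]
      have hd := (hφ.differentiable (by norm_num) (x - s • z)).hasFDerivAt.comp x
        ((hasFDerivAt_id x).sub_const (s • z))
      have hd' : fderiv ℝ (fun x => φ (x - s • z)) x = _ := hd.fderiv
      rw [hd']
      simp
  have hcont : Continuous (Function.uncurry fun (s : ℝ) (x : Plane) =>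
      fderiv ℝ φ (x - s • z) z) := by
    simp only [Function.uncurry_def]
    exact (hdφ.comp (by fun_prop)).clm_apply continuous_const
  have hKc : IsCompact (closure Ω) := hb.isCompact_closure
  have e1 : ∫ s in (0 : ℝ)..1, ∫ x in Ω, fderiv ℝ φ (x - s • z) z =
      ∫ x in Ω, (φ x - φ (x - z)) := by
    rw [intervalIntegral_integral_swap]
    · refine setIntegral_congr_fun hΩ.measurableSet fun x _ => ?_
      have hd : ∀ s ∈ uIcc (0 : ℝ) 1, HasDerivAt (fun s : ℝ => -φ (x - s • z))
          (fderiv ℝ φ (x - s • z) z) s := by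
        intro s _
        have a1 : HasDerivAt (fun s : ℝ => x - s • z) (-z) s := by
          simpa using ((hasDerivAt_id s).smul_const z).const_sub x
        have a2 := (hφ.differentiable (by norm_num) (x - s • z)).hasFDerivAt.comp_hasDerivAt s a1
        exact a2.neg.congr_deriv (by simp)
      rw [intervalIntegral.integral_eq_sub_of_hasDerivAt hd]
      · simp; ring
      · exact (hcont.comp (continuous_id.prodMk continuous_const)).intervalIntegrable _ _
    · rw [Measure.prod_restrict]
      refine (hcont.continuousOn.integrableOn_compact ((isCompact_uIcc (a := (0 : ℝ)) (b := 1)).prod hKc)).mono_set ?_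
      exact prod_mono uIoc_subset_uIcc subset_closure
  rw [← e1]
  simp_rw [hshift]
  have hci : ∀ i ∈ Finset.range N, Continuous (Function.uncurry fun (s t : ℝ) =>
      φ (γ i t - s • z) * inner ℝ (perp (deriv (γ i) t)) z) := by
    intro i hi
    have hi' := Finset.mem_range.1 hi
    have h1 := (h.contDiff_one hi').continuous
    have h2 := h.continuous_deriv hi'
    have h3 := hφ.continuous
    have h4 := continuous_perp.comp (h2.comp (continuous_snd (X := ℝ)))
    simp only [Function.uncurry_def]
    exact (h3.comp (by fun_prop)).mul (h4.inner continuous_const)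
  rw [intervalIntegral.integral_neg, intervalIntegral.integral_finsetSum]
  · congr 1
    refine Finset.sum_congr rfl fun i hi => ?_
    rw [intervalIntegral_intervalIntegral_swap]
    · refine intervalIntegral.integral_congr fun t _ => ?_
      rw [intervalIntegral.integral_mul_const]
      rfl
    · refine ((hci i hi).continuousOn.integrableOn_compact
        ((isCompact_uIcc (a := (0 : ℝ)) (b := 1)).prod (isCompact_uIcc (a := (0 : ℝ)) (b := 1)))).mono_set ?_
      exact prod_mono uIoc_subset_uIcc uIoc_subset_uIcc
  · intro i hi
    refine Continuous.intervalIntegrable ?_ _ _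
    exact intervalIntegral.continuous_parametric_intervalIntegral_of_continuous' (hci i hi) _ _

end IsBoundaryDecomposition

/-- Duality: a function with values in `{-1, 0, 1}` may be tested against itself. -/
theorem integral_sq_le_of_forall_contDiff {D : Plane → ℝ} (hD : Measurable D)
    (hDs : HasCompactSupport D) (hD1 : ∀ x, |D x| ≤ 1) {M : ℝ}
    (hM : ∀ φ : Plane → ℝ, ContDiff ℝ 1 φ → HasCompactSupport φ → (∀ x, |φ x| ≤ 1) →
      ∫ x, D x * φ x ≤ M) : ∫ x, D x * D x ≤ M := by
  have hDi : Integrable D := by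
    refine (integrableOn_iff_integrable_of_support_subset (subset_tsupport D)).1 ?_
    exact Measure.integrableOn_of_bounded (M := 1) hDs.isCompact.measure_lt_top.ne
      hD.aestronglyMeasurable (ae_of_all _ hD1)
  -- The mollifications of D are admissible test functions bounded by 1 and converge to D almost
  -- everywhere. The ratio of the two radii is kept equal to 2, as differentiation of integrals
  -- requires it bounded.
  let b : ℕ → ContDiffBump (0 : Plane) := fun n =>
    ⟨1 / (n + 1) / 2, 1 / (n + 1), by positivity, half_lt_self (by positivity)⟩
  set φ : ℕ → Plane → ℝ := fun n =>
    convolution ((b n).normed volume) D (ContinuousLinearMap.lsmul ℝ ℝ) volume with hφ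
  have hlim : ∀ᵐ x, Tendsto (fun n => φ n x) atTop (𝓝 (D x)) :=
    ContDiffBump.ae_convolution_tendsto_right_of_locallyIntegrable (K := 2)
      tendsto_one_div_add_atTop_nhds_zero_nat
      (Eventually.of_forall fun n => by simp only [b]; linarith) hDi.locallyIntegrable
  have hφ1 : ∀ n x, |φ n x| ≤ 1 := by
    intro n x
    have := dist_convolution_le (μ := volume) (f := (b n).normed volume) (g := D) (x₀ := x)
      (R := (b n).rOut) (ε := 1) (z₀ := 0) zero_le_one (by rw [(b n).support_normed_eq])
      (b n).nonneg_normed (b n).integral_normed hD.aestronglyMeasurable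
      (fun y _ => by rw [dist_zero_right]; exact hD1 y)
    rwa [dist_zero_right] at this
  have hφc : ∀ n, ContDiff ℝ 1 (φ n) := fun n =>
    (b n).hasCompactSupport_normed.contDiff_convolution_left (n := 1) _
      (b n).contDiff_normed hDi.locallyIntegrable
  have hφs : ∀ n, HasCompactSupport (φ n) := fun n =>
    (b n).hasCompactSupport_normed.convolution _ hDs
  have ht : Tendsto (fun n => ∫ x, D x * φ n x) atTop (𝓝 (∫ x, D x * D x)) := by
    refine tendsto_integral_of_dominated_convergence (fun x => |D x|)
      (fun n => (hD.aestronglyMeasurable.mul (hφc n).continuous.aestronglyMeasurable))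
      hDi.abs (fun n => ae_of_all _ fun x => ?_) ?_
    · rw [Real.norm_eq_abs, abs_mul]
      exact mul_le_of_le_one_right (abs_nonneg _) (hφ1 n x)
    · filter_upwards [hlim] with x hx using hx.const_mul _
  exact le_of_tendsto' ht fun n => hM _ (hφc n) (hφs n) (hφ1 n)

namespace IsBoundaryDecomposition

variable {Ω : Set Plane} {N : ℕ} {γ : ℕ → ℝ → Plane}

/-- The area of the part of `Ω` that a translation moves out of `Ω`, estimated by inscribed
polygons of the boundary curves. -/
theorem measureReal_translate_le (h : IsBoundaryDecomposition Ω N γ) (hΩ : IsOpen Ω)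
    (hb : Bornology.IsBounded Ω) {δ : ℝ} {m : ℕ → ℕ} (hm : ∀ i < N, 0 < m i)
    (hδ : ∀ i < N, curveLength (γ i) / m i ≤ δ) (u : ℝ) {z : Plane} (hz : z ≠ 0) :
    2 * volume.real {x | x ∈ Ω ∧ x + z ∉ Ω} ≤ ∑ i ∈ Finset.range N,
      ((1 - min 1 (δ / ‖z‖)) * chordFlux (γ i) (m i) u z +
        min 1 (δ / ‖z‖) * ∫ t in (0 : ℝ)..1, |inner ℝ (perp (deriv (γ i) t)) z|) := by
  set T : Set Plane := (fun x => x + z) ⁻¹' Ω with hT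
  have hTo : IsOpen T := hΩ.preimage (by fun_prop)
  have hvT : volume T = volume Ω := measure_preimage_add_right volume z Ω
  have hfin : volume Ω ≠ ⊤ := hb.measure_lt_top.ne
  have hTb : Bornology.IsBounded T := by
    have : T = (fun x => x - z) '' Ω := by
      ext x; simp [hT, sub_eq_iff_eq_add]
    rw [this]
    obtain ⟨R, hR⟩ := hb.exists_norm_le
    refine isBounded_iff_forall_norm_le.2 ⟨R + ‖z‖, ?_⟩
    rintro _ ⟨x, hx, rfl⟩
    exact (norm_sub_le _ _).trans (by linarith [hR x hx])
  set D : Plane → ℝ := fun x =>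
    Ω.indicator (fun _ => (1 : ℝ)) x - T.indicator (fun _ => (1 : ℝ)) x with hD
  have hDm : Measurable D := (measurable_const.indicator hΩ.measurableSet).sub
    (measurable_const.indicator hTo.measurableSet)
  have hDs : HasCompactSupport D := by
    refine HasCompactSupport.intro (hb.union hTb).isCompact_closure fun x hx => ?_
    have h1 : x ∉ Ω := fun hx' => hx (subset_closure (Or.inl hx'))
    have h2 : x ∉ T := fun hx' => hx (subset_closure (Or.inr hx'))
    simp [hD, h1, h2]
  have hD1 : ∀ x, |D x| ≤ 1 := by
    intro x
    by_cases h1 : x ∈ Ω <;> by_cases h2 : x ∈ T <;> simp [hD, h1, h2]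
  -- D² is the indicator of the symmetric difference of Ω and its translate, whose two halves have
  -- equal area.
  have hsq : ∫ x, D x * D x = 2 * volume.real {x | x ∈ Ω ∧ x + z ∉ Ω} := by
    have e : ∀ x, D x * D x = (Ω \ T).indicator (fun _ => (1 : ℝ)) x +
        (T \ Ω).indicator (fun _ => (1 : ℝ)) x := by
      intro x
      by_cases h1 : x ∈ Ω <;> by_cases h2 : x ∈ T <;> simp [hD, h1, h2]
    have hm1 : MeasurableSet (Ω \ T) := hΩ.measurableSet.diff hTo.measurableSet
    have hm2 : MeasurableSet (T \ Ω) := hTo.measurableSet.diff hΩ.measurableSet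
    have hf1 : volume (Ω \ T) ≠ ⊤ := (measure_mono_top sdiff_subset |>.mt) hfin
    have hf2 : volume (T \ Ω) ≠ ⊤ := (measure_mono_top sdiff_subset |>.mt) (hvT ▸ hfin)
    have hsymm : volume (T \ Ω) = volume (Ω \ T) :=
      measure_sdiff_symm hTo.measurableSet.nullMeasurableSet hΩ.measurableSet.nullMeasurableSet
        hvT (measure_ne_top_of_subset inter_subset_left (hvT ▸ hfin))
    simp_rw [e]
    rw [integral_add ((integrable_indicator_iff hm1).2 (integrableOn_const hf1))
      ((integrable_indicator_iff hm2).2 (integrableOn_const hf2)), integral_indicator_const _ hm1,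
      integral_indicator_const _ hm2, Measure.real, Measure.real, hsymm, Measure.real]
    have : {x | x ∈ Ω ∧ x + z ∉ Ω} = Ω \ T := rfl
    rw [this]; simp; ring
  rw [← hsq]
  refine integral_sq_le_of_forall_contDiff hDm hDs hD1 fun φ hφ hφs hφ1 => ?_
  have hφi : Integrable φ := hφ.continuous.integrable_of_hasCompactSupport hφs
  have e1 : ∫ x, D x * φ x = ∫ x in Ω, (φ x - φ (x - z)) := by
    have a1 : ∫ x, D x * φ x = (∫ x in Ω, φ x) - ∫ x in T, φ x := by
      rw [← integral_indicator hΩ.measurableSet, ← integral_indicator hTo.measurableSet,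
        ← integral_sub (hφi.indicator hΩ.measurableSet) (hφi.indicator hTo.measurableSet)]
      congr 1
      ext1 x
      by_cases h1 : x ∈ Ω <;> by_cases h2 : x ∈ T <;> simp [hD, h1, h2]
    have a2 : ∫ x in T, φ x = ∫ x in Ω, φ (x - z) := by
      rw [← (measurePreserving_add_right volume z).setIntegral_preimage_emb
        (MeasurableEquiv.addRight z).measurableEmbedding (fun x => φ (x - z)) Ω]
      simp [hT]
    rw [a1, a2, integral_sub hφi.integrableOn (hφi.comp_sub_right z).integrableOn]
  rw [e1, h.integral_sub_translate hΩ hb hφ hφs z, ← Finset.sum_neg_distrib]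
  refine Finset.sum_le_sum fun i hi => ?_
  have hi' := Finset.mem_range.1 hi
  refine (neg_le_abs _).trans ?_
  exact abs_integral_segmentAverage_closed_le (h.contDiff_one hi') (h.periodic i hi')
    (h.constantSpeed i hi') (hm i hi') u (hδ i hi') hz hφ.continuous hφ1

end IsBoundaryDecomposition


/-! ### The kernel and the energy -/

theorem integral_abs_cos : ∫ θ in (-Real.pi)..Real.pi, |Real.cos θ| = 4 := by
  have hper : Function.Periodic (fun θ => |Real.cos θ|) Real.pi := fun θ => by
    simp [Real.cos_add_pi]
  have hc : Continuous fun θ => |Real.cos θ| := Real.continuous_cos.abs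
  have h1 : ∫ θ in (-(Real.pi / 2))..(Real.pi / 2), |Real.cos θ| = 2 := by
    have : ∫ θ in (-(Real.pi / 2))..(Real.pi / 2), |Real.cos θ| =
        ∫ θ in (-(Real.pi / 2))..(Real.pi / 2), Real.cos θ := by
      refine intervalIntegral.integral_congr fun θ hθ => ?_
      rw [uIcc_of_le (by linarith [Real.pi_pos])] at hθ
      exact abs_of_nonneg (Real.cos_nonneg_of_mem_Icc hθ)
    rw [this, integral_cos]
    simp
    norm_num
  have h2 : ∀ a, ∫ θ in a..(a + Real.pi), |Real.cos θ| = 2 := fun a => by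
    rw [hper.intervalIntegral_add_eq a (-(Real.pi / 2))]
    convert h1 using 2
    ring
  rw [← intervalIntegral.integral_add_adjacent_intervals (hc.intervalIntegrable _ 0)
    (hc.intervalIntegrable _ _)]
  have h3 := h2 (-Real.pi)
  have h4 := h2 0
  rw [neg_add_cancel] at h3
  rw [zero_add] at h4
  rw [h3, h4]; norm_num

/-- With v in polar form the integrand is |v| |cos(θ - arg v)|, and the phase disappears over a full
period. -/
theorem integral_abs_inner_circle (v : Plane) :
    ∫ θ in (-Real.pi)..Real.pi, |v 0 * Real.cos θ + v 1 * Real.sin θ| = 4 * ‖v‖ := by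
  set c : ℂ := ⟨v 0, v 1⟩ with hc
  have hn : ‖c‖ = ‖v‖ := by
    have h1 : ‖c‖ ^ 2 = ‖v‖ ^ 2 := by
      rw [plane_norm_sq, Complex.sq_norm, Complex.normSq_apply]; simp [hc]; ring
    exact (sq_eq_sq₀ (norm_nonneg _) (norm_nonneg _)).1 h1
  have e0 : v 0 = ‖v‖ * Real.cos c.arg := by rw [← hn, Complex.norm_mul_cos_arg]
  have e1 : v 1 = ‖v‖ * Real.sin c.arg := by rw [← hn, Complex.norm_mul_sin_arg]
  have e : ∀ θ, |v 0 * Real.cos θ + v 1 * Real.sin θ| = ‖v‖ * |Real.cos (θ - c.arg)| := by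
    intro θ
    rw [e0, e1, Real.cos_sub, ← abs_of_nonneg (norm_nonneg v), ← abs_mul,
      abs_of_nonneg (norm_nonneg v)]
    congr 1; ring
  simp_rw [e]
  rw [intervalIntegral.integral_const_mul, mul_comm]
  congr 1
  rw [intervalIntegral.integral_comp_sub_right (fun θ => |Real.cos θ|)]
  have hper : Function.Periodic (fun θ => |Real.cos θ|) (2 * Real.pi) := fun θ => by
    simp
  have := hper.intervalIntegral_add_eq (-Real.pi - c.arg) (-Real.pi)
  rw [← integral_abs_cos]
  convert this using 2 <;> ring

/-- Integration in polar coordinates of a radial function times `|⟨v, z⟩|`. -/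
theorem lintegral_radial_mul_abs_inner {k : ℝ → ℝ≥0∞} (hk : Measurable k) (v : Plane) :
    ∫⁻ z : Plane, k ‖z‖ * ENNReal.ofReal |inner ℝ v z| =
      ENNReal.ofReal (4 * ‖v‖) * ∫⁻ r in Ioi (0 : ℝ), ENNReal.ofReal (r ^ 2) * k r := by
  rw [lintegral_plane, ← lintegral_comp_polarCoord_symm]
  have htarget : polarCoord.target = Ioi (0 : ℝ) ×ˢ Ioo (-Real.pi) Real.pi := rfl
  have e : ∀ p ∈ polarCoord.target, ENNReal.ofReal p.1 • (k ‖(!₂[(polarCoord.symm p).1,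
      (polarCoord.symm p).2] : Plane)‖ * ENNReal.ofReal |inner ℝ v
        (!₂[(polarCoord.symm p).1, (polarCoord.symm p).2] : Plane)|) =
      (ENNReal.ofReal (p.1 ^ 2) * k p.1) *
        ENNReal.ofReal |v 0 * Real.cos p.2 + v 1 * Real.sin p.2| := by
    rintro ⟨r, θ⟩ hp
    have hr : 0 < r := hp.1
    have hnorm : ‖(!₂[r * Real.cos θ, r * Real.sin θ] : Plane)‖ = r := by
      have : ‖(!₂[r * Real.cos θ, r * Real.sin θ] : Plane)‖ ^ 2 = r ^ 2 := by
        rw [plane_norm_sq]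
        simp only [Matrix.cons_val_zero, Matrix.cons_val_one]
        nlinarith [Real.sin_sq_add_cos_sq θ]
      exact (sq_eq_sq₀ (norm_nonneg _) hr.le).1 this
    have hin : inner ℝ v (!₂[r * Real.cos θ, r * Real.sin θ] : Plane) =
        r * (v 0 * Real.cos θ + v 1 * Real.sin θ) := by
      rw [plane_inner]; simp; ring
    simp only [polarCoord_symm_apply]
    rw [hnorm, hin, abs_mul, abs_of_pos hr, ENNReal.ofReal_mul hr.le, sq,
      ENNReal.ofReal_mul hr.le, smul_eq_mul]
    ring
  rw [setLIntegral_congr_fun (polarCoord.open_target.measurableSet) e, htarget,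
    Measure.volume_eq_prod, ← Measure.prod_restrict,
    lintegral_prod_mul (f := fun r => ENNReal.ofReal (r ^ 2) * k r)
      (g := fun θ => ENNReal.ofReal |v 0 * Real.cos θ + v 1 * Real.sin θ|)]
  · have hcont : Continuous fun θ => |v 0 * Real.cos θ + v 1 * Real.sin θ| := by fun_prop
    rw [← ofReal_integral_eq_lintegral_ofReal
      ((hcont.integrableOn_Icc (a := -Real.pi) (b := Real.pi)).mono_set Ioo_subset_Icc_self)
      (ae_of_all _ fun θ => abs_nonneg _),
      setIntegral_Ioo_eq_intervalIntegral (by linarith [Real.pi_pos]), integral_abs_inner_circle,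
      mul_comm]
  · exact ((by fun_prop : Measurable fun r : ℝ => ENNReal.ofReal (r ^ 2)).mul hk).aemeasurable
  · fun_prop

theorem lintegral_sub_mul_exp {β δ : ℝ} (hβ : 0 < β) :
    ∫⁻ r in Ioi δ, ENNReal.ofReal ((r - δ) * Real.exp (-(β * r))) =
      ENNReal.ofReal (Real.exp (-(β * δ)) / β ^ 2) := by
  set A : ℝ → ℝ := fun r => -((r - δ) / β + 1 / β ^ 2) * Real.exp (-(β * r)) with hA
  have hd : ∀ r ∈ Ici δ, HasDerivAt A ((r - δ) * Real.exp (-(β * r))) r := by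
    intro r _
    have h1 : HasDerivAt (fun r : ℝ => -((r - δ) / β + 1 / β ^ 2)) (-(1 / β)) r :=
      ((((hasDerivAt_id r).sub_const δ).div_const β).add_const _).neg
    have h2 : HasDerivAt (fun r : ℝ => Real.exp (-(β * r)))
        (Real.exp (-(β * r)) * (-(β * 1))) r :=
      (((hasDerivAt_id r).const_mul β).neg).exp
    refine (h1.mul h2).congr_deriv ?_
    field_simp
    ring
  have hnn : ∀ r ∈ Ioi δ, 0 ≤ (r - δ) * Real.exp (-(β * r)) := fun r hr =>
    mul_nonneg (sub_nonneg.2 (le_of_lt hr)) (Real.exp_pos _).le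
  have hlim : Tendsto A atTop (𝓝 0) := by
    have h1 : Tendsto (fun r : ℝ => r * Real.exp (-β * r)) atTop (𝓝 0) := by
      simpa using Real.tendsto_pow_mul_exp_neg_atTop_nhds_zero 1 |>.comp
        (tendsto_id.const_mul_atTop hβ) |>.const_mul β⁻¹ |>.congr fun r => by
          simp; field_simp
    have h2 : Tendsto (fun r : ℝ => Real.exp (-β * r)) atTop (𝓝 0) :=
      Real.tendsto_exp_atBot.comp (tendsto_id.const_mul_atTop_of_neg (by linarith))
    have h3 := (h1.const_mul (-(1 / β))).add (h2.const_mul (δ / β - 1 / β ^ 2))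
    simp only [mul_zero, add_zero] at h3
    refine h3.congr fun r => ?_
    simp only [hA, neg_mul]
    ring
  have hintg := integrableOn_Ioi_deriv_of_nonneg' hd hnn hlim
  rw [← ofReal_integral_eq_lintegral_ofReal hintg
    ((ae_restrict_iff' measurableSet_Ioi).2 (ae_of_all _ hnn)),
    integral_Ioi_of_hasDerivAt_of_nonneg' hd hnn hlim]
  congr 1
  simp [hA]
  ring

theorem ofReal_integral_le_lintegral {X : Type*} [MeasurableSpace X] {μ : Measure X} {f : X → ℝ}
    (hf : ∀ x, 0 ≤ f x) : ENNReal.ofReal (∫ x, f x ∂μ) ≤ ∫⁻ x, ENNReal.ofReal (f x) ∂μ := by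
  by_cases hi : Integrable f μ
  · rw [ofReal_integral_eq_lintegral_ofReal hi (ae_of_all _ hf)]
  · rw [integral_undef hi]; simp

/-- The substitution y = x + z and Tonelli. Working in [0, ∞] requires no integrability; the upper
bound persists for a divergent Bochner integral, whose value is 0 by convention. -/
theorem ofReal_nonlocal_le {Ω : Set Plane} (hΩ : MeasurableSet Ω) (β : ℝ) :
    ENNReal.ofReal (∫ x in Ω, ∫ y in Ωᶜ, Real.exp (-(β * ‖x - y‖)) / ‖x - y‖) ≤
      ∫⁻ z : Plane, ENNReal.ofReal (Real.exp (-(β * ‖z‖)) / ‖z‖) *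
        volume {x | x ∈ Ω ∧ x + z ∉ Ω} := by
  set k : Plane → ℝ≥0∞ := fun z => ENNReal.ofReal (Real.exp (-(β * ‖z‖)) / ‖z‖) with hk
  have hkm : Measurable k := by fun_prop
  have hnn : ∀ x y : Plane, 0 ≤ Real.exp (-(β * ‖x - y‖)) / ‖x - y‖ := fun x y => by positivity
  calc ENNReal.ofReal (∫ x in Ω, ∫ y in Ωᶜ, Real.exp (-(β * ‖x - y‖)) / ‖x - y‖)
      ≤ ∫⁻ x in Ω, ENNReal.ofReal (∫ y in Ωᶜ, Real.exp (-(β * ‖x - y‖)) / ‖x - y‖) :=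
        ofReal_integral_le_lintegral fun x => integral_nonneg (hnn x)
    _ ≤ ∫⁻ x in Ω, ∫⁻ y in Ωᶜ, k (y - x) := by
        refine lintegral_mono fun x => (ofReal_integral_le_lintegral (hnn x)).trans ?_
        refine lintegral_mono fun y => ?_
        simp only [hk, norm_sub_rev x y, le_refl]
    _ = ∫⁻ x, ∫⁻ z, k z * {p : Plane × Plane | p.1 ∈ Ω ∧ p.1 + p.2 ∉ Ω}.indicator 1 (x, z) := by
        rw [← lintegral_indicator hΩ]
        refine lintegral_congr fun x => ?_
        by_cases hx : x ∈ Ω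
        · rw [indicator_of_mem hx, ← lintegral_indicator hΩ.compl]
          rw [← lintegral_add_left_eq_self _ x]
          refine lintegral_congr fun z => ?_
          by_cases hz : x + z ∈ Ω <;> simp [hx, hz]
        · rw [indicator_of_notMem hx]
          simp [hx]
    _ = ∫⁻ z, ∫⁻ x, k z * {p : Plane × Plane | p.1 ∈ Ω ∧ p.1 + p.2 ∉ Ω}.indicator 1 (x, z) := by
        refine lintegral_lintegral_swap ?_
        have hS : MeasurableSet {p : Plane × Plane | p.1 ∈ Ω ∧ p.1 + p.2 ∉ Ω} :=
          (measurable_fst hΩ).inter ((measurable_fst.add measurable_snd) hΩ.compl)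
        exact ((hkm.comp measurable_snd).mul (measurable_one.indicator hS)).aemeasurable
    _ = _ := by
        refine lintegral_congr fun z => ?_
        rw [lintegral_const_mul]
        · congr 1
          have hS : MeasurableSet {x : Plane | x ∈ Ω ∧ x + z ∉ Ω} :=
            hΩ.inter ((measurable_id.add_const z) hΩ.compl)
          rw [← lintegral_indicator_one hS]
          rfl
        · have hS : MeasurableSet {x : Plane | x ∈ Ω ∧ x + z ∉ Ω} :=
            hΩ.inter ((measurable_id.add_const z) hΩ.compl)
          exact (measurable_one.indicator hS)

/-- The radial profile of the kernel. -/
noncomputable def kernelProfile (β r : ℝ) : ℝ := Real.exp (-(β * r)) / r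

/-- Of the weight r², one factor r is the polar Jacobian and the other comes from |⟨v, z⟩|. Against
the profile it leaves (r - δ)₊ exp(-β r). -/
theorem lintegral_kernelProfile_far {β δ : ℝ} (hβ : 0 < β) (hδ : 0 ≤ δ) :
    ∫⁻ r in Ioi (0 : ℝ), ENNReal.ofReal (r ^ 2) *
        ENNReal.ofReal (kernelProfile β r * (1 - min 1 (δ / r))) =
      ENNReal.ofReal (Real.exp (-(β * δ)) / β ^ 2) := by
  rw [← lintegral_sub_mul_exp hβ]
  rw [← lintegral_indicator measurableSet_Ioi, ← lintegral_indicator measurableSet_Ioi]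
  refine lintegral_congr fun r => ?_
  by_cases hr : 0 < r
  · rw [indicator_of_mem (mem_Ioi.2 hr), ← ENNReal.ofReal_mul (by positivity)]
    by_cases hrδ : δ < r
    · rw [indicator_of_mem (mem_Ioi.2 hrδ), min_eq_right ((div_le_one hr).2 hrδ.le),
        kernelProfile]
      congr 1
      field_simp
    · rw [indicator_of_notMem (by simpa using hrδ),
        min_eq_left ((one_le_div hr).2 (not_lt.1 hrδ))]
      simp
  · rw [indicator_of_notMem (by simpa using hr), indicator_of_notMem]
    simp only [mem_Ioi, not_lt] at hr ⊢
    linarith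

/-- Near and far parts add up to r exp(-β r), of integral 1/β². -/
theorem lintegral_kernelProfile_near {β δ : ℝ} (hβ : 0 < β) (hδ : 0 ≤ δ) :
    ∫⁻ r in Ioi (0 : ℝ), ENNReal.ofReal (r ^ 2) *
        ENNReal.ofReal (kernelProfile β r * min 1 (δ / r)) =
      ENNReal.ofReal (1 / β ^ 2 - Real.exp (-(β * δ)) / β ^ 2) := by
  have hadd : (∫⁻ r in Ioi (0 : ℝ), ENNReal.ofReal (r ^ 2) *
        ENNReal.ofReal (kernelProfile β r * min 1 (δ / r))) +
      ∫⁻ r in Ioi (0 : ℝ), ENNReal.ofReal (r ^ 2) *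
        ENNReal.ofReal (kernelProfile β r * (1 - min 1 (δ / r))) =
      ENNReal.ofReal (1 / β ^ 2) := by
    have h0 := lintegral_sub_mul_exp (β := β) (δ := 0) hβ
    simp only [mul_zero, neg_zero, Real.exp_zero] at h0
    rw [← h0, ← lintegral_add_left (by unfold kernelProfile; fun_prop)]
    refine setLIntegral_congr_fun measurableSet_Ioi fun r hr => ?_
    have hr' : 0 < r := hr
    have hk : 0 ≤ kernelProfile β r := by unfold kernelProfile; positivity
    have h1 : min 1 (δ / r) ≤ 1 := min_le_left _ _
    have h2 : 0 ≤ min 1 (δ / r) := le_min zero_le_one (by positivity)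
    rw [← mul_add, ← ENNReal.ofReal_add (mul_nonneg hk h2) (mul_nonneg hk (by linarith)),
      ← ENNReal.ofReal_mul (by positivity)]
    congr 1
    rw [kernelProfile]
    field_simp
    ring
  rw [lintegral_kernelProfile_far hβ hδ] at hadd
  rw [ENNReal.ofReal_sub _ (by positivity), ← hadd, ENNReal.add_sub_cancel_right ENNReal.ofReal_ne_top]

namespace IsBoundaryDecomposition

variable {Ω : Set Plane} {N : ℕ} {γ : ℕ → ℝ → Plane}

/-- For each z the area moved out is bounded by chords with weight 1 - κ and arcs with weight κ =
min 1 (δ/|z|). Integrated against the kernel, each chord or tangent v gives 4|v| times a radial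
integral: exp(-βδ)/β² for the chords and the complement to 1/β² for the arcs. Compared with 2/β²
times the length, the gain is the length defect of the polygons. The offset u of the mesh stays free
for a later averaging. -/
theorem nonlocal_le (h : IsBoundaryDecomposition Ω N γ) (hΩ : IsOpen Ω)
    (hb : Bornology.IsBounded Ω) {β δ : ℝ} (hβ : 0 < β) (hδ0 : 0 ≤ δ) {m : ℕ → ℕ}
    (hm : ∀ i < N, 0 < m i) (hδ : ∀ i < N, curveLength (γ i) / m i ≤ δ) (u : ℝ) :
    ∫ x in Ω, ∫ y in Ωᶜ, Real.exp (-(β * ‖x - y‖)) / ‖x - y‖ ≤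
      2 / β ^ 2 * ∑ i ∈ Finset.range N, (curveLength (γ i) -
        Real.exp (-(β * δ)) * (curveLength (γ i) - chordLength (γ i) (m i) u)) := by
  set J := ∫ x in Ω, ∫ y in Ωᶜ, Real.exp (-(β * ‖x - y‖)) / ‖x - y‖ with hJ
  set c₁ := Real.exp (-(β * δ)) / β ^ 2 with hc₁
  set c₂ := 1 / β ^ 2 - Real.exp (-(β * δ)) / β ^ 2 with hc₂
  have hc₁0 : 0 ≤ c₁ := by positivity
  have hc₂0 : 0 ≤ c₂ := by
    rw [hc₂, ← sub_div]
    have : Real.exp (-(β * δ)) ≤ 1 := Real.exp_le_one_iff.2 (by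
      have := mul_nonneg hβ.le hδ0
      linarith)
    exact div_nonneg (by linarith) (by positivity)
  set K₁ : ℝ → ℝ≥0∞ := fun r => ENNReal.ofReal (kernelProfile β r * (1 - min 1 (δ / r))) with hK₁
  set K₂ : ℝ → ℝ≥0∞ := fun r => ENNReal.ofReal (kernelProfile β r * min 1 (δ / r)) with hK₂
  have hK₁m : Measurable K₁ := by simp only [hK₁]; unfold kernelProfile; fun_prop
  have hK₂m : Measurable K₂ := by simp only [hK₂]; unfold kernelProfile; fun_prop
  have hkn : ∀ z : Plane, 0 ≤ kernelProfile β ‖z‖ := fun z => by unfold kernelProfile; positivity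
  have hw1 : ∀ z : Plane, 0 ≤ 1 - min 1 (δ / ‖z‖) := fun z => sub_nonneg.2 (min_le_left _ _)
  have hw2 : ∀ z : Plane, 0 ≤ min 1 (δ / ‖z‖) := fun z => le_min zero_le_one (by positivity)
  have hcd : ∀ i ∈ Finset.range N, Continuous (deriv (γ i)) := fun i hi =>
    h.continuous_deriv (Finset.mem_range.1 hi)
  have hpt : ∀ z : Plane, ENNReal.ofReal (kernelProfile β ‖z‖) *
      (2 * volume {x | x ∈ Ω ∧ x + z ∉ Ω}) ≤ ∑ i ∈ Finset.range N,
        ((∑ j ∈ Finset.range (m i), K₁ ‖z‖ * ENNReal.ofReal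
          |inner ℝ (perp (γ i (u + (j + 1 : ℕ) / m i) - γ i (u + j / m i))) z|) +
        ∫⁻ t in Ioc (0 : ℝ) 1, K₂ ‖z‖ * ENNReal.ofReal |inner ℝ (perp (deriv (γ i) t)) z|) := by
    intro z
    -- At z = 0 the kernel is 0 by the convention for division by zero.
    by_cases hz : z = 0
    · simp [hz, kernelProfile]
    have hfin : volume {x | x ∈ Ω ∧ x + z ∉ Ω} ≠ ⊤ :=
      measure_ne_top_of_subset (fun x hx => hx.1) hb.measure_lt_top.ne
    have h2 := h.measureReal_translate_le hΩ hb hm hδ u hz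
    have e1 : 2 * volume {x | x ∈ Ω ∧ x + z ∉ Ω} =
        ENNReal.ofReal (2 * volume.real {x | x ∈ Ω ∧ x + z ∉ Ω}) := by
      rw [ENNReal.ofReal_mul (by norm_num), Measure.real, ENNReal.ofReal_toReal hfin]
      simp
    rw [e1]
    refine (mul_le_mul_right (ENNReal.ofReal_le_ofReal h2) _).trans (le_of_eq ?_)
    rw [← ENNReal.ofReal_mul (hkn z), Finset.mul_sum, ENNReal.ofReal_sum_of_nonneg]
    · refine Finset.sum_congr rfl fun i hi => ?_
      have hintg : 0 ≤ ∫ t in (0 : ℝ)..1, |inner ℝ (perp (deriv (γ i) t)) z| :=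
        intervalIntegral.integral_nonneg (by norm_num) fun t _ => abs_nonneg _
      have hch : 0 ≤ chordFlux (γ i) (m i) u z := Finset.sum_nonneg fun j _ => abs_nonneg _
      rw [mul_add, ENNReal.ofReal_add (mul_nonneg (hkn z) (mul_nonneg (hw1 z) hch))
        (mul_nonneg (hkn z) (mul_nonneg (hw2 z) hintg)), ← mul_assoc, ← mul_assoc]
      congr 1
      · rw [ENNReal.ofReal_mul (mul_nonneg (hkn z) (hw1 z)), chordFlux,
          ENNReal.ofReal_sum_of_nonneg fun j _ => abs_nonneg _, Finset.mul_sum]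
      · have hcont : Continuous fun t => |inner ℝ (perp (deriv (γ i) t)) z| :=
          ((continuous_perp.comp (hcd i hi)).inner continuous_const).abs
        rw [ENNReal.ofReal_mul (mul_nonneg (hkn z) (hw2 z)), lintegral_const_mul,
          intervalIntegral.integral_of_le (by norm_num), ofReal_integral_eq_lintegral_ofReal]
        · exact (hcont.integrableOn_Icc (a := 0) (b := 1)).mono_set Ioc_subset_Icc_self
        · exact ae_of_all _ fun t => abs_nonneg _
        · exact (ENNReal.continuous_ofReal.comp hcont).measurable
    · intro i hi
      have hintg : 0 ≤ ∫ t in (0 : ℝ)..1, |inner ℝ (perp (deriv (γ i) t)) z| :=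
        intervalIntegral.integral_nonneg (by norm_num) fun t _ => abs_nonneg _
      have hch : 0 ≤ chordFlux (γ i) (m i) u z := Finset.sum_nonneg fun j _ => abs_nonneg _
      exact mul_nonneg (hkn z)
        (add_nonneg (mul_nonneg (hw1 z) hch) (mul_nonneg (hw2 z) hintg))
  have hmeas1 : ∀ c : Plane, Measurable fun z : Plane => K₁ ‖z‖ * ENNReal.ofReal |inner ℝ c z| :=
    fun c => (hK₁m.comp measurable_norm).mul (by fun_prop)
  have hmeas2 : ∀ i ∈ Finset.range N, Measurable (Function.uncurry fun (z : Plane) (t : ℝ) =>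
      K₂ ‖z‖ * ENNReal.ofReal |inner ℝ (perp (deriv (γ i) t)) z|) := by
    intro i hi
    refine Measurable.mul (hK₂m.comp (measurable_norm.comp measurable_fst)) ?_
    have : Continuous fun p : Plane × ℝ => |inner ℝ (perp (deriv (γ i) p.2)) p.1| :=
      ((continuous_perp.comp ((hcd i hi).comp continuous_snd)).inner continuous_fst).abs
    exact (ENNReal.continuous_ofReal.comp this).measurable
  have hle : ENNReal.ofReal (2 * J) ≤ ENNReal.ofReal (∑ i ∈ Finset.range N,
      (4 * chordLength (γ i) (m i) u * c₁ + 4 * curveLength (γ i) * c₂)) := by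
    calc ENNReal.ofReal (2 * J) = 2 * ENNReal.ofReal J := by
          rw [ENNReal.ofReal_mul (by norm_num)]; simp
      _ ≤ 2 * ∫⁻ z : Plane, ENNReal.ofReal (kernelProfile β ‖z‖) *
          volume {x | x ∈ Ω ∧ x + z ∉ Ω} :=
          mul_le_mul_right (ofReal_nonlocal_le hΩ.measurableSet β) _
      _ = ∫⁻ z : Plane, ENNReal.ofReal (kernelProfile β ‖z‖) *
          (2 * volume {x | x ∈ Ω ∧ x + z ∉ Ω}) := by
          rw [← lintegral_const_mul' _ _ (by norm_num)]
          refine lintegral_congr fun z => ?_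
          ring
      _ ≤ _ := lintegral_mono hpt
      _ = ∑ i ∈ Finset.range N,
        ((∑ j ∈ Finset.range (m i), ENNReal.ofReal
          (4 * ‖γ i (u + (j + 1 : ℕ) / m i) - γ i (u + j / m i)‖) * ENNReal.ofReal c₁) +
          ENNReal.ofReal (4 * curveLength (γ i)) * ENNReal.ofReal c₂) := by
          rw [lintegral_finsetSum']
          · refine Finset.sum_congr rfl fun i hi => ?_
            rw [lintegral_add_left (Finset.measurable_fun_sum _ fun j _ => hmeas1 _),
              lintegral_finsetSum _ fun j _ => hmeas1 _]
            congr 1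
            · refine Finset.sum_congr rfl fun j _ => ?_
              rw [lintegral_radial_mul_abs_inner hK₁m, norm_perp,
                lintegral_kernelProfile_far hβ hδ0]
            · rw [lintegral_lintegral_swap (hmeas2 i hi).aemeasurable]
              have : ∀ t : ℝ, ∫⁻ z : Plane, K₂ ‖z‖ *
                  ENNReal.ofReal |inner ℝ (perp (deriv (γ i) t)) z| =
                  ENNReal.ofReal (4 * curveLength (γ i)) * ENNReal.ofReal c₂ := by
                intro t
                rw [lintegral_radial_mul_abs_inner hK₂m, norm_perp,
                  h.constantSpeed i (Finset.mem_range.1 hi), lintegral_kernelProfile_near hβ hδ0]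
              simp_rw [this]
              simp
          · intro i hi
            refine AEMeasurable.add
              (Finset.measurable_fun_sum _ fun j _ => hmeas1 _).aemeasurable ?_
            exact ((hmeas2 i hi).lintegral_prod_right' (ν := volume.restrict (Ioc (0 : ℝ) 1))).aemeasurable
      _ = _ := by
          rw [ENNReal.ofReal_sum_of_nonneg]
          · refine Finset.sum_congr rfl fun i hi => ?_
            have hl := (h.curveLength_pos (Finset.mem_range.1 hi)).le
            have hch : 0 ≤ chordLength (γ i) (m i) u :=
              Finset.sum_nonneg fun j _ => norm_nonneg _
            rw [ENNReal.ofReal_add (by positivity) (by positivity),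
              ENNReal.ofReal_mul (p := 4 * curveLength (γ i)) (by positivity),
              ENNReal.ofReal_mul (p := 4 * chordLength (γ i) (m i) u) (by positivity),
              chordLength, Finset.mul_sum,
              ENNReal.ofReal_sum_of_nonneg (fun j _ => by positivity), Finset.sum_mul]
          · intro i hi
            have hl := (h.curveLength_pos (Finset.mem_range.1 hi)).le
            have hch : 0 ≤ chordLength (γ i) (m i) u :=
              Finset.sum_nonneg fun j _ => norm_nonneg _
            positivity
  have hnn : 0 ≤ ∑ i ∈ Finset.range N,
      (4 * chordLength (γ i) (m i) u * c₁ + 4 * curveLength (γ i) * c₂) := by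
    refine Finset.sum_nonneg fun i hi => ?_
    have hl := (h.curveLength_pos (Finset.mem_range.1 hi)).le
    have hch : 0 ≤ chordLength (γ i) (m i) u :=
      Finset.sum_nonneg fun j _ => norm_nonneg _
    positivity
  rw [ENNReal.ofReal_le_ofReal_iff hnn] at hle
  have e : 2 / β ^ 2 * ∑ i ∈ Finset.range N, (curveLength (γ i) -
        Real.exp (-(β * δ)) * (curveLength (γ i) - chordLength (γ i) (m i) u)) =
      (∑ i ∈ Finset.range N,
        (4 * chordLength (γ i) (m i) u * c₁ + 4 * curveLength (γ i) * c₂)) / 2 := by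
    rw [Finset.mul_sum, Finset.sum_div]
    refine Finset.sum_congr rfl fun i _ => ?_
    rw [hc₁, hc₂]
    ring
  rw [e]
  linarith

/-- Lower bound for the energy in terms of inscribed polygons of the boundary curves. -/
theorem le_energy (h : IsBoundaryDecomposition Ω N γ) (hΩ : IsOpen Ω)
    (hb : Bornology.IsBounded Ω) (hP : perimeter Ω < ⊤) {lam α δ : ℝ} (hlam : 0 < lam)
    (hα : 0 < α) (hδ0 : 0 ≤ δ) {m : ℕ → ℕ}
    (hm : ∀ i < N, 0 < m i) (hδ : ∀ i < N, curveLength (γ i) / m i ≤ δ) (u : ℝ) :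
    (1 - 1 / (2 * Real.pi * α ^ 2)) * ∑ i ∈ Finset.range N, curveLength (γ i) +
      Real.exp (-(lam * α * δ)) / (2 * Real.pi * α ^ 2) *
        ∑ i ∈ Finset.range N, (curveLength (γ i) - chordLength (γ i) (m i) u) ≤
      energy lam α Ω := by
  have hβ : 0 < lam * α := mul_pos hlam hα
  have h1 := h.nonlocal_le hΩ hb hβ hδ0 hm hδ u
  have h2 : ∑ i ∈ Finset.range N, curveLength (γ i) ≤ (perimeter Ω).toReal :=
    (ENNReal.ofReal_le_iff_le_toReal hP.ne).1 (h.sum_curveLength_le_perimeter hΩ hb)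
  unfold energy
  have h3 := mul_le_mul_of_nonneg_left h1
    (by positivity : 0 ≤ lam ^ 2 / (4 * Real.pi))
  rw [Finset.sum_sub_distrib, ← Finset.mul_sum] at h3
  set S := ∑ i ∈ Finset.range N, curveLength (γ i)
  set E := ∑ i ∈ Finset.range N, (curveLength (γ i) - chordLength (γ i) (m i) u)
  have e : lam ^ 2 / (4 * Real.pi) * (2 / (lam * α) ^ 2 *
      (S - Real.exp (-(lam * α * δ)) * E)) =
      1 / (2 * Real.pi * α ^ 2) * S - Real.exp (-(lam * α * δ)) / (2 * Real.pi * α ^ 2) * E := by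
    field_simp
    ring
  rw [e] at h3
  linarith

end IsBoundaryDecomposition


/-! ### Regularized tangents of closed curves -/

/-- Cauchy–Schwarz, by expanding the nonnegative integral of (g - c)² with c the mean of g. -/
theorem sq_intervalIntegral_le {g : ℝ → ℝ} (hg : Continuous g) {a b : ℝ} (hab : a ≤ b) :
    (∫ t in a..b, g t) ^ 2 ≤ (b - a) * ∫ t in a..b, g t ^ 2 := by
  rcases hab.eq_or_lt with rfl | hlt
  · simp
  have hba : 0 < b - a := sub_pos.2 hlt
  set A := ∫ t in a..b, g t with hA
  set c := A / (b - a) with hc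
  have h0 : 0 ≤ ∫ t in a..b, (g t - c) ^ 2 :=
    intervalIntegral.integral_nonneg hab fun t _ => sq_nonneg _
  have e : ∫ t in a..b, (g t - c) ^ 2 = (∫ t in a..b, g t ^ 2) - 2 * c * A + (b - a) * c ^ 2 := by
    have : ∀ t, (g t - c) ^ 2 = g t ^ 2 - 2 * c * g t + c ^ 2 := fun t => by ring
    simp_rw [this]
    rw [intervalIntegral.integral_add, intervalIntegral.integral_sub,
      intervalIntegral.integral_const_mul, intervalIntegral.integral_const, smul_eq_mul]
    · exact (hg.pow 2).intervalIntegrable _ _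
    · exact (continuous_const.mul hg).intervalIntegrable _ _
    · exact ((hg.pow 2).sub (continuous_const.mul hg)).intervalIntegrable _ _
    · exact continuous_const.intervalIntegrable _ _
  have e2 : 2 * c * A - (b - a) * c ^ 2 = A ^ 2 / (b - a) := by
    rw [hc]; field_simp; ring
  have h3 : A ^ 2 / (b - a) ≤ ∫ t in a..b, g t ^ 2 := by linarith
  rw [div_le_iff₀ hba] at h3
  linarith

theorem norm_sq_intervalIntegral_le {f : ℝ → Plane} (hf : Continuous f) {a b : ℝ} (hab : a ≤ b) :
    ‖∫ t in a..b, f t‖ ^ 2 ≤ (b - a) * ∫ t in a..b, ‖f t‖ ^ 2 :=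
  (pow_le_pow_left₀ (norm_nonneg _)
    (intervalIntegral.norm_integral_le_integral_norm hab) 2).trans
    (sq_intervalIntegral_le hf.norm hab)

theorem intervalIntegral_swap_of_continuous {E : Type*} [NormedAddCommGroup E] [NormedSpace ℝ E]
    {F : ℝ → ℝ → E} (hF : Continuous (Function.uncurry F)) (a b c d : ℝ) :
    ∫ x in a..b, ∫ y in c..d, F x y = ∫ y in c..d, ∫ x in a..b, F x y := by
  refine intervalIntegral_intervalIntegral_swap ?_
  exact (hF.continuousOn.integrableOn_compact
    ((isCompact_uIcc (a := a) (b := b)).prod (isCompact_uIcc (a := c) (b := d)))).mono_set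
    (prod_mono uIoc_subset_uIcc uIoc_subset_uIcc)

theorem periodic_intervalIntegral_comp_add {E : Type*} [NormedAddCommGroup E] [NormedSpace ℝ E]
    {f : ℝ → E} (hf : Function.Periodic f 1) (s : ℝ) :
    ∫ t in (0 : ℝ)..1, f (t + s) = ∫ t in (0 : ℝ)..1, f t := by
  rw [intervalIntegral.integral_comp_add_right, zero_add, add_comm]
  have := hf.intervalIntegral_add_eq s 0
  rwa [zero_add] at this

/-- The mean of the unit tangent of `γ` over `[t, t + h]`, when `γ` has speed `L`. -/
noncomputable def meanTangent (γ : ℝ → Plane) (L h t : ℝ) : Plane :=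
  (h * L)⁻¹ • (γ (t + h) - γ t)

section

variable {γ : ℝ → Plane} {L h : ℝ}

theorem continuous_meanTangent (hγ : ContDiff ℝ 1 γ) : Continuous (meanTangent γ L h) := by
  have := hγ.continuous
  unfold meanTangent
  fun_prop

theorem periodic_meanTangent (hper : Function.Periodic γ 1) :
    Function.Periodic (meanTangent γ L h) 1 := fun t => by
  have h1 : γ (t + 1 + h) = γ (t + h) := by rw [add_right_comm, hper]
  simp only [meanTangent, h1, hper t]

theorem norm_meanTangent_le (hγ : ContDiff ℝ 1 γ) (hL0 : 0 < L) (hL : ∀ t, ‖deriv γ t‖ = L)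
    (hh : 0 < h) (t : ℝ) : ‖meanTangent γ L h t‖ ≤ 1 := by
  have := norm_sub_le_of_norm_deriv_eq hγ hL (t + h) t
  rw [add_sub_cancel_left, abs_of_pos hh] at this
  rw [meanTangent, norm_smul, norm_inv, Real.norm_eq_abs, abs_of_pos (by positivity),
    inv_mul_le_iff₀ (by positivity)]
  linarith

theorem integral_meanTangent (hγ : ContDiff ℝ 1 γ) (hper : Function.Periodic γ 1) :
    ∫ t in (0 : ℝ)..1, meanTangent γ L h t = 0 := by
  have hc := hγ.continuous
  unfold meanTangent
  rw [intervalIntegral.integral_smul, intervalIntegral.integral_sub,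
    periodic_intervalIntegral_comp_add hper, sub_self, smul_zero]
  · exact (hc.comp (by fun_prop)).intervalIntegrable _ _
  · exact hc.intervalIntegrable _ _

theorem integral_tangent (hγ : ContDiff ℝ 1 γ) (hL0 : 0 < L) (hh : 0 < h) (t : ℝ) :
    ∫ s in (0 : ℝ)..h, L⁻¹ • deriv γ (t + s) = h • meanTangent γ L h t := by
  have hd : ∀ s ∈ uIcc 0 h, HasDerivAt (fun s => γ (t + s)) (deriv γ (t + s)) s := fun s _ =>
    HasDerivAt.comp_const_add t s (hγ.differentiable (by norm_num) _).hasDerivAt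
  rw [intervalIntegral.integral_smul, intervalIntegral.integral_eq_sub_of_hasDerivAt hd,
    add_zero, meanTangent, smul_smul]
  · congr 1; field_simp
  · exact ((hγ.continuous_deriv le_rfl).comp (by fun_prop)).intervalIntegrable _ _

/-- The variance of the unit tangent over `[t, t + h]`. -/
theorem integral_norm_sq_tangent_sub (hγ : ContDiff ℝ 1 γ) (hL0 : 0 < L)
    (hL : ∀ t, ‖deriv γ t‖ = L) (hh : 0 < h) (t : ℝ) :
    ∫ s in (0 : ℝ)..h, ‖L⁻¹ • deriv γ (t + s) - meanTangent γ L h t‖ ^ 2 =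
      h * (1 - ‖meanTangent γ L h t‖ ^ 2) := by
  set T := meanTangent γ L h t with hT
  have hc : Continuous fun s => L⁻¹ • deriv γ (t + s) :=
    have := hγ.continuous_deriv le_rfl
    by fun_prop
  have h1 : ∀ s, ‖L⁻¹ • deriv γ (t + s)‖ = 1 := fun s => by
    rw [norm_smul, hL, norm_inv, Real.norm_eq_abs, abs_of_pos hL0, inv_mul_cancel₀ hL0.ne']
  have e : ∀ s, ‖L⁻¹ • deriv γ (t + s) - T‖ ^ 2 =
      (1 + ‖T‖ ^ 2) - 2 * inner ℝ T (L⁻¹ • deriv γ (t + s)) := fun s => by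
    rw [norm_sub_sq_real, h1, real_inner_comm]; ring
  simp_rw [e]
  rw [intervalIntegral.integral_sub, intervalIntegral.integral_const,
    intervalIntegral.integral_const_mul]
  · have : ∫ s in (0 : ℝ)..h, inner ℝ T (L⁻¹ • deriv γ (t + s)) =
        inner ℝ T (∫ s in (0 : ℝ)..h, L⁻¹ • deriv γ (t + s)) :=
      ((innerSL ℝ T).intervalIntegral_comp_comm (hc.intervalIntegrable _ _))
    rw [this, integral_tangent hγ hL0 hh, inner_smul_right, ← hT, real_inner_self_eq_norm_sq,
      sub_zero, smul_eq_mul]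
    ring
  · exact continuous_const.intervalIntegrable _ _
  · exact (continuous_const.mul (continuous_const.inner hc)).intervalIntegrable _ _

/-- Means over overlapping intervals are close, in terms of the variances. -/
theorem norm_sq_meanTangent_sub_le (hγ : ContDiff ℝ 1 γ) (hL0 : 0 < L)
    (hL : ∀ t, ‖deriv γ t‖ = L) (hh : 0 < h) (t : ℝ) :
    ‖meanTangent γ L h t - meanTangent γ L h (t - h / 2)‖ ^ 2 ≤
      4 * ((1 - ‖meanTangent γ L h t‖ ^ 2) + (1 - ‖meanTangent γ L h (t - h / 2)‖ ^ 2)) := by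
  set T := meanTangent γ L h t with hT
  set T' := meanTangent γ L h (t - h / 2) with hT'
  have hc : Continuous fun s => L⁻¹ • deriv γ s := by
    have := hγ.continuous_deriv le_rfl
    fun_prop
  have hv := integral_norm_sq_tangent_sub hγ hL0 hL hh t
  have hv' := integral_norm_sq_tangent_sub hγ hL0 hL hh (t - h / 2)
  rw [← hT] at hv
  rw [← hT'] at hv'
  have i1 : ∀ a b, IntervalIntegrable (fun s => ‖L⁻¹ • deriv γ (t + s) - T‖ ^ 2) volume a b :=
    fun a b => (((hc.comp (by fun_prop : Continuous fun s => t + s)).sub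
      continuous_const).norm.pow 2).intervalIntegrable _ _
  have i2 : ∀ a b,
      IntervalIntegrable (fun s => ‖L⁻¹ • deriv γ (t - h / 2 + s) - T'‖ ^ 2) volume a b :=
    fun a b => (((hc.comp (by fun_prop : Continuous fun s => t - h / 2 + s)).sub
      continuous_const).norm.pow 2).intervalIntegrable _ _
  have i3 : ∀ a b,
      IntervalIntegrable (fun s => ‖L⁻¹ • deriv γ (t + s) - T'‖ ^ 2) volume a b :=
    fun a b => (((hc.comp (by fun_prop : Continuous fun s => t + s)).sub
      continuous_const).norm.pow 2).intervalIntegrable _ _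
  -- The intervals [t, t + h] and [t - h/2, t + h/2] share [t, t + h/2]. There the tangent is
  -- compared with both means, and the squared deviation over the shared half is at most the one
  -- over the whole interval.
  have h1 : ∫ s in (0 : ℝ)..(h / 2), ‖L⁻¹ • deriv γ (t + s) - T‖ ^ 2 ≤ h * (1 - ‖T‖ ^ 2) := by
    rw [← hv]
    exact intervalIntegral.integral_mono_interval le_rfl (by linarith) (by linarith)
      (ae_of_all _ fun s => by positivity) (i1 _ _)
  have h2 : ∫ s in (0 : ℝ)..(h / 2), ‖L⁻¹ • deriv γ (t + s) - T'‖ ^ 2 ≤ h * (1 - ‖T'‖ ^ 2) := by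
    have e : ∫ s in (0 : ℝ)..(h / 2), ‖L⁻¹ • deriv γ (t + s) - T'‖ ^ 2 =
        ∫ s in (h / 2)..h, ‖L⁻¹ • deriv γ (t - h / 2 + s) - T'‖ ^ 2 := by
      have := intervalIntegral.integral_comp_add_right (a := 0) (b := h / 2)
        (fun s => ‖L⁻¹ • deriv γ (t - h / 2 + s) - T'‖ ^ 2) (h / 2)
      rw [zero_add, add_halves] at this
      rw [← this]
      refine intervalIntegral.integral_congr fun s _ => ?_
      have : t - h / 2 + (s + h / 2) = t + s := by ring
      simp only [this]
    rw [e, ← hv']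
    exact intervalIntegral.integral_mono_interval (by linarith) (by linarith) le_rfl
      (ae_of_all _ fun s => by positivity) (i2 _ _)
  have h3 : ∫ _ in (0 : ℝ)..(h / 2), ‖T - T'‖ ^ 2 ≤
      ∫ s in (0 : ℝ)..(h / 2), (2 * ‖L⁻¹ • deriv γ (t + s) - T‖ ^ 2 +
        2 * ‖L⁻¹ • deriv γ (t + s) - T'‖ ^ 2) := by
    refine intervalIntegral.integral_mono_on (by linarith)
      (continuous_const.intervalIntegrable _ _)
      (((i1 _ _).const_mul 2).add ((i3 _ _).const_mul 2)) fun s _ => ?_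
    have e : T - T' = (L⁻¹ • deriv γ (t + s) - T') - (L⁻¹ • deriv γ (t + s) - T) := by abel
    rw [e]
    have hn := norm_sub_le (L⁻¹ • deriv γ (t + s) - T') (L⁻¹ • deriv γ (t + s) - T)
    have := pow_le_pow_left₀ (norm_nonneg _) hn 2
    nlinarith [sq_nonneg (‖L⁻¹ • deriv γ (t + s) - T'‖ - ‖L⁻¹ • deriv γ (t + s) - T‖)]
  rw [intervalIntegral.integral_const, intervalIntegral.integral_add ((i1 _ _).const_mul 2)
    ((i3 _ _).const_mul 2), intervalIntegral.integral_const_mul,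
    intervalIntegral.integral_const_mul, smul_eq_mul, sub_zero] at h3
  have h4 : h / 2 * ‖T - T'‖ ^ 2 ≤
      h / 2 * (4 * ((1 - ‖T‖ ^ 2) + (1 - ‖T'‖ ^ 2))) := by
    nlinarith
  exact le_of_mul_le_mul_left h4 (by positivity)

end

/-- The mean variance is controlled by the length defect of inscribed polygons. -/
theorem integral_one_sub_norm_sq_meanTangent_le {γ : ℝ → Plane} (hγ : ContDiff ℝ 1 γ)
    {L : ℝ} (hL0 : 0 < L) {m : ℕ} (hm : 0 < m) {E : ℝ}
    (hE : ∀ u, L - chordLength γ m u ≤ E) :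
    ∫ t in (0 : ℝ)..1, (1 - ‖meanTangent γ L (1 / m) t‖ ^ 2) ≤ 2 * E / L := by
  have hm' : (0 : ℝ) < m := by exact_mod_cast hm
  have hh : (0 : ℝ) < 1 / m := by positivity
  set T := meanTangent γ L (1 / m) with hT
  have hTc : Continuous T := continuous_meanTangent hγ
  -- Each chord is L / m times a mean tangent T. Averaging over the offset u ∈ [0, 1/m] turns the
  -- sum over chords into ∫ |T|, and 1 - |T|² ≤ 2 (1 - |T|).
  have hch : ∀ u, chordLength γ m u = L / m * ∑ j ∈ Finset.range m, ‖T (u + j / m)‖ := by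
    intro u
    rw [chordLength, Finset.mul_sum]
    refine Finset.sum_congr rfl fun j _ => ?_
    have e : u + ((j + 1 : ℕ) : ℝ) / m = u + j / m + 1 / m := by push_cast; ring
    rw [hT, meanTangent, norm_smul, norm_inv, Real.norm_eq_abs, abs_of_pos (by positivity), e]
    field_simp
  have hsum : ∫ u in (0 : ℝ)..(1 / m), ∑ j ∈ Finset.range m, ‖T (u + j / m)‖ =
      ∫ t in (0 : ℝ)..1, ‖T t‖ := by
    rw [intervalIntegral.integral_finsetSum (f := fun (j : ℕ) u => ‖T (u + j / m)‖) fun j _ =>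
      Continuous.intervalIntegrable (by fun_prop) _ _]
    have := intervalIntegral.sum_integral_adjacent_intervals (n := m)
      (a := fun j : ℕ => (j : ℝ) / m) (f := fun t => ‖T t‖) (μ := volume)
      (fun k _ => hTc.norm.intervalIntegrable _ _)
    simp only [Nat.cast_zero, zero_div, div_self hm'.ne'] at this
    rw [← this]
    refine Finset.sum_congr rfl fun j _ => ?_
    rw [intervalIntegral.integral_comp_add_right (fun t => ‖T t‖)]
    congr 1
    · ring
    · push_cast; ring
  have hge : ∫ _ in (0 : ℝ)..(1 / m), (L - E) ≤
      ∫ u in (0 : ℝ)..(1 / m), L / m * ∑ j ∈ Finset.range m, ‖T (u + j / m)‖ := by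
    refine intervalIntegral.integral_mono_on hh.le (continuous_const.intervalIntegrable _ _)
      ?_ fun u _ => ?_
    · refine Continuous.intervalIntegrable (continuous_const.mul ?_) _ _
      exact continuous_finsetSum _ fun j _ => (hTc.comp (by fun_prop)).norm
    · rw [← hch]; linarith [hE u]
  rw [intervalIntegral.integral_const, intervalIntegral.integral_const_mul, hsum, smul_eq_mul,
    sub_zero] at hge
  have hT1 : L - E ≤ L * ∫ t in (0 : ℝ)..1, ‖T t‖ := by
    have e : 1 / (m : ℝ) * (L - E) = (L - E) / m := by ring
    have e' : L / m * ∫ t in (0 : ℝ)..1, ‖T t‖ = (L * ∫ t in (0 : ℝ)..1, ‖T t‖) / m := by ring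
    rw [e, e', div_le_div_iff_of_pos_right hm'] at hge
    exact hge
  have hle : ∫ t in (0 : ℝ)..1, (1 - ‖T t‖ ^ 2) ≤ ∫ t in (0 : ℝ)..1, 2 * (1 - ‖T t‖) := by
    refine intervalIntegral.integral_mono_on zero_le_one
      ((continuous_const.sub (hTc.norm.pow 2)).intervalIntegrable _ _)
      ((continuous_const.mul (continuous_const.sub hTc.norm)).intervalIntegrable _ _) fun t _ => ?_
    nlinarith [sq_nonneg (1 - ‖T t‖)]
  refine hle.trans ?_
  rw [intervalIntegral.integral_const_mul, intervalIntegral.integral_sub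
    (continuous_const.intervalIntegrable _ _) (hTc.norm.intervalIntegrable _ _),
    intervalIntegral.integral_const, sub_zero, one_smul, le_div_iff₀ hL0]
  nlinarith

set_option maxHeartbeats 400000 in
/-- A closed curve of constant speed whose inscribed polygons are almost as long as the curve has
a tangent close to a function with controlled Dirichlet energy. -/
theorem exists_regularized_tangent {γ : ℝ → Plane} (hγ : ContDiff ℝ 1 γ)
    (hper : Function.Periodic γ 1) {L : ℝ} (hL0 : 0 < L) (hL : ∀ t, ‖deriv γ t‖ = L) {m : ℕ}
    (hm : 0 < m) {E : ℝ} (hE : ∀ u, L - chordLength γ m u ≤ E) :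
    ∃ S S' : ℝ → Plane, Continuous S' ∧ (∀ t, HasDerivAt S (S' t) t) ∧ Function.Periodic S 1 ∧
      (∀ t, ‖S t‖ ≤ 1) ∧ ∫ t in (0 : ℝ)..1, S t = 0 ∧
      ∫ t in (0 : ℝ)..1, ‖S' t‖ ^ 2 ≤ 64 * E * m ^ 2 / L ∧
      ∫ t in (0 : ℝ)..1, ‖L⁻¹ • deriv γ t - S t‖ ^ 2 ≤ 4 * E / L := by
  have hm' : (0 : ℝ) < m := by exact_mod_cast hm
  set h : ℝ := 1 / m with hh_def
  have hh : 0 < h := by positivity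
  set T := meanTangent γ L h with hT
  have hTc : Continuous T := continuous_meanTangent hγ
  have hTp : Function.Periodic T 1 := periodic_meanTangent hper
  have hT1 : ∀ t, ‖T t‖ ≤ 1 := norm_meanTangent_le hγ hL0 hL hh
  have hV := integral_one_sub_norm_sq_meanTangent_le hγ hL0 hm hE
  rw [← hh_def, ← hT] at hV
  set k := h / 2 with hk_def
  have hk : 0 < k := by positivity
  have hτc : Continuous fun s => L⁻¹ • deriv γ s := by
    have := hγ.continuous_deriv le_rfl
    fun_prop
  have hτp : Function.Periodic (fun s => L⁻¹ • deriv γ s) 1 := fun t => by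
    simp only [periodic_deriv hper t]
  set W : ℝ → Plane := fun t => ∫ s in (0 : ℝ)..t, T s with hW
  have hWd : ∀ t, HasDerivAt W (T t) t := fun t => hTc.integral_hasStrictDerivAt 0 t |>.hasDerivAt
  -- S is the mean of T over [t - k, t], so its derivative is a difference quotient of T. The step k
  -- = h/2 makes the intervals behind T t and T (t - k) overlap by half, which is what the
  -- comparison of means requires.
  set S : ℝ → Plane := fun t => k⁻¹ • (W t - W (t - k)) with hS
  have hSeq : ∀ t, S t = k⁻¹ • ∫ s in (0 : ℝ)..k, T (t - s) := by
    intro t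
    simp only [hS, hW]
    rw [intervalIntegral.integral_comp_sub_left (fun s => T s), sub_zero,
      intervalIntegral.integral_interval_sub_left (hTc.intervalIntegrable _ _)
      (hTc.intervalIntegrable _ _)]
  have hFc : Continuous (Function.uncurry fun t s : ℝ => T (t - s)) := by
    simp only [Function.uncurry_def]
    exact hTc.comp (by fun_prop)
  have hSd : ∀ t, HasDerivAt S (k⁻¹ • (T t - T (t - k))) t := fun t =>
    ((hWd t).sub (HasDerivAt.comp_sub_const t k (hWd (t - k)))).const_smul k⁻¹
  have hShiftp : ∀ s, Function.Periodic (fun t => T (t - s)) 1 := fun s t => by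
    have : t + 1 - s = t - s + 1 := by ring
    simp only [this, hTp (t - s)]
  have hS0 : ∫ t in (0 : ℝ)..1, S t = 0 := by
    simp_rw [hSeq]
    rw [intervalIntegral.integral_smul, intervalIntegral_swap_of_continuous hFc]
    have : ∀ s : ℝ, ∫ t in (0 : ℝ)..1, T (t - s) = 0 := fun s => by
      have := periodic_intervalIntegral_comp_add hTp (-s)
      simp only [← sub_eq_add_neg] at this
      rw [this, hT, integral_meanTangent hγ hper]
    simp [this]
  have hVc : Continuous fun t => 1 - ‖T t‖ ^ 2 := continuous_const.sub (hTc.norm.pow 2)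
  refine ⟨S, fun t => k⁻¹ • (T t - T (t - k)), by fun_prop, hSd, ?_, ?_, hS0, ?_, ?_⟩
  · intro t
    rw [hSeq, hSeq]
    congr 1
    exact intervalIntegral.integral_congr fun s _ => hShiftp s t
  · intro t
    rw [hSeq, norm_smul, norm_inv, Real.norm_eq_abs, abs_of_pos hk, inv_mul_le_iff₀ hk]
    have := intervalIntegral.norm_integral_le_of_norm_le_const (a := 0) (b := k) (C := 1)
      (f := fun s => T (t - s)) (fun s _ => hT1 _)
    rw [sub_zero, abs_of_pos hk, one_mul] at this
    linarith
  · have hpt : ∀ t ∈ Icc (0 : ℝ) 1, ‖k⁻¹ • (T t - T (t - k))‖ ^ 2 ≤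
        (k⁻¹) ^ 2 * (4 * ((1 - ‖T t‖ ^ 2) + (1 - ‖T (t - k)‖ ^ 2))) := by
      intro t _
      rw [norm_smul, mul_pow, norm_inv, Real.norm_eq_abs, abs_of_pos hk]
      gcongr
      exact norm_sq_meanTangent_sub_le hγ hL0 hL hh t
    have hmono := intervalIntegral.integral_mono_on (μ := volume) zero_le_one
      (Continuous.intervalIntegrable (by fun_prop) _ _)
      (Continuous.intervalIntegrable (by fun_prop) _ _) hpt
    refine hmono.trans ?_
    have hshift : ∫ t in (0 : ℝ)..1, (1 - ‖T (t - k)‖ ^ 2) =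
        ∫ t in (0 : ℝ)..1, (1 - ‖T t‖ ^ 2) := by
      have hp : Function.Periodic (fun t => 1 - ‖T t‖ ^ 2) 1 := fun t => by simp only [hTp t]
      have := periodic_intervalIntegral_comp_add hp (-k)
      simpa only [← sub_eq_add_neg] using this
    rw [intervalIntegral.integral_const_mul, intervalIntegral.integral_const_mul,
      intervalIntegral.integral_add (hVc.intervalIntegrable _ _)
      (Continuous.intervalIntegrable (by fun_prop) _ _), hshift]
    -- 64 = 2² · 4 · 4, from k⁻¹ = 2m, the constant of the overlap estimate, and two variances of
    -- 2E/L each.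
    have e : 64 * E * m ^ 2 / L = (k⁻¹) ^ 2 * (4 * (2 * E / L + 2 * E / L)) := by
      rw [hk_def, hh_def]; field_simp; ring
    rw [e]
    gcongr
  · have hpt : ∀ t ∈ Icc (0 : ℝ) 1, ‖L⁻¹ • deriv γ t - S t‖ ^ 2 ≤
        k⁻¹ * ∫ s in (0 : ℝ)..k, ‖L⁻¹ • deriv γ t - T (t - s)‖ ^ 2 := by
      intro t _
      have hc1 : Continuous fun s => L⁻¹ • deriv γ t - T (t - s) := by fun_prop
      have e : L⁻¹ • deriv γ t - S t =
          k⁻¹ • ∫ s in (0 : ℝ)..k, (L⁻¹ • deriv γ t - T (t - s)) := by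
        rw [intervalIntegral.integral_sub (continuous_const.intervalIntegrable _ _)
          (Continuous.intervalIntegrable (by fun_prop) _ _), intervalIntegral.integral_const,
          smul_sub, ← hSeq, sub_zero, smul_smul k⁻¹ k, inv_mul_cancel₀ hk.ne', one_smul]
      rw [e, norm_smul, mul_pow, norm_inv, Real.norm_eq_abs, abs_of_pos hk]
      have := norm_sq_intervalIntegral_le hc1 hk.le
      rw [sub_zero] at this
      calc k⁻¹ ^ 2 * ‖∫ s in (0 : ℝ)..k, (L⁻¹ • deriv γ t - T (t - s))‖ ^ 2
          ≤ k⁻¹ ^ 2 * (k * ∫ s in (0 : ℝ)..k, ‖L⁻¹ • deriv γ t - T (t - s)‖ ^ 2) := by gcongr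
        _ = _ := by field_simp
    have hG : Continuous (Function.uncurry fun t s : ℝ => ‖L⁻¹ • deriv γ t - T (t - s)‖ ^ 2) := by
      simp only [Function.uncurry_def]
      have := hτc.comp (continuous_fst (X := ℝ) (Y := ℝ))
      exact ((this.sub hFc).norm.pow 2)
    have hG' : Continuous (Function.uncurry fun t s : ℝ => ‖L⁻¹ • deriv γ (t + s) - T t‖ ^ 2) := by
      simp only [Function.uncurry_def]
      have h1 := hτc.comp (by fun_prop : Continuous fun p : ℝ × ℝ => p.1 + p.2)
      exact ((h1.sub (hTc.comp continuous_fst)).norm.pow 2)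
    have hSc : Continuous S := continuous_iff_continuousAt.2 fun t => (hSd t).continuousAt
    have hmono := intervalIntegral.integral_mono_on (μ := volume) zero_le_one
      (((hτc.sub hSc).norm.pow 2).intervalIntegrable _ _)
      ((continuous_const.mul
        (intervalIntegral.continuous_parametric_intervalIntegral_of_continuous' hG 0 k)
        ).intervalIntegrable _ _) hpt
    refine hmono.trans ?_
    simp only [Pi.mul_apply]
    rw [intervalIntegral.integral_const_mul, intervalIntegral_swap_of_continuous hG]
    have hshift : ∀ s : ℝ, ∫ t in (0 : ℝ)..1, ‖L⁻¹ • deriv γ t - T (t - s)‖ ^ 2 =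
        ∫ t in (0 : ℝ)..1, ‖L⁻¹ • deriv γ (t + s) - T t‖ ^ 2 := by
      intro s
      have hp : Function.Periodic (fun t => ‖L⁻¹ • deriv γ t - T (t - s)‖ ^ 2) 1 := fun t => by
        have h1 := hτp t
        have h2 := hShiftp s t
        simp only at h1 h2
        simp only [h1, h2]
      have := periodic_intervalIntegral_comp_add hp s
      simp only [add_sub_cancel_right] at this
      exact this.symm
    simp_rw [hshift]
    -- After the shift T t is compared with the tangent at t + s for s ∈ [0, k]. Enlarging the range
    -- to [0, h] produces exactly the variance over the interval whose mean is T t.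
    have hle : ∫ s in (0 : ℝ)..k, ∫ t in (0 : ℝ)..1, ‖L⁻¹ • deriv γ (t + s) - T t‖ ^ 2 ≤
        ∫ s in (0 : ℝ)..h, ∫ t in (0 : ℝ)..1, ‖L⁻¹ • deriv γ (t + s) - T t‖ ^ 2 := by
      refine intervalIntegral.integral_mono_interval le_rfl hk.le (by linarith)
        (ae_of_all _ fun s => intervalIntegral.integral_nonneg zero_le_one fun t _ => by positivity)
        ?_
      have hG'' : Continuous
          (Function.uncurry fun s t : ℝ => ‖L⁻¹ • deriv γ (t + s) - T t‖ ^ 2) := by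
        simp only [Function.uncurry_def]
        have h1 := hτc.comp (by fun_prop : Continuous fun p : ℝ × ℝ => p.2 + p.1)
        exact ((h1.sub (hTc.comp continuous_snd)).norm.pow 2)
      exact (intervalIntegral.continuous_parametric_intervalIntegral_of_continuous'
        hG'' 0 1).intervalIntegrable _ _
    rw [← intervalIntegral_swap_of_continuous hG' 0 1 0 h] at hle
    have hvar : ∀ t, ∫ s in (0 : ℝ)..h, ‖L⁻¹ • deriv γ (t + s) - T t‖ ^ 2 =
        h * (1 - ‖T t‖ ^ 2) := integral_norm_sq_tangent_sub hγ hL0 hL hh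
    simp_rw [hvar] at hle
    rw [intervalIntegral.integral_const_mul] at hle
    calc k⁻¹ * ∫ s in (0 : ℝ)..k, ∫ t in (0 : ℝ)..1, ‖L⁻¹ • deriv γ (t + s) - T t‖ ^ 2
        ≤ k⁻¹ * (h * (2 * E / L)) := by gcongr; exact hle.trans (by gcongr)
      _ = 4 * E / L := by rw [hk_def]; field_simp; ring


/-! ### Consequences of bounded energy -/

theorem chordLength_le {γ : ℝ → Plane} (hγ : ContDiff ℝ 1 γ) {L : ℝ} (hL : ∀ t, ‖deriv γ t‖ = L)
    {m : ℕ} (hm : 0 < m) (u : ℝ) : chordLength γ m u ≤ L := by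
  have hm' : (0 : ℝ) < m := by exact_mod_cast hm
  have : ∀ j ∈ Finset.range m, ‖γ (u + ((j + 1 : ℕ) : ℝ) / m) - γ (u + j / m)‖ ≤ L / m := by
    intro j _
    refine (norm_sub_le_of_norm_deriv_eq hγ hL _ _).trans (le_of_eq ?_)
    have e : u + ((j + 1 : ℕ) : ℝ) / m - (u + j / m) = 1 / m := by push_cast; ring
    rw [e, abs_of_pos (by positivity)]; ring
  refine (Finset.sum_le_sum this).trans (le_of_eq ?_)
  rw [Finset.sum_const, Finset.card_range, nsmul_eq_mul]
  field_simp

theorem chordLength_one {γ : ℝ → Plane} (hper : Function.Periodic γ 1) (u : ℝ) :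
    chordLength γ 1 u = 0 := by
  simp [chordLength, hper u]

theorem norm_sub_sq_le_of_hasDerivAt {S S' : ℝ → Plane} (hS' : Continuous S')
    (hS : ∀ t, HasDerivAt S (S' t) t) {K : ℝ} (hK : ∫ t in (0 : ℝ)..1, ‖S' t‖ ^ 2 ≤ K) {s t : ℝ}
    (hs : s ∈ Icc (0 : ℝ) 1) (ht : t ∈ Icc (0 : ℝ) 1) : ‖S t - S s‖ ^ 2 ≤ K * |t - s| := by
  wlog hst : s ≤ t generalizing s t
  · rw [norm_sub_rev, abs_sub_comm]
    exact this ht hs (le_of_not_ge hst)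
  have e : S t - S s = ∫ r in s..t, S' r :=
    (intervalIntegral.integral_eq_sub_of_hasDerivAt (fun r _ => hS r)
      (hS'.intervalIntegrable _ _)).symm
  have hmono : ∫ r in s..t, ‖S' r‖ ^ 2 ≤ ∫ r in (0 : ℝ)..1, ‖S' r‖ ^ 2 :=
    intervalIntegral.integral_mono_interval hs.1 hst ht.2
      (ae_of_all _ fun r => by positivity) ((hS'.norm.pow 2).intervalIntegrable _ _)
  rw [e, abs_of_nonneg (sub_nonneg.2 hst)]
  refine (norm_sq_intervalIntegral_le hS' hst).trans ?_
  rw [mul_comm]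
  exact mul_le_mul_of_nonneg_right (hmono.trans hK) (sub_nonneg.2 hst)

/-- A pointwise Poincaré inequality: S t is the mean over s of S t - S s, and each difference is
bounded by Cauchy–Schwarz. -/
theorem norm_sq_le_of_integral_eq_zero {S S' : ℝ → Plane} (hS' : Continuous S')
    (hS : ∀ t, HasDerivAt S (S' t) t) (h0 : ∫ t in (0 : ℝ)..1, S t = 0) {K : ℝ}
    (hK : ∫ t in (0 : ℝ)..1, ‖S' t‖ ^ 2 ≤ K) {t : ℝ} (ht : t ∈ Icc (0 : ℝ) 1) :
    ‖S t‖ ^ 2 ≤ K := by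
  have hSc : Continuous S := continuous_iff_continuousAt.2 fun t => (hS t).continuousAt
  have hK0 : 0 ≤ K := le_trans
    (intervalIntegral.integral_nonneg zero_le_one fun t _ => by positivity) hK
  have e : S t = ∫ s in (0 : ℝ)..1, (S t - S s) := by
    rw [intervalIntegral.integral_sub (continuous_const.intervalIntegrable _ _)
      (hSc.intervalIntegrable _ _), h0, intervalIntegral.integral_const]
    simp
  rw [e]
  refine (norm_sq_intervalIntegral_le (continuous_const.sub hSc) zero_le_one).trans ?_
  rw [sub_zero, one_mul]
  have hm : ∫ s in (0 : ℝ)..1, ‖S t - S s‖ ^ 2 ≤ ∫ _ in (0 : ℝ)..1, K := by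
    refine intervalIntegral.integral_mono_on zero_le_one
      (((continuous_const.sub hSc).norm.pow 2).intervalIntegrable _ _)
      (continuous_const.intervalIntegrable _ _) fun s hs => ?_
    refine (norm_sub_sq_le_of_hasDerivAt hS' hS hK hs ht).trans ?_
    have : |t - s| ≤ 1 := abs_sub_le_iff.2 ⟨by linarith [hs.1, ht.2], by linarith [hs.2, ht.1]⟩
    nlinarith
  simpa using hm

/-- Bounded rescaled energy bounds the total length and the total length defect of polygons
inscribed at scale `1 / lam`. -/
theorem IsBoundaryDecomposition.sum_le_of_energy_le {Ω : Set Plane} {N : ℕ} {γ : ℕ → ℝ → Plane}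
    (h : IsBoundaryDecomposition Ω N γ) (hΩ : IsOpen Ω) (hb : Bornology.IsBounded Ω)
    (hP : perimeter Ω < ⊤) {lam α s C : ℝ} (hlam : 0 < lam) (hα : 0 < α) (hα1 : α ≤ 1)
    (hs : 0 < s) (hsl : s ≤ lam ^ 2 * (1 - 1 / (2 * Real.pi * α ^ 2)))
    (hhalf : 1 / 2 ≤ 1 / (2 * Real.pi * α ^ 2)) (hC : lam ^ 2 * energy lam α Ω ≤ C) :
    ∑ i ∈ Finset.range N, curveLength (γ i) ≤ C / s ∧
      ∀ u, ∑ i ∈ Finset.range N,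
        (curveLength (γ i) - chordLength (γ i) ⌈curveLength (γ i) * lam⌉₊ u) ≤
          2 * Real.exp 1 * C * (1 / lam) ^ 2 := by
  have hLpos : ∀ i < N, 0 < curveLength (γ i) := fun i hi => h.curveLength_pos hi
  have hm : ∀ i < N, 0 < ⌈curveLength (γ i) * lam⌉₊ := fun i hi =>
    Nat.ceil_pos.2 (mul_pos (hLpos i hi) hlam)
  have hδ : ∀ i < N, curveLength (γ i) / (⌈curveLength (γ i) * lam⌉₊ : ℕ) ≤ 1 / lam := by
    intro i hi
    have h1 : (0 : ℝ) < (⌈curveLength (γ i) * lam⌉₊ : ℕ) := by exact_mod_cast hm i hi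
    rw [div_le_div_iff₀ h1 hlam, one_mul]
    exact Nat.le_ceil _
  have hdef : ∀ u, 0 ≤ ∑ i ∈ Finset.range N,
      (curveLength (γ i) - chordLength (γ i) ⌈curveLength (γ i) * lam⌉₊ u) := fun u =>
    Finset.sum_nonneg fun i hi => sub_nonneg.2 <|
      chordLength_le (h.contDiff_one (Finset.mem_range.1 hi))
        (h.constantSpeed i (Finset.mem_range.1 hi)) (hm i (Finset.mem_range.1 hi)) u
  have hsum : 0 ≤ ∑ i ∈ Finset.range N, curveLength (γ i) :=
    Finset.sum_nonneg fun i hi => (hLpos i (Finset.mem_range.1 hi)).le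
  have key : ∀ u, s * ∑ i ∈ Finset.range N, curveLength (γ i) +
      lam ^ 2 * (Real.exp (-1) / 2) * ∑ i ∈ Finset.range N,
        (curveLength (γ i) - chordLength (γ i) ⌈curveLength (γ i) * lam⌉₊ u) ≤ C := by
    intro u
    -- At mesh δ = 1/λ the factor exp(-λαδ) equals exp(-α) ≥ exp(-1), so the coefficient of the
    -- defect stays away from 0, and multiplying by λ² makes the defect O(λ⁻²).
    have hle := h.le_energy hΩ hb hP hlam hα (by positivity : 0 ≤ 1 / lam) hm hδ u
    have e : lam * α * (1 / lam) = α := by field_simp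
    rw [e] at hle
    have hexp : Real.exp (-1) / 2 ≤ Real.exp (-α) / (2 * Real.pi * α ^ 2) := by
      have h1 : Real.exp (-1) ≤ Real.exp (-α) := Real.exp_le_exp.2 (by linarith)
      calc Real.exp (-1) / 2 = Real.exp (-1) * (1 / 2) := by ring
        _ ≤ Real.exp (-α) * (1 / (2 * Real.pi * α ^ 2)) := by gcongr
        _ = _ := by ring
    have h2 := mul_le_mul_of_nonneg_right hsl hsum
    have h3 := mul_le_mul_of_nonneg_right hexp (hdef u)
    have h4 := mul_le_mul_of_nonneg_left hle (sq_nonneg lam)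
    have h5 := mul_le_mul_of_nonneg_left h3 (sq_nonneg lam)
    linarith
  constructor
  · rw [le_div_iff₀ hs]
    have := key 0
    have h6 : 0 ≤ lam ^ 2 * (Real.exp (-1) / 2) * ∑ i ∈ Finset.range N,
        (curveLength (γ i) - chordLength (γ i) ⌈curveLength (γ i) * lam⌉₊ 0) :=
      mul_nonneg (by positivity) (hdef 0)
    linarith
  · intro u
    have h6 : 0 ≤ s * ∑ i ∈ Finset.range N, curveLength (γ i) := mul_nonneg hs.le hsum
    have h7 : lam ^ 2 * (Real.exp (-1) / 2) * ∑ i ∈ Finset.range N,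
        (curveLength (γ i) - chordLength (γ i) ⌈curveLength (γ i) * lam⌉₊ u) ≤ C := by
      linarith [key u]
    rw [mul_comm, ← le_div_iff₀ (by positivity)] at h7
    refine h7.trans (le_of_eq ?_)
    rw [Real.exp_neg]
    field_simp

/-- The family of boundary curves consists of short curves of negligible total length, and of
long curves whose tangents are close to functions of bounded Dirichlet energy. -/
theorem IsBoundaryDecomposition.short_or_long {Ω : Set Plane} {N : ℕ} {γ : ℕ → ℝ → Plane}
    (h : IsBoundaryDecomposition Ω N γ) {lam K : ℝ} (hlam : 0 < lam) (hK : 0 < K)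
    (hKlam : 1024 * K ≤ lam)
    (hdef : ∀ u, ∑ i ∈ Finset.range N,
        (curveLength (γ i) - chordLength (γ i) ⌈curveLength (γ i) * lam⌉₊ u) ≤
          K * (1 / lam) ^ 2) :
    ∑ i ∈ Finset.range N with curveLength (γ i) < 1 / (1024 * K), curveLength (γ i) ≤
        K * (1 / lam) ^ 2 ∧
      ∀ i < N, 1 / (1024 * K) ≤ curveLength (γ i) → ∃ S S' : ℝ → Plane, Continuous S' ∧
        (∀ t, HasDerivAt S (S' t) t) ∧ Function.Periodic S 1 ∧
        (∀ t, ‖S t‖ ≤ 1) ∧ ∫ t in (0 : ℝ)..1, S t = 0 ∧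
        ∫ t in (0 : ℝ)..1, ‖S' t‖ ^ 2 ≤ 256 * K * curveLength (γ i) ∧
        ∫ t in (0 : ℝ)..1, ‖(curveLength (γ i))⁻¹ • deriv (γ i) t - S t‖ ^ 2 ≤
          4 * K * (1 / lam) := by
  have hLpos : ∀ i < N, 0 < curveLength (γ i) := fun i hi => h.curveLength_pos hi
  have hm : ∀ i < N, 0 < ⌈curveLength (γ i) * lam⌉₊ := fun i hi =>
    Nat.ceil_pos.2 (mul_pos (hLpos i hi) hlam)
  have hnn : ∀ u, ∀ i ∈ Finset.range N,
      0 ≤ curveLength (γ i) - chordLength (γ i) ⌈curveLength (γ i) * lam⌉₊ u := fun u i hi =>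
    sub_nonneg.2 <| chordLength_le (h.contDiff_one (Finset.mem_range.1 hi))
        (h.constantSpeed i (Finset.mem_range.1 hi)) (hm i (Finset.mem_range.1 hi)) u
  have hE : ∀ i < N, ∀ u, curveLength (γ i) -
      chordLength (γ i) ⌈curveLength (γ i) * lam⌉₊ u ≤ K * (1 / lam) ^ 2 := fun i hi u =>
    (Finset.single_le_sum (hnn u) (Finset.mem_range.2 hi)).trans (hdef u)
  have hlong : ∀ i < N, 1 / lam ≤ curveLength (γ i) → ∃ S S' : ℝ → Plane, Continuous S' ∧
        (∀ t, HasDerivAt S (S' t) t) ∧ Function.Periodic S 1 ∧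
        (∀ t, ‖S t‖ ≤ 1) ∧ ∫ t in (0 : ℝ)..1, S t = 0 ∧
        ∫ t in (0 : ℝ)..1, ‖S' t‖ ^ 2 ≤ 256 * K * curveLength (γ i) ∧
        ∫ t in (0 : ℝ)..1, ‖(curveLength (γ i))⁻¹ • deriv (γ i) t - S t‖ ^ 2 ≤
          4 * K * (1 / lam) := by
    intro i hi hl
    obtain ⟨S, S', h1, h2, h3, h4, h5, h6, h7⟩ := exists_regularized_tangent (h.contDiff_one hi)
      (h.periodic i hi) (hLpos i hi) (h.constantSpeed i hi) (hm i hi) (hE i hi)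
    have hL0 := hLpos i hi
    set L := curveLength (γ i) with hL
    have hLl : 1 ≤ L * lam := by rwa [div_le_iff₀ hlam] at hl
    -- As L λ ≥ 1, rounding up at most doubles. So E m² / L is at most of order L when E = K / λ²,
    -- which bounds the Dirichlet energy uniformly in λ.
    have hm2 : ((⌈L * lam⌉₊ : ℕ) : ℝ) ≤ 2 * (L * lam) := by
      have := (Nat.ceil_lt_add_one (mul_pos hL0 hlam).le).le
      linarith
    refine ⟨S, S', h1, h2, h3, h4, h5, h6.trans ?_, h7.trans ?_⟩
    · calc 64 * (K * (1 / lam) ^ 2) * ((⌈L * lam⌉₊ : ℕ) : ℝ) ^ 2 / L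
          ≤ 64 * (K * (1 / lam) ^ 2) * (2 * (L * lam)) ^ 2 / L := by gcongr
        _ = 256 * K * L := by field_simp; ring
    · calc 4 * (K * (1 / lam) ^ 2) / L = 4 * K * (1 / lam) * (1 / (L * lam)) := by field_simp
        _ ≤ 4 * K * (1 / lam) * 1 := by
          gcongr
          rw [div_le_one (by positivity)]; exact hLl
        _ = _ := by ring
  have hlam1 : 1 / lam ≤ 1 / (16 * K) := one_div_le_one_div_of_le (by positivity) (by linarith)
  have hlower : ∀ i < N, 1 / lam ≤ curveLength (γ i) → 1 / (1024 * K) ≤ curveLength (γ i) := by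
    intro i hi hl
    obtain ⟨S, S', h1, h2, h3, h4, h5, h6, h7⟩ := hlong i hi hl
    have hL0 := hLpos i hi
    set L := curveLength (γ i) with hL
    have hSc : Continuous S := continuous_iff_continuousAt.2 fun t => (h2 t).continuousAt
    have hdc := h.continuous_deriv hi
    -- The unit tangent differs from S by at most 4K/λ ≤ 1/4 in squared L² norm, and |S|² ≤ 256 K L
    -- by the Poincaré inequality. Hence 1 ≤ 2 · 1/4 + 2 · 256 K L, which is L ≥ 1/(1024 K).
    have hmono : ∫ _ in (0 : ℝ)..1, (1 : ℝ) ≤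
        ∫ t in (0 : ℝ)..1, (2 * ‖L⁻¹ • deriv (γ i) t - S t‖ ^ 2 + 2 * (256 * K * L)) := by
      refine intervalIntegral.integral_mono_on zero_le_one
        (continuous_const.intervalIntegrable _ _)
        (Continuous.intervalIntegrable (by fun_prop) _ _) fun t ht => ?_
      have e1 : ‖L⁻¹ • deriv (γ i) t‖ = 1 := by
        rw [norm_smul, h.constantSpeed i hi, norm_inv, Real.norm_eq_abs, abs_of_pos hL0,
          inv_mul_cancel₀ hL0.ne']
      have e2 : ‖S t‖ ^ 2 ≤ 256 * K * L := norm_sq_le_of_integral_eq_zero h1 h2 h5 h6 ht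
      have e3 : ‖L⁻¹ • deriv (γ i) t‖ ≤ ‖L⁻¹ • deriv (γ i) t - S t‖ + ‖S t‖ := by
        simpa using norm_add_le (L⁻¹ • deriv (γ i) t - S t) (S t)
      rw [e1] at e3
      nlinarith [sq_nonneg (‖L⁻¹ • deriv (γ i) t - S t‖ - ‖S t‖), norm_nonneg (S t),
        norm_nonneg (L⁻¹ • deriv (γ i) t - S t)]
    rw [intervalIntegral.integral_add (Continuous.intervalIntegrable (by fun_prop) _ _)
      (continuous_const.intervalIntegrable _ _), intervalIntegral.integral_const_mul] at hmono
    simp only [intervalIntegral.integral_const, sub_zero, one_smul] at hmono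
    have h8 : 4 * K * (1 / lam) ≤ 1 / 4 := by
      calc 4 * K * (1 / lam) ≤ 4 * K * (1 / (16 * K)) := by gcongr
        _ = 1 / 4 := by field_simp; norm_num
    rw [div_le_iff₀ (by positivity)]
    linarith
  refine ⟨?_, fun i hi hl => hlong i hi ?_⟩
  · refine le_trans ?_ (hdef 0)
    refine (Finset.sum_le_sum fun i hi => ?_).trans
      (Finset.sum_le_sum_of_subset_of_nonneg (Finset.filter_subset _ _)
        fun i hi _ => hnn 0 i hi)
    rw [Finset.mem_filter] at hi
    have hiN := Finset.mem_range.1 hi.1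
    have hlt : curveLength (γ i) < 1 / lam := by
      by_contra hcon
      exact absurd (hlower i hiN (not_lt.1 hcon)) (not_le.2 hi.2)
    -- A curve shorter than 1/λ is assigned a single chord, which degenerates to a point: its whole
    -- length is defect.
    have hm1 : ⌈curveLength (γ i) * lam⌉₊ = 1 := by
      refine le_antisymm (Nat.ceil_le.2 ?_) (hm i hiN)
      rw [lt_div_iff₀ hlam] at hlt
      exact_mod_cast hlt.le
    rw [hm1, chordLength_one (h.periodic i hiN), sub_zero]
  · exact (one_div_le_one_div_of_le (by positivity) hKlam).trans hl

/-- Uniform bounds along a sequence of regular sets of bounded rescaled energy. -/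
theorem exists_eventually_bounds {lam α : ℕ → ℝ} {σ : ℝ} (hlam : Tendsto lam atTop atTop)
    (hα : ∀ n, 0 < α n) (hσ_pos : 0 < σ)
    (hσ : Tendsto (fun n => lam n ^ 2 * (1 - 1 / (2 * Real.pi * α n ^ 2))) atTop (𝓝 σ))
    {Ω : ℕ → Set Plane} (hP : ∀ n, perimeter (Ω n) < ⊤) (hΩ : ∀ n, RegularSet (Ω n))
    (hbdd : limsup (fun n => ((lam n ^ 2 * energy (lam n) (α n) (Ω n) : ℝ) : EReal)) atTop < ⊤)
    {N : ℕ → ℕ} {γ : ℕ → ℕ → ℝ → Plane} (hγ : ∀ n, IsBoundaryDecomposition (Ω n) (N n) (γ n)) :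
    ∃ K > 0, ∃ c > 0, ∃ η : ℕ → ℝ, Tendsto η atTop (𝓝 0) ∧ ∀ᶠ n in atTop,
      ∑ i ∈ Finset.range (N n), curveLength (γ n i) ≤ K ∧
      ∑ i ∈ Finset.range (N n) with curveLength (γ n i) < c, curveLength (γ n i) ≤ η n ∧
      ∀ i < N n, c ≤ curveLength (γ n i) → ∃ S S' : ℝ → Plane, Continuous S' ∧
        (∀ t, HasDerivAt S (S' t) t) ∧ Function.Periodic S 1 ∧
        (∀ t, ‖S t‖ ≤ 1) ∧ ∫ t in (0 : ℝ)..1, S t = 0 ∧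
        ∫ t in (0 : ℝ)..1, ‖S' t‖ ^ 2 ≤ K ∧
        ∫ t in (0 : ℝ)..1, ‖(curveLength (γ n i))⁻¹ • deriv (γ n i) t - S t‖ ^ 2 ≤ η n := by
  obtain ⟨C, hC, -⟩ := EReal.lt_iff_exists_real_btwn.1 hbdd
  have hC' := eventually_lt_of_limsup_lt hC
  have hinv : Tendsto (fun n => 1 / lam n) atTop (𝓝 0) := by
    simp_rw [one_div]
    exact hlam.inv_tendsto_atTop
  -- 1 - 1/(2πα²) is a convergent sequence divided by λ², so it tends to 0. The lower bound 1/2 also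
  -- gives α ≤ 1 below.
  have hhalf : ∀ᶠ n in atTop, 1 / 2 ≤ 1 / (2 * Real.pi * α n ^ 2) := by
    have h1 : Tendsto (fun n => lam n ^ 2 * (1 - 1 / (2 * Real.pi * α n ^ 2)) * (1 / lam n) ^ 2)
        atTop (𝓝 (σ * 0 ^ 2)) := hσ.mul (hinv.pow 2)
    have h2 : σ * 0 ^ 2 < 1 / 2 := by norm_num
    filter_upwards [h1.eventually_lt_const h2, hlam.eventually_gt_atTop 0] with n hn hl
    have e : lam n ^ 2 * (1 - 1 / (2 * Real.pi * α n ^ 2)) * (1 / lam n) ^ 2 =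
        1 - 1 / (2 * Real.pi * α n ^ 2) := by
      have : lam n ≠ 0 := hl.ne'
      generalize 1 - 1 / (2 * Real.pi * α n ^ 2) = z
      field_simp
    rw [e] at hn
    linarith
  have hs := hσ.eventually_const_le (by linarith : σ / 2 < σ)
  -- The maximum with 1 keeps all constants positive whatever the sign of C.
  set D := max C 1 with hD
  have hD1 : 1 ≤ D := le_max_right _ _
  set K₀ := 2 * Real.exp 1 * D with hK₀
  have hK₀pos : 0 < K₀ := by positivity
  set K₁ := D / (σ / 2) with hK₁
  have hK₁pos : 0 < K₁ := by positivity
  refine ⟨max K₁ (256 * K₀ * K₁), lt_max_of_lt_left hK₁pos, 1 / (1024 * K₀), by positivity,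
    fun n => max (K₀ * (1 / lam n) ^ 2) (4 * K₀ * (1 / lam n)), ?_, ?_⟩
  · have h1 : Tendsto (fun n => K₀ * (1 / lam n) ^ 2) atTop (𝓝 0) := by
      simpa using (hinv.pow 2).const_mul K₀
    have h2 : Tendsto (fun n => 4 * K₀ * (1 / lam n)) atTop (𝓝 0) := by
      simpa using hinv.const_mul (4 * K₀)
    simpa using h1.max h2
  · filter_upwards [hC', hhalf, hs, hlam.eventually_gt_atTop 0,
      hlam.eventually_ge_atTop (1024 * K₀)] with n h1 h2 h3 h4 h5
    have hα1 : α n ≤ 1 := by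
      have hpos : 0 < 2 * Real.pi * α n ^ 2 := by have := hα n; positivity
      rw [div_le_div_iff₀ (by norm_num) hpos] at h2
      have := Real.pi_gt_three
      by_contra hcon
      rw [not_le] at hcon
      have : 1 < α n ^ 2 := by nlinarith
      nlinarith
    have hE : lam n ^ 2 * energy (lam n) (α n) (Ω n) ≤ D :=
      (EReal.coe_lt_coe_iff.1 h1).le.trans (le_max_left _ _)
    obtain ⟨hsum, hdef⟩ := (hγ n).sum_le_of_energy_le (hΩ n).isOpen (hΩ n).bounded (hP n) h4 (hα n)
      hα1 (by positivity : 0 < σ / 2) h3 h2 hE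
    obtain ⟨hshort, hlong⟩ := (hγ n).short_or_long h4 hK₀pos h5 hdef
    refine ⟨hsum.trans (le_max_left _ _), hshort.trans (le_max_left _ _), fun i hi hl => ?_⟩
    obtain ⟨S, S', g1, g2, g3, g4, g5, g6, g7⟩ := hlong i hi hl
    refine ⟨S, S', g1, g2, g3, g4, g5, g6.trans (le_trans ?_ (le_max_right _ _)),
      g7.trans (le_max_right _ _)⟩
    have hLK : curveLength (γ n i) ≤ K₁ := le_trans (Finset.single_le_sum
      (fun j hj => ((hγ n).curveLength_pos (Finset.mem_range.1 hj)).le) (Finset.mem_range.2 hi)) hsum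
    gcongr


/-! ### Weak derivatives of periodic functions -/

/-- Bounded sequences in Hilbert spaces have weak limits along ultrafilters. -/
theorem exists_weak_limit {H : Type*} [NormedAddCommGroup H] [InnerProductSpace ℝ H]
    [CompleteSpace H] (f : ℕ → H) {R : ℝ} (hf : ∀ n, ‖f n‖ ≤ R) (U : Ultrafilter ℕ) :
    ∃ v : H, ∀ g : H, Tendsto (fun n => inner ℝ (f n) g) U (𝓝 (inner ℝ v g)) := by
  set x : ℕ → WeakDual ℝ H := fun n =>
    StrongDual.toWeakDual (InnerProductSpace.toDual ℝ H (f n)) with hx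
  -- Banach–Alaoglu: an ultrafilter on a compact set converges, so neither separability nor a
  -- subsequence is called for.
  have hK := WeakDual.isCompact_closedBall (𝕜 := ℝ) (E := H) 0 R
  have hmem : ∀ n, x n ∈ WeakDual.toStrongDual ⁻¹' Metric.closedBall (0 : StrongDual ℝ H) R := by
    intro n
    rw [mem_preimage, mem_closedBall_zero_iff]
    exact ((InnerProductSpace.toDual ℝ H).norm_map (f n)).le.trans (hf n)
  obtain ⟨y, -, hy⟩ := hK.ultrafilter_le_nhds (U.map x)
    (le_principal_iff.2 (mem_map.2 (univ_mem' hmem)))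
  refine ⟨(InnerProductSpace.toDual ℝ H).symm (WeakDual.toStrongDual y), fun g => ?_⟩
  have ht : Tendsto x U (𝓝 y) := hy
  have he := ((WeakDual.eval_continuous g).tendsto y).comp ht
  rw [InnerProductSpace.toDual_symm_apply]
  exact he

theorem memL2Loc_of_continuous {u : ℝ → Plane} (hu : Continuous u) : MemL2Loc u := fun a b => by
  rw [memLp_two_iff_integrable_sq_norm hu.aestronglyMeasurable]
  exact (hu.norm.pow 2).continuousOn.integrableOn_compact isCompact_Icc

theorem MemL2Loc.locallyIntegrable {u : ℝ → Plane} (hu : MemL2Loc u) :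
    LocallyIntegrable u volume := by
  rw [locallyIntegrable_iff]
  intro k hk
  obtain ⟨r, hr⟩ := hk.isBounded.subset_closedBall 0
  rw [Real.closedBall_eq_Icc] at hr
  exact IntegrableOn.mono_set ((hu _ _).integrable one_le_two) hr

theorem MemL2Loc.const_smul {u : ℝ → Plane} (hu : MemL2Loc u) (c : ℝ) :
    MemL2Loc fun t => c • u t := fun a b => (hu a b).const_smul c

theorem HasWeakDeriv.const_smul {u v : ℝ → Plane} (h : HasWeakDeriv u v) (c : ℝ) :
    HasWeakDeriv (fun t => c • u t) fun t => c • v t := by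
  refine ⟨h.1.smul c, h.2.1.smul c, fun φ hφ hc => ?_⟩
  have := h.2.2 φ hφ hc
  simp_rw [smul_comm _ c, integral_smul, this, smul_neg]

theorem hasWeakDeriv_of_hasDerivAt {u v : ℝ → Plane} (hu : ∀ t, HasDerivAt u (v t) t)
    (hv : Continuous v) : HasWeakDeriv u v := by
  have huc : Continuous u := continuous_iff_continuousAt.2 fun t => (hu t).continuousAt
  refine ⟨huc.locallyIntegrable, hv.locallyIntegrable, fun φ hφ hc => ?_⟩
  have hφ' : Continuous (deriv φ) := hφ.continuous_deriv (by norm_cast)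
  have hφd : ∀ t, HasDerivAt φ (deriv φ t) t := fun t =>
    (hφ.differentiable (by norm_cast) t).hasDerivAt
  have hcd : HasCompactSupport (deriv φ) := hc.deriv
  have i : ∀ {f : ℝ → ℝ} {g : ℝ → Plane}, Continuous f → HasCompactSupport f → Continuous g →
      Integrable (fun t => f t • g t) := fun {f g} hf hfc hg =>
    (hf.smul hg).integrable_of_hasCompactSupport
      (HasCompactSupport.intro hfc fun t ht => by
        rw [Pi.smul_apply', image_eq_zero_of_notMem_tsupport ht, zero_smul])
  have := integral_bilinear_hasDerivAt_right_eq_neg_left_of_integrable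
    (L := ContinuousLinearMap.lsmul ℝ ℝ (E := Plane)) (u := φ) (u' := deriv φ) (v := u) (v' := v)
    (fun t _ => hφd t) (fun t _ => hu t) (i hφ.continuous hc hv) (i hφ' hcd huc)
    (i hφ.continuous hc huc)
  simp only [ContinuousLinearMap.lsmul_apply] at this
  rw [this, neg_neg]

/-- Unfolding the integral of a periodic function against a compactly supported one. -/
theorem integral_smul_periodic {φ : ℝ → ℝ} (hφ : Continuous φ) {M : ℕ}
    (hM : ∀ t, φ t ≠ 0 → |t| < M) {f : ℝ → Plane} (hf : LocallyIntegrable f volume)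
    (hper : Function.Periodic f 1) :
    ∫ t, φ t • f t =
      ∫ t in (0 : ℝ)..1, (∑ j ∈ Finset.range (2 * M), φ (t + (j - M : ℝ))) • f t := by
  have hfi : ∀ a b, IntervalIntegrable f volume a b := fun a b =>
    (hf.integrableOn_isCompact (isCompact_uIcc (a := a) (b := b))).intervalIntegrable
  have hintg : ∀ a b, IntervalIntegrable (fun t => φ t • f t) volume a b := fun a b =>
    (hfi a b).continuousOn_smul hφ.continuousOn
  have hsupp : Function.support (fun t => φ t • f t) ⊆ Ioc (-(M : ℝ)) M := by
    intro t ht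
    have : φ t ≠ 0 := fun h0 => ht (by simp only [h0, zero_smul])
    have := abs_lt.1 (hM t this)
    exact ⟨this.1, this.2.le⟩
  rw [← intervalIntegral.integral_eq_integral_of_support_subset hsupp]
  have hadj := intervalIntegral.sum_integral_adjacent_intervals (n := 2 * M)
    (a := fun k : ℕ => (k - M : ℝ)) (fun k _ => hintg (k - M : ℝ) ((k + 1 : ℕ) - M : ℝ))
  have e0 : ((0 : ℕ) : ℝ) - M = -(M : ℝ) := by simp
  have e1 : ((2 * M : ℕ) : ℝ) - M = M := by push_cast; ring
  rw [e0, e1] at hadj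
  simp_rw [Finset.sum_smul]
  rw [← hadj, intervalIntegral.integral_finsetSum]
  · refine Finset.sum_congr rfl fun k _ => ?_
    have hshift := intervalIntegral.integral_comp_add_right (a := 0) (b := 1)
      (fun t => φ t • f t) (k - M : ℝ)
    have e2 : (0 : ℝ) + (k - M) = k - M := by ring
    have e3 : (1 : ℝ) + (k - M) = (k + 1 : ℕ) - M := by push_cast; ring
    rw [e2, e3] at hshift
    rw [← hshift]
    refine intervalIntegral.integral_congr fun t _ => ?_
    have hp : f (t + (k - M : ℝ)) = f t := by
      have := hper.int_mul ((k : ℤ) - M) t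
      push_cast at this
      rwa [mul_one] at this
    simp only [hp]
  · intro k _
    exact (hfi 0 1).continuousOn_smul (by fun_prop)

/-- A uniform limit of periodic functions with bounded Dirichlet energy has a weak derivative
in `L²`. -/
theorem exists_hasWeakDeriv_of_tendstoUniformly {S S' : ℕ → ℝ → Plane}
    (hS' : ∀ n, Continuous (S' n)) (hS : ∀ n t, HasDerivAt (S n) (S' n t) t)
    (hper : ∀ n, Function.Periodic (S n) 1) {K : ℝ}
    (hK : ∀ n, ∫ t in (0 : ℝ)..1, ‖S' n t‖ ^ 2 ≤ K) {T : ℝ → Plane}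
    (h1 : ∀ n t, ‖S n t‖ ≤ 1) (hT : TendstoUniformly S T atTop) :
    ∃ v, HasWeakDeriv T v ∧ MemL2Loc v := by
  have hSc : ∀ n, Continuous (S n) := fun n =>
    continuous_iff_continuousAt.2 fun t => (hS n t).continuousAt
  have hTc : Continuous T := hT.continuous (Frequently.of_forall hSc)
  have hS'per : ∀ n, Function.Periodic (S' n) 1 := fun n t => by
    have hd : S' n = deriv (S n) := funext fun t => (hS n t).deriv.symm
    rw [hd, periodic_deriv (hper n)]
  set μ : Measure ℝ := volume.restrict (Ioc 0 1) with hμ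
  have hmem : ∀ {u : ℝ → Plane}, Continuous u → MemLp u 2 μ := fun {u} hu =>
    (memL2Loc_of_continuous hu 0 1).mono_measure (Measure.restrict_mono Ioc_subset_Icc_self le_rfl)
  set f : ℕ → Lp Plane 2 μ := fun n => (hmem (hS' n)).toLp (S' n) with hf
  have hfn : ∀ n, ‖f n‖ ≤ Real.sqrt K := by
    intro n
    refine Real.le_sqrt_of_sq_le ?_
    rw [← real_inner_self_eq_norm_sq, L2.inner_def]
    refine le_trans (le_of_eq ?_) (hK n)
    rw [intervalIntegral.integral_of_le zero_le_one]
    refine integral_congr_ae ?_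
    filter_upwards [(hmem (hS' n)).coeFn_toLp] with t ht
    rw [hf, ht, real_inner_self_eq_norm_sq]
  obtain ⟨v, hv⟩ := exists_weak_limit f hfn (Ultrafilter.of (atTop : Filter ℕ))
  -- The periodic extension of the weak limit of the derivatives; on (0, 1] it may differ from v
  -- only at the null point 1.
  set V : ℝ → Plane := fun t => v (Int.fract t) with hV
  have hVper : Function.Periodic V 1 := fun t => by simp only [hV, Int.fract_add_one]
  have hVm : StronglyMeasurable V :=
    (Lp.stronglyMeasurable v).comp_measurable measurable_fract
  have hVv : v =ᵐ[μ] V := by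
    have h01 : ∀ᵐ t ∂μ, t ≠ 1 := ae_restrict_of_ae (by simp [ae_iff])
    filter_upwards [h01, ae_restrict_mem measurableSet_Ioc] with t ht htm
    simp only [hV]
    rw [Int.fract_eq_self.2 ⟨htm.1.le, lt_of_le_of_ne htm.2 ht⟩]
  have hVsq : IntervalIntegrable (fun t => ‖V t‖ ^ 2) volume 0 1 := by
    rw [intervalIntegrable_iff_integrableOn_Ioc_of_le zero_le_one]
    exact (memLp_two_iff_integrable_sq_norm hVm.aestronglyMeasurable).1
      ((memLp_congr_ae hVv).1 (Lp.memLp v))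
  have hV2 : MemL2Loc V := fun a b => by
    rw [memLp_two_iff_integrable_sq_norm hVm.aestronglyMeasurable]
    have hp : Function.Periodic (fun t => ‖V t‖ ^ 2) 1 := fun t => by simp only [hVper t]
    have := hp.intervalIntegrable₀ one_ne_zero hVsq (min a b) (max a b)
    rw [intervalIntegrable_iff_integrableOn_Icc_of_le (min_le_max)] at this
    exact this.mono_set (Icc_subset_Icc (min_le_left _ _) (le_max_right _ _))
  refine ⟨V, ⟨hTc.locallyIntegrable, hV2.locallyIntegrable, fun φ hφ hc => ?_⟩, hV2⟩
  obtain ⟨r, hr⟩ := hc.isBounded.subset_ball 0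
  obtain ⟨M, hM⟩ := exists_nat_gt r
  have hφM : ∀ t, φ t ≠ 0 → |t| < M := fun t ht => by
    have := hr (subset_tsupport φ ht)
    rw [mem_ball_zero_iff, Real.norm_eq_abs] at this
    exact this.trans hM
  -- The periodized test function: pairing φ with a periodic function on ℝ is pairing Φ with it over
  -- one period, where the weak convergence in L² applies.
  set Φ : ℝ → ℝ := fun t => ∑ j ∈ Finset.range (2 * M), φ (t + (j - M : ℝ)) with hΦ
  have hφc := hφ.continuous
  have hΦc : Continuous Φ := by fun_prop
  have hpair : ∀ (h : ℝ → Plane) (q : Lp Plane 2 μ) (w : Plane), LocallyIntegrable h volume →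
      Function.Periodic h 1 → q =ᵐ[μ] h →
      inner ℝ q ((hmem (hΦc.smul (continuous_const (y := w)))).toLp _) =
        inner ℝ (∫ t, φ t • h t) w := by
    intro h q w hh hhp hq
    have hi : IntervalIntegrable (fun t => Φ t • h t) volume 0 1 :=
      (hh.integrableOn_isCompact (isCompact_uIcc (a := 0) (b := 1))).intervalIntegrable
        |>.continuousOn_smul hΦc.continuousOn
    rw [integral_smul_periodic hφc hφM hh hhp, L2.inner_def, real_inner_comm]
    have := (innerSL ℝ w).intervalIntegral_comp_comm hi
    simp only [innerSL_apply_apply] at this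
    rw [← this, intervalIntegral.integral_of_le zero_le_one]
    refine integral_congr_ae ?_
    filter_upwards [hq, (hmem (hΦc.smul (continuous_const (y := w)))).coeFn_toLp] with t h2 h3
    rw [h2, h3, Pi.smul_apply', inner_smul_right, inner_smul_right, real_inner_comm]
  have hφ' : Continuous (deriv φ) := hφ.continuous_deriv (by norm_cast)
  have hlim : Tendsto (fun n => ∫ t, deriv φ t • S n t) atTop (𝓝 (∫ t, deriv φ t • T t)) := by
    refine tendsto_integral_of_dominated_convergence (fun t => |deriv φ t|)
      (fun n => (hφ'.smul (hSc n)).aestronglyMeasurable)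
      (hφ'.integrable_of_hasCompactSupport hc.deriv).abs
      (fun n => ae_of_all _ fun t => ?_)
      (ae_of_all _ fun t => tendsto_const_nhds.smul (hT.tendsto_at t))
    rw [norm_smul, Real.norm_eq_abs]
    exact mul_le_of_le_one_right (abs_nonneg _) (h1 n t)
  refine ext_inner_right ℝ fun w => ?_
  have hlim' : Tendsto (fun n => -inner ℝ (∫ t, deriv φ t • S n t) w)
      (Ultrafilter.of (atTop : Filter ℕ) : Filter ℕ)
      (𝓝 (-inner ℝ (∫ t, deriv φ t • T t) w)) :=
    (Filter.Tendsto.inner (𝕜 := ℝ) (hlim.mono_left (Ultrafilter.of_le _)) tendsto_const_nhds).neg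
  have hw := hv ((hmem (hΦc.smul (continuous_const (y := w)))).toLp _)
  rw [hpair V v w hV2.locallyIntegrable hVper hVv] at hw
  have heq : ∀ n, inner ℝ (f n) ((hmem (hΦc.smul (continuous_const (y := w)))).toLp _) =
      -inner ℝ (∫ t, deriv φ t • S n t) w := by
    intro n
    rw [hpair (S' n) (f n) w (hS' n).locallyIntegrable (hS'per n) (MemLp.coeFn_toLp _),
      (hasWeakDeriv_of_hasDerivAt (hS n) (hS' n)).2.2 φ hφ hc, inner_neg_left, neg_neg]
  simp_rw [heq] at hw
  have := tendsto_nhds_unique hlim' hw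
  rw [inner_neg_left, ← this, neg_neg]


/-! ### Compactness of sequences of closed curves -/

/-- Convergence of closed curves: uniformly, and in `L²` for the derivatives, to a curve of
class `C¹`. -/
structure CurvesConverge (g : ℕ → ℝ → Plane) (Γ : ℝ → Plane) : Prop where
  contDiff : ContDiff ℝ 1 Γ
  uniform : TendstoUniformlyOn g Γ atTop (Icc 0 1)
  tendsto_deriv : Tendsto (fun n => ∫ t in (0 : ℝ)..1, ‖deriv (g n) t - deriv Γ t‖ ^ 2) atTop (𝓝 0)

theorem CurvesConverge.comp {g : ℕ → ℝ → Plane} {Γ : ℝ → Plane} (h : CurvesConverge g Γ)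
    {φ : ℕ → ℕ} (hφ : StrictMono φ) : CurvesConverge (fun k => g (φ k)) Γ :=
  ⟨h.contDiff, fun u hu => hφ.tendsto_atTop.eventually (h.uniform u hu),
    h.tendsto_deriv.comp hφ.tendsto_atTop⟩

theorem CurvesConverge.tendsto_h1Norm {g : ℕ → ℝ → Plane} {Γ : ℝ → Plane}
    (h : CurvesConverge g Γ) (hg : ∀ n, ContDiff ℝ 1 (g n)) :
    Tendsto (fun n => h1Norm fun t => g n t - Γ t) atTop (𝓝 0) := by
  have hd : ∀ n t, deriv (fun t => g n t - Γ t) t = deriv (g n) t - deriv Γ t := fun n t =>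
    deriv_fun_sub ((hg n).differentiable (by norm_num) t)
      (h.contDiff.differentiable (by norm_num) t)
  have hdc : ∀ n, Continuous fun t => deriv (g n) t - deriv Γ t := fun n =>
    ((hg n).continuous_deriv le_rfl).sub (h.contDiff.continuous_deriv le_rfl)
  have e : ∀ n, h1Norm (fun t => g n t - Γ t) =
      ((∫⁻ t in Icc (0 : ℝ) 1, ‖g n t - Γ t‖ₑ ^ 2) +
        ENNReal.ofReal (∫ t in (0 : ℝ)..1, ‖deriv (g n) t - deriv Γ t‖ ^ 2)) ^ (1 / 2 : ℝ) := by
    intro n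
    have hc : Continuous fun t => g n t - Γ t := (hg n).continuous.sub h.contDiff.continuous
    have hi : IntegrableOn (fun t => ‖deriv (g n) t - deriv Γ t‖ ^ 2) (Icc 0 1) :=
      ((hdc n).norm.pow 2).continuousOn.integrableOn_compact isCompact_Icc
    have e2 : ENNReal.ofReal (∫ t in (0 : ℝ)..1, ‖deriv (g n) t - deriv Γ t‖ ^ 2) =
        ∫⁻ t in Icc (0 : ℝ) 1, ‖deriv (g n) t - deriv Γ t‖ₑ ^ 2 := by
      rw [intervalIntegral.integral_of_le zero_le_one, ← integral_Icc_eq_integral_Ioc,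
        ofReal_integral_eq_lintegral_ofReal hi
          (ae_of_all _ fun t => by positivity)]
      refine lintegral_congr fun t => ?_
      rw [ENNReal.ofReal_pow (norm_nonneg _), ofReal_norm]
    rw [h1Norm, e2, ← lintegral_add_left (hc.enorm.measurable.pow_const 2)]
    simp_rw [hd]
  have h0 : Tendsto (fun n => ∫⁻ t in Icc (0 : ℝ) 1, ‖g n t - Γ t‖ₑ ^ 2) atTop (𝓝 0) := by
    rw [ENNReal.tendsto_nhds_zero]
    intro ε hε
    obtain ⟨r, hr, hrε⟩ : ∃ r : ℝ, 0 < r ∧ ENNReal.ofReal r ^ 2 ≤ ε := by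
      have ht : Tendsto (fun r : ℝ => ENNReal.ofReal r ^ 2) (𝓝[>] 0) (𝓝 0) := by
        have : Tendsto (fun r : ℝ => ENNReal.ofReal r ^ 2) (𝓝 0) (𝓝 (ENNReal.ofReal 0 ^ 2)) :=
          ENNReal.Tendsto.pow (ENNReal.tendsto_ofReal tendsto_id)
        simp only [ENNReal.ofReal_zero, ne_eq, OfNat.ofNat_ne_zero, not_false_eq_true,
          zero_pow] at this
        exact this.mono_left nhdsWithin_le_nhds
      obtain ⟨r, hr, hr0⟩ := ((ENNReal.tendsto_nhds_zero.1 ht ε hε).and self_mem_nhdsWithin).exists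
      exact ⟨r, hr0, hr⟩
    filter_upwards [Metric.tendstoUniformlyOn_iff.1 h.uniform r hr] with n hn
    calc ∫⁻ t in Icc (0 : ℝ) 1, ‖g n t - Γ t‖ₑ ^ 2
        ≤ ∫⁻ _ in Icc (0 : ℝ) 1, ε := by
          refine setLIntegral_mono measurable_const fun t ht => le_trans ?_ hrε
          have := (hn t ht).le
          rw [dist_comm, dist_eq_norm] at this
          gcongr
          rw [← ofReal_norm]
          exact ENNReal.ofReal_le_ofReal this
      _ = ε := by simp
  have hsum := h0.add (ENNReal.tendsto_ofReal h.tendsto_deriv)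
  simp only [ENNReal.ofReal_zero, add_zero] at hsum
  have hfin := (ENNReal.continuous_rpow_const (y := (1 / 2 : ℝ))).tendsto 0 |>.comp hsum
  simp_rw [e]
  rw [ENNReal.zero_rpow_of_pos (by norm_num)] at hfin
  exact hfin

/-- Arzelà–Ascoli for periodic functions of bounded Dirichlet energy. -/
theorem exists_subseq_tendstoUniformly {S S' : ℕ → ℝ → Plane}
    (hS' : ∀ n, Continuous (S' n)) (hS : ∀ n t, HasDerivAt (S n) (S' n t) t)
    (hper : ∀ n, Function.Periodic (S n) 1) {K : ℝ}
    (hK : ∀ n, ∫ t in (0 : ℝ)..1, ‖S' n t‖ ^ 2 ≤ K) (h1 : ∀ n t, ‖S n t‖ ≤ 1) :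
    ∃ (φ : ℕ → ℕ) (T : ℝ → Plane), StrictMono φ ∧ Continuous T ∧ Function.Periodic T 1 ∧
      TendstoUniformly (fun k => S (φ k)) T atTop := by
  have hSc : ∀ n, Continuous (S n) := fun n =>
    continuous_iff_continuousAt.2 fun t => (hS n t).continuousAt
  have hK0 : 0 ≤ K := le_trans
    (intervalIntegral.integral_nonneg zero_le_one fun t _ => by positivity) (hK 0)
  set s : ℕ → BoundedContinuousFunction (Icc (0 : ℝ) 1) Plane := fun n =>
    BoundedContinuousFunction.mkOfCompact ⟨fun t => S n t, (hSc n).comp continuous_subtype_val⟩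
    with hs
  have hsv : ∀ n (t : Icc (0 : ℝ) 1), s n t = S n t := fun n t => rfl
  have hcomp : IsCompact (closure (range s)) := by
    refine BoundedContinuousFunction.arzela_ascoli (Metric.closedBall 0 1)
      (isCompact_closedBall 0 1) (range s) ?_ ?_
    · rintro _ x ⟨n, rfl⟩
      rw [mem_closedBall_zero_iff]
      exact h1 n x
    -- The Dirichlet bound gives the common Hölder modulus √(K r).
    · refine Metric.equicontinuous_of_continuity_modulus (fun r => Real.sqrt (K * r)) ?_ _ ?_
      · have : Continuous fun r : ℝ => Real.sqrt (K * r) := by fun_prop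
        simpa using this.tendsto 0
      · rintro x y ⟨_, n, rfl⟩
        refine Real.le_sqrt_of_sq_le ?_
        rw [dist_eq_norm, Subtype.dist_eq, Real.dist_eq]
        exact norm_sub_sq_le_of_hasDerivAt (hS' n) (hS n) (hK n) y.2 x.2
  obtain ⟨f, -, φ, hφ, hlim⟩ := hcomp.tendsto_subseq (fun n => subset_closure (mem_range_self n))
  have hfr : ∀ t : ℝ, Int.fract t ∈ Icc (0 : ℝ) 1 := fun t =>
    ⟨Int.fract_nonneg t, (Int.fract_lt_one t).le⟩
  have hSfr : ∀ n t, S n (Int.fract t) = S n t := fun n t => by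
    have := (hper n).int_mul (-⌊t⌋) t
    rw [← this]
    congr 1
    simp only [Int.fract]; push_cast; ring
  -- Uniform convergence on [0, 1] spreads to ℝ through fractional parts, all functions being
  -- 1-periodic.
  have hU : TendstoUniformly (fun k => S (φ k)) (fun t => f ⟨Int.fract t, hfr t⟩) atTop := by
    rw [Metric.tendstoUniformly_iff]
    intro ε hε
    have := (BoundedContinuousFunction.tendsto_iff_tendstoUniformly.1 hlim)
    rw [Metric.tendstoUniformly_iff] at this
    filter_upwards [this ε hε] with k hk t
    have := hk ⟨Int.fract t, hfr t⟩
    simp only [Function.comp_apply, hsv, hSfr] at this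
    exact this
  exact ⟨φ, _, hφ, hU.continuous (Frequently.of_forall fun k => hSc (φ k)),
    fun t => by simp only [Int.fract_add_one], hU⟩

theorem tendsto_integral_norm_sub_sq {S : ℕ → ℝ → Plane} {T : ℝ → Plane}
    (hSc : ∀ n, Continuous (S n)) (hTc : Continuous T) (hT : TendstoUniformly S T atTop) :
    Tendsto (fun n => ∫ t in (0 : ℝ)..1, ‖S n t - T t‖ ^ 2) atTop (𝓝 0) := by
  rw [Metric.tendsto_nhds]
  intro ε hε
  filter_upwards [Metric.tendstoUniformly_iff.1 hT (Real.sqrt (ε / 2)) (by positivity)] with n hn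
  have h0 : 0 ≤ ∫ t in (0 : ℝ)..1, ‖S n t - T t‖ ^ 2 :=
    intervalIntegral.integral_nonneg zero_le_one fun t _ => by positivity
  rw [Real.dist_eq, sub_zero, abs_of_nonneg h0]
  have : ∫ t in (0 : ℝ)..1, ‖S n t - T t‖ ^ 2 ≤ ∫ _ in (0 : ℝ)..1, ε / 2 := by
    refine intervalIntegral.integral_mono_on zero_le_one
      ((((hSc n).sub hTc).norm.pow 2).intervalIntegrable _ _)
      (continuous_const.intervalIntegrable _ _) fun t _ => ?_
    have h1 := (hn t).le
    rw [dist_comm, dist_eq_norm] at h1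
    calc ‖S n t - T t‖ ^ 2 ≤ Real.sqrt (ε / 2) ^ 2 := by gcongr
      _ = ε / 2 := Real.sq_sqrt (by positivity)
  simp only [intervalIntegral.integral_const, sub_zero, one_smul] at this
  linarith

theorem norm_sub_sq_le_two_mul (a b c : Plane) :
    ‖a - c‖ ^ 2 ≤ 2 * ‖a - b‖ ^ 2 + 2 * ‖b - c‖ ^ 2 := by
  have h1 : ‖a - c‖ ≤ ‖a - b‖ + ‖b - c‖ := norm_sub_le_norm_sub_add_norm_sub a b c
  nlinarith [sq_nonneg (‖a - b‖ - ‖b - c‖), norm_nonneg (a - c), norm_nonneg (a - b),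
    norm_nonneg (b - c)]

/-- The unit tangents converge in L² to the uniform limit T of their regularizations, so |T| = 1 by
continuity, and T has mean zero. Integrating ℓ T from p gives a closed curve of constant speed ℓ ≥ c
> 0, whose second derivative is ℓ times the weak derivative of T. -/
theorem limit_curve {g : ℕ → ℝ → Plane} (hg : ∀ n, ContDiff ℝ 1 (g n)) {L : ℕ → ℝ}
    (hL : ∀ n t, ‖deriv (g n) t‖ = L n) {c K : ℝ} (hc : 0 < c) (hcL : ∀ n, c ≤ L n)
    (hLK : ∀ n, L n ≤ K) {η : ℕ → ℝ} (hη : Tendsto η atTop (𝓝 0)) {S S' : ℕ → ℝ → Plane}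
    (hS' : ∀ n, Continuous (S' n)) (hS : ∀ n t, HasDerivAt (S n) (S' n t) t)
    (hper : ∀ n, Function.Periodic (S n) 1) (h1 : ∀ n t, ‖S n t‖ ≤ 1)
    (h0 : ∀ n, ∫ t in (0 : ℝ)..1, S n t = 0) (hK : ∀ n, ∫ t in (0 : ℝ)..1, ‖S' n t‖ ^ 2 ≤ K)
    (hSη : ∀ n, ∫ t in (0 : ℝ)..1, ‖(L n)⁻¹ • deriv (g n) t - S n t‖ ^ 2 ≤ η n)
    {p : Plane} (hp : Tendsto (fun n => g n 0) atTop (𝓝 p)) {ℓ : ℝ}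
    (hℓ : Tendsto L atTop (𝓝 ℓ)) {T : ℝ → Plane} (hTc : Continuous T)
    (hTper : Function.Periodic T 1) (hT : TendstoUniformly S T atTop) :
    ∃ Γ, MemH2 Γ ∧ RegularCurve Γ ∧ ConstantSpeed Γ ∧ CurvesConverge g Γ := by
  have hSc : ∀ n, Continuous (S n) := fun n =>
    continuous_iff_continuousAt.2 fun t => (hS n t).continuousAt
  have hLpos : ∀ n, 0 < L n := fun n => hc.trans_le (hcL n)
  have hℓpos : 0 < ℓ := hc.trans_le (ge_of_tendsto' hℓ hcL)
  have hK0 : 0 ≤ K := (hLpos 0).le.trans (hLK 0)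
  have hgc : ∀ n, Continuous (deriv (g n)) := fun n => (hg n).continuous_deriv le_rfl
  have hD := tendsto_integral_norm_sub_sq hSc hTc hT
  set A : ℕ → ℝ := fun n => ∫ t in (0 : ℝ)..1, ‖(L n)⁻¹ • deriv (g n) t - T t‖ ^ 2 with hA
  have hA0 : ∀ n, 0 ≤ A n := fun n =>
    intervalIntegral.integral_nonneg zero_le_one fun t _ => by positivity
  have hAlim : Tendsto A atTop (𝓝 0) := by
    have hb := (hη.const_mul 2).add (hD.const_mul 2)
    simp only [mul_zero, add_zero] at hb
    refine squeeze_zero hA0 (fun n => ?_) hb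
    have hgn := hgc n
    have hsn := hSc n
    have : A n ≤ ∫ t in (0 : ℝ)..1, (2 * ‖(L n)⁻¹ • deriv (g n) t - S n t‖ ^ 2 +
        2 * ‖S n t - T t‖ ^ 2) :=
      intervalIntegral.integral_mono_on zero_le_one
        (Continuous.intervalIntegrable (by fun_prop) _ _)
        (Continuous.intervalIntegrable (by fun_prop) _ _)
        fun t _ => norm_sub_sq_le_two_mul _ _ _
    refine this.trans ?_
    rw [intervalIntegral.integral_add (Continuous.intervalIntegrable (by fun_prop) _ _)
      (Continuous.intervalIntegrable (by fun_prop) _ _), intervalIntegral.integral_const_mul,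
      intervalIntegral.integral_const_mul]
    linarith [hSη n]
  have hτ : ∀ n t, ‖(L n)⁻¹ • deriv (g n) t‖ = 1 := fun n t => by
    rw [norm_smul, hL, norm_inv, Real.norm_eq_abs, abs_of_pos (hLpos n),
      inv_mul_cancel₀ (hLpos n).ne']
  have hTle : ∀ t, ‖T t‖ ≤ 1 := fun t => le_of_tendsto' (hT.tendsto_at t).norm fun n => h1 n t
  have hTint : ∫ t in (0 : ℝ)..1, (1 - ‖T t‖) ^ 2 ≤ 0 := by
    refine ge_of_tendsto' hAlim fun n => ?_
    have hgn := hgc n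
    refine intervalIntegral.integral_mono_on zero_le_one
        (Continuous.intervalIntegrable (by fun_prop) _ _)
        (Continuous.intervalIntegrable (by fun_prop) _ _) fun t _ => ?_
    have := norm_sub_norm_le ((L n)⁻¹ • deriv (g n) t) (T t)
    rw [hτ] at this
    exact pow_le_pow_left₀ (sub_nonneg.2 (hTle t)) this 2
  have hT1' : ∀ t ∈ Icc (0 : ℝ) 1, ‖T t‖ = 1 := by
    intro t ht
    by_contra hne
    have : 0 < ∫ t in (0 : ℝ)..1, (1 - ‖T t‖) ^ 2 :=
      intervalIntegral.integral_pos zero_lt_one (by fun_prop) (fun t _ => by positivity)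
        ⟨t, ht, by have : 1 - ‖T t‖ ≠ 0 := fun h => hne (by linarith)
                   positivity⟩
    linarith
  have hT1 : ∀ t, ‖T t‖ = 1 := by
    intro t
    have := hTper.int_mul (-⌊t⌋) t
    rw [← this]
    have e : t + ((-⌊t⌋ : ℤ) : ℝ) * 1 = Int.fract t := by
      simp only [Int.fract]; push_cast; ring
    rw [e]
    exact hT1' _ ⟨Int.fract_nonneg t, (Int.fract_lt_one t).le⟩
  have hTzero : ∫ t in (0 : ℝ)..1, T t = 0 := by
    have hle : ‖∫ t in (0 : ℝ)..1, T t‖ ^ 2 ≤ 0 := by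
      refine ge_of_tendsto' hD fun n => ?_
      have e : ‖∫ t in (0 : ℝ)..1, T t‖ = ‖∫ t in (0 : ℝ)..1, (S n t - T t)‖ := by
        rw [intervalIntegral.integral_sub ((hSc n).intervalIntegrable _ _)
          (hTc.intervalIntegrable _ _), h0, zero_sub, norm_neg]
      rw [e]
      simpa using norm_sq_intervalIntegral_le ((hSc n).sub hTc) zero_le_one
    have := pow_eq_zero_iff (two_ne_zero) |>.1 (le_antisymm hle (by positivity))
    exact norm_eq_zero.1 this
  set Γ : ℝ → Plane := fun t => p + ℓ • ∫ s in (0 : ℝ)..t, T s with hΓ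
  have hΓd : ∀ t, HasDerivAt Γ (ℓ • T t) t := fun t =>
    ((hTc.integral_hasStrictDerivAt 0 t).hasDerivAt.const_smul ℓ).const_add p
  have hΓ' : deriv Γ = fun t => ℓ • T t := funext fun t => (hΓd t).deriv
  have hdc : Continuous fun t => ℓ • T t := by fun_prop
  have hΓ1 : ContDiff ℝ 1 Γ := by
    rw [contDiff_one_iff_deriv, hΓ']
    exact ⟨fun t => (hΓd t).differentiableAt, hdc⟩
  have hnorm : ∀ t, ‖deriv Γ t‖ = ℓ := fun t => by
    rw [hΓ', norm_smul, hT1, mul_one, Real.norm_eq_abs, abs_of_pos hℓpos]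
  obtain ⟨v, hv, hv2⟩ := exists_hasWeakDeriv_of_tendstoUniformly hS' hS hper hK h1 hT
  have hBlim : Tendsto (fun n => ∫ t in (0 : ℝ)..1, ‖deriv (g n) t - deriv Γ t‖ ^ 2) atTop
      (𝓝 0) := by
    have hb := (hAlim.const_mul (2 * K ^ 2)).add (((hℓ.sub_const ℓ).pow 2).const_mul 2)
    simp only [mul_zero, sub_self, ne_eq, OfNat.ofNat_ne_zero, not_false_eq_true, zero_pow,
      add_zero] at hb
    refine squeeze_zero (fun n =>
      intervalIntegral.integral_nonneg zero_le_one fun t _ => by positivity) (fun n => ?_) hb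
    have hgn := hgc n
    rw [hΓ']
    have : ∫ t in (0 : ℝ)..1, ‖deriv (g n) t - ℓ • T t‖ ^ 2 ≤
        ∫ t in (0 : ℝ)..1, (2 * K ^ 2 * ‖(L n)⁻¹ • deriv (g n) t - T t‖ ^ 2 +
          2 * (L n - ℓ) ^ 2) := by
      refine intervalIntegral.integral_mono_on zero_le_one
        (Continuous.intervalIntegrable (by fun_prop) _ _)
        (Continuous.intervalIntegrable (by fun_prop) _ _) fun t _ => ?_
      refine (norm_sub_sq_le_two_mul _ (L n • T t) _).trans ?_
      have e1 : deriv (g n) t - L n • T t = L n • ((L n)⁻¹ • deriv (g n) t - T t) := by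
        rw [smul_sub, smul_inv_smul₀ (hLpos n).ne']
      have e2 : L n • T t - ℓ • T t = (L n - ℓ) • T t := (sub_smul _ _ _).symm
      rw [e1, e2, norm_smul, norm_smul, hT1, mul_one, mul_pow, Real.norm_eq_abs,
        Real.norm_eq_abs, sq_abs, sq_abs, mul_assoc 2 (K ^ 2)]
      have := hLpos n
      have := hLK n
      gcongr
    refine this.trans (le_of_eq ?_)
    rw [intervalIntegral.integral_add (Continuous.intervalIntegrable (by fun_prop) _ _)
      (Continuous.intervalIntegrable (by fun_prop) _ _), intervalIntegral.integral_const_mul]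
    simp [hA]
  refine ⟨Γ, ⟨hΓ1.continuous, fun t => ?_, fun t => ℓ • T t, fun t => ℓ • v t,
    hasWeakDeriv_of_hasDerivAt hΓd hdc, hv.const_smul ℓ, memL2Loc_of_continuous hΓ1.continuous,
    memL2Loc_of_continuous hdc, hv2.const_smul ℓ⟩, fun t => ?_, fun t => ?_, ⟨hΓ1, ?_, hBlim⟩⟩
  · simp only [hΓ]
    rw [← intervalIntegral.integral_add_adjacent_intervals (hTc.intervalIntegrable 0 t)
      (hTc.intervalIntegrable t (t + 1)), hTper.intervalIntegral_add_eq t 0, zero_add, hTzero,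
      add_zero]
  · rw [← norm_pos_iff, hnorm]; exact hℓpos
  · simp_rw [curveLength, hnorm]; simp
  · rw [Metric.tendstoUniformlyOn_iff]
    intro ε hε
    have hsq : Tendsto (fun n => Real.sqrt
        (∫ t in (0 : ℝ)..1, ‖deriv (g n) t - deriv Γ t‖ ^ 2)) atTop (𝓝 0) := by
      simpa using hBlim.sqrt
    have hp0 : Tendsto (fun n => ‖g n 0 - p‖) atTop (𝓝 0) := by
      simpa using (hp.sub_const p).norm
    have hsum := hp0.add hsq
    rw [add_zero] at hsum
    filter_upwards [hsum.eventually_lt_const hε] with n hn t ht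
    have hgn := hgc n
    have hΓn : Continuous (deriv Γ) := hΓ1.continuous_deriv le_rfl
    have e : g n t - Γ t = (g n 0 - p) + ∫ s in (0 : ℝ)..t, (deriv (g n) s - deriv Γ s) := by
      rw [intervalIntegral.integral_sub (hgn.intervalIntegrable _ _)
        (hΓn.intervalIntegrable _ _), intervalIntegral.integral_deriv_eq_sub'
        _ rfl (fun s _ => (hg n).differentiable (by norm_num) s) hgn.continuousOn,
        intervalIntegral.integral_deriv_eq_sub' _ rfl
        (fun s _ => hΓ1.differentiable (by norm_num) s) hΓn.continuousOn]
      have : Γ 0 = p := by simp [hΓ]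
      rw [this]; abel
    rw [dist_comm, dist_eq_norm, e]
    refine lt_of_le_of_lt ((norm_add_le _ _).trans ?_) hn
    gcongr
    refine Real.le_sqrt_of_sq_le ?_
    refine (norm_sq_intervalIntegral_le (hgn.sub hΓn) ht.1).trans ?_
    have hmono : ∫ s in (0 : ℝ)..t, ‖deriv (g n) s - deriv Γ s‖ ^ 2 ≤
        ∫ s in (0 : ℝ)..1, ‖deriv (g n) s - deriv Γ s‖ ^ 2 :=
      intervalIntegral.integral_mono_interval le_rfl ht.1 ht.2
        (ae_of_all _ fun r => by positivity) (Continuous.intervalIntegrable (by fun_prop) _ _)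
    have hnn : 0 ≤ ∫ s in (0 : ℝ)..t, ‖deriv (g n) s - deriv Γ s‖ ^ 2 :=
      intervalIntegral.integral_nonneg ht.1 fun t _ => by positivity
    rw [sub_zero]
    exact (mul_le_of_le_one_left hnn ht.2).trans hmono

/-- Compactness for closed curves of constant speed: up to subsequences they converge to an `H²`
curve or escape to infinity. -/
theorem exists_subseq_curve {g : ℕ → ℝ → Plane} (hg : ∀ n, ContDiff ℝ 1 (g n)) {L : ℕ → ℝ}
    (hL : ∀ n t, ‖deriv (g n) t‖ = L n) {c K : ℝ} (hc : 0 < c) (hcL : ∀ n, c ≤ L n)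
    (hLK : ∀ n, L n ≤ K) {η : ℕ → ℝ} (hη : Tendsto η atTop (𝓝 0))
    (hS : ∀ n, ∃ S S' : ℝ → Plane, Continuous S' ∧
      (∀ t, HasDerivAt S (S' t) t) ∧ Function.Periodic S 1 ∧
      (∀ t, ‖S t‖ ≤ 1) ∧ ∫ t in (0 : ℝ)..1, S t = 0 ∧
      ∫ t in (0 : ℝ)..1, ‖S' t‖ ^ 2 ≤ K ∧
      ∫ t in (0 : ℝ)..1, ‖(L n)⁻¹ • deriv (g n) t - S t‖ ^ 2 ≤ η n) :
    ∃ φ : ℕ → ℕ, StrictMono φ ∧ (Tendsto (fun k => ‖g (φ k) 0‖) atTop atTop ∨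
      ∃ Γ, MemH2 Γ ∧ RegularCurve Γ ∧ ConstantSpeed Γ ∧
        CurvesConverge (fun k => g (φ k)) Γ) := by
  by_cases hb : Tendsto (fun n => ‖g n 0‖) atTop atTop
  · exact ⟨id, strictMono_id, Or.inl hb⟩
  choose S S' h1 h2 h3 h4 h5 h6 h7 using hS
  -- Base points that do not tend to infinity return to some ball infinitely often. Base points,
  -- lengths and regularized tangents are then made to converge by successive extractions.
  obtain ⟨B, hB⟩ : ∃ B : ℝ, ∃ᶠ n in atTop, g n 0 ∈ Metric.closedBall 0 B := by
    rw [tendsto_atTop] at hb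
    push Not at hb
    obtain ⟨B, hB⟩ := hb
    refine ⟨B, hB.mono fun n hn => ?_⟩
    rw [mem_closedBall_zero_iff]
    linarith
  obtain ⟨p, -, φ₁, hφ₁, hp⟩ := tendsto_subseq_of_frequently_bounded Metric.isBounded_closedBall hB
  obtain ⟨ℓ, -, φ₂, hφ₂, hℓ⟩ := isCompact_Icc.tendsto_subseq
    (fun n => (⟨hcL (φ₁ n), hLK (φ₁ n)⟩ : L (φ₁ n) ∈ Icc c K))
  obtain ⟨φ₃, T, hφ₃, hTc, hTper, hT⟩ := exists_subseq_tendstoUniformly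
    (S := fun n => S (φ₁ (φ₂ n))) (fun n => h1 _) (fun n => h2 _) (fun n => h3 _)
    (fun n => h6 _) (fun n => h4 _)
  have hφ : StrictMono fun k => φ₁ (φ₂ (φ₃ k)) := fun a b hab => hφ₁ (hφ₂ (hφ₃ hab))
  refine ⟨fun k => φ₁ (φ₂ (φ₃ k)), hφ, Or.inr ?_⟩
  exact limit_curve (g := fun k => g (φ₁ (φ₂ (φ₃ k)))) (fun n => hg _)
    (L := fun k => L (φ₁ (φ₂ (φ₃ k)))) (fun n => hL _) hc (fun n => hcL _) (fun n => hLK _)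
    (hη.comp hφ.tendsto_atTop) (fun n => h1 _) (fun n => h2 _) (fun n => h3 _)
    (fun n => h4 _) (fun n => h5 _) (fun n => h6 _) (fun n => h7 _)
    (hp.comp (hφ₂.comp hφ₃).tendsto_atTop) (hℓ.comp hφ₃.tendsto_atTop) hTc hTper hT

/-- Simultaneous extraction of finitely many subsequences. -/
theorem exists_common_subseq {P : ℕ → (ℕ → ℕ) → Prop}
    (hmono : ∀ i φ ψ, StrictMono ψ → P i φ → P i (φ ∘ ψ)) (M : ℕ)
    (h : ∀ i < M, ∀ φ : ℕ → ℕ, StrictMono φ → ∃ ψ : ℕ → ℕ, StrictMono ψ ∧ P i (φ ∘ ψ)) :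
    ∃ φ : ℕ → ℕ, StrictMono φ ∧ ∀ i < M, P i φ := by
  induction M with
  | zero => exact ⟨id, strictMono_id, fun i hi => absurd hi (Nat.not_lt_zero i)⟩
  | succ M ih =>
    obtain ⟨φ, hφ, hP⟩ := ih fun i hi => h i (hi.trans (Nat.lt_succ_self M))
    obtain ⟨ψ, hψ, hM⟩ := h M (Nat.lt_succ_self M) φ hφ
    refine ⟨φ ∘ ψ, hφ.comp hψ, fun i hi => ?_⟩
    rcases Nat.lt_succ_iff_lt_or_eq.1 hi with hlt | rfl
    · exact hmono i φ ψ hψ (hP i hlt)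
    · exact hM


/-! ### Limits of winding numbers -/

/-- The vector field whose flux through curves defines winding numbers. -/
noncomputable def windingKernel (z : Plane) : Plane := (‖z‖ ^ 2)⁻¹ • perp z

theorem norm_windingKernel (z : Plane) : ‖windingKernel z‖ = ‖z‖⁻¹ := by
  rw [windingKernel, norm_smul, norm_perp, norm_inv, norm_pow, norm_norm]
  rcases eq_or_ne ‖z‖ 0 with h | h
  · simp [h]
  · field_simp

theorem continuousAt_windingKernel {z : Plane} (hz : z ≠ 0) : ContinuousAt windingKernel z := by
  have h1 : ContinuousAt (fun z : Plane => (‖z‖ ^ 2)⁻¹) z :=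
    (continuous_norm.pow 2).continuousAt.inv₀ (pow_ne_zero 2 (norm_ne_zero_iff.2 hz))
  exact h1.smul continuous_perp.continuousAt

theorem measurable_windingKernel : Measurable windingKernel :=
  (continuous_norm.pow 2).measurable.inv.smul continuous_perp.measurable

theorem windingNumber_eq (γ : ℝ → Plane) (x : Plane) :
    windingNumber γ x =
      1 / (2 * Real.pi) * ∫ t in (0 : ℝ)..1, inner ℝ (windingKernel (γ t - x)) (deriv γ t) := by
  rw [windingNumber]
  congr 1
  refine intervalIntegral.integral_congr fun t _ => ?_
  simp only [windingKernel, real_inner_smul_left]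
  ring

theorem abs_windingNumber_le {γ : ℝ → Plane} {x : Plane} {K r : ℝ} (hr : 0 < r)
    (hd : ∀ t ∈ Icc (0 : ℝ) 1, r ≤ ‖γ t - x‖) (hK : ∀ t, ‖deriv γ t‖ ≤ K) :
    |windingNumber γ x| ≤ K / r := by
  have h1 : ‖∫ t in (0 : ℝ)..1, inner ℝ (windingKernel (γ t - x)) (deriv γ t)‖ ≤
      K / r * |(1 : ℝ) - 0| := by
    refine intervalIntegral.norm_integral_le_of_norm_le_const fun t ht => ?_
    rw [uIoc_of_le zero_le_one] at ht
    have h2 := hd t (Ioc_subset_Icc_self ht)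
    refine (norm_inner_le_norm _ _).trans ?_
    rw [norm_windingKernel, mul_comm, ← div_eq_mul_inv]
    exact div_le_div₀ ((norm_nonneg _).trans (hK t)) (hK t) hr h2
  rw [windingNumber_eq, abs_mul, ← Real.norm_eq_abs (∫ t in (0 : ℝ)..1, _)]
  rw [sub_zero, abs_one, mul_one] at h1
  have hpi : |1 / (2 * Real.pi)| ≤ 1 := by
    rw [abs_of_pos (by positivity), div_le_one (by positivity)]
    linarith [Real.pi_gt_three]
  calc |1 / (2 * Real.pi)| * ‖∫ t in (0 : ℝ)..1, inner ℝ (windingKernel (γ t - x)) (deriv γ t)‖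
      ≤ 1 * (K / r) := by gcongr
    _ = K / r := one_mul _

/-- A curve of length at most K with a distant base point stays far from x, and the kernel decays
like the inverse distance. -/
theorem tendsto_windingNumber_of_escape {g : ℕ → ℝ → Plane} (hg : ∀ n, ContDiff ℝ 1 (g n))
    {L : ℕ → ℝ} (hL : ∀ n t, ‖deriv (g n) t‖ = L n) {K : ℝ} (hLK : ∀ n, L n ≤ K)
    (hesc : Tendsto (fun n => ‖g n 0‖) atTop atTop) (x : Plane) :
    Tendsto (fun n => windingNumber (g n) x) atTop (𝓝 0) := by
  have hr : Tendsto (fun n => ‖g n 0‖ - (K + ‖x‖)) atTop atTop :=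
    tendsto_atTop_add_const_right _ _ hesc
  have hlim : Tendsto (fun n => K / (‖g n 0‖ - (K + ‖x‖))) atTop (𝓝 0) :=
    hr.const_div_atTop K
  refine squeeze_zero_norm' ?_ hlim
  filter_upwards [hr.eventually_gt_atTop 0] with n hn
  rw [Real.norm_eq_abs]
  refine abs_windingNumber_le hn (fun t ht => ?_) fun t => (hL n t).le.trans (hLK n)
  have h1 := norm_sub_le_of_norm_deriv_eq (hg n) (hL n) 0 t
  have hK0 : 0 ≤ L n := by rw [← hL n 0]; exact norm_nonneg _
  have h2 : ‖g n 0 - g n t‖ ≤ K := by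
    refine h1.trans (le_trans ?_ (hLK n))
    rw [zero_sub, abs_neg, abs_of_nonneg ht.1]
    exact mul_le_of_le_one_right hK0 ht.2
  have h3 : ‖g n 0‖ ≤ ‖g n 0 - g n t‖ + (‖g n t - x‖ + ‖x‖) := by
    have e : g n 0 = (g n 0 - g n t) + ((g n t - x) + x) := by abel
    calc ‖g n 0‖ = ‖(g n 0 - g n t) + ((g n t - x) + x)‖ := by rw [← e]
      _ ≤ _ := (norm_add_le _ _).trans (by gcongr; exact norm_add_le _ _)
  linarith

/-- The curves eventually keep a fixed distance from the centres, so the kernel is bounded. Against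
the derivative of Γ the integral converges by dominated convergence; against the difference of
derivatives it is small by L² convergence. Letting the centre vary with n gives continuity of
winding numbers from a constant sequence of curves. -/
theorem CurvesConverge.tendsto_windingNumber {g : ℕ → ℝ → Plane} {Γ : ℝ → Plane}
    (h : CurvesConverge g Γ) (hg : ∀ n, ContDiff ℝ 1 (g n)) {x : ℕ → Plane} {y : Plane}
    (hx : Tendsto x atTop (𝓝 y)) (hy : y ∉ curveImage Γ) :
    Tendsto (fun n => windingNumber (g n) (x n)) atTop (𝓝 (windingNumber Γ y)) := by
  have hcpt : IsCompact (curveImage Γ) := isCompact_Icc.image h.contDiff.continuous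
  obtain ⟨r, hr, hball⟩ := Metric.isOpen_iff.1 hcpt.isClosed.isOpen_compl y hy
  have hfar : ∀ t ∈ Icc (0 : ℝ) 1, r ≤ ‖Γ t - y‖ := by
    intro t ht
    by_contra hcon
    rw [not_le, ← dist_eq_norm] at hcon
    exact hball (Metric.mem_ball.2 hcon) (mem_image_of_mem Γ ht)
  set ρ := r / 2 with hρ
  have hρ0 : 0 < ρ := by positivity
  have hev : ∀ᶠ n in atTop, ∀ t ∈ Icc (0 : ℝ) 1, ρ ≤ ‖g n t - x n‖ := by
    filter_upwards [Metric.tendstoUniformlyOn_iff.1 h.uniform (ρ / 2) (by positivity),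
      Metric.tendsto_nhds.1 hx (ρ / 2) (by positivity)] with n h1 h2 t ht
    have h3 := h1 t ht
    rw [dist_eq_norm] at h3 h2
    have h4 := hfar t ht
    have e : Γ t - y = (Γ t - g n t) + ((g n t - x n) + (x n - y)) := by abel
    have h5 : ‖Γ t - y‖ ≤ ‖Γ t - g n t‖ + (‖g n t - x n‖ + ‖x n - y‖) := by
      rw [e]
      exact (norm_add_le _ _).trans (by gcongr; exact norm_add_le _ _)
    linarith
  have hΓ' : Continuous (deriv Γ) := h.contDiff.continuous_deriv le_rfl
  have hgc : ∀ n, Continuous (deriv (g n)) := fun n => (hg n).continuous_deriv le_rfl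
  have hkm : ∀ n, Measurable fun t => windingKernel (g n t - x n) := fun n =>
    measurable_windingKernel.comp ((hg n).continuous.sub continuous_const).measurable
  have hkb : ∀ᶠ n in atTop, ∀ t ∈ Ioc (0 : ℝ) 1, ‖windingKernel (g n t - x n)‖ ≤ ρ⁻¹ := by
    filter_upwards [hev] with n hn t ht
    rw [norm_windingKernel]
    exact inv_anti₀ hρ0 (hn t (Ioc_subset_Icc_self ht))
  have hA : Tendsto (fun n => ∫ t in (0 : ℝ)..1, inner ℝ (windingKernel (g n t - x n)) (deriv Γ t))
      atTop (𝓝 (∫ t in (0 : ℝ)..1, inner ℝ (windingKernel (Γ t - y)) (deriv Γ t))) := by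
    refine intervalIntegral.tendsto_integral_filter_of_dominated_convergence
      (fun t => ρ⁻¹ * ‖deriv Γ t‖)
      (Eventually.of_forall fun n => ((hkm n).inner hΓ'.measurable).aestronglyMeasurable)
      ?_ (Continuous.intervalIntegrable (by fun_prop) _ _) ?_
    · filter_upwards [hkb] with n hn
      refine ae_of_all _ fun t ht => ?_
      rw [uIoc_of_le zero_le_one] at ht
      exact (norm_inner_le_norm _ _).trans (by gcongr; exact hn t ht)
    · refine ae_of_all _ fun t ht => ?_
      rw [uIoc_of_le zero_le_one] at ht
      have hne : Γ t - y ≠ 0 := norm_pos_iff.1 (hr.trans_le (hfar t (Ioc_subset_Icc_self ht)))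
      have ht1 : Tendsto (fun n => g n t - x n) atTop (𝓝 (Γ t - y)) :=
        (h.uniform.tendsto_at (Ioc_subset_Icc_self ht)).sub hx
      exact Filter.Tendsto.inner (𝕜 := ℝ) ((continuousAt_windingKernel hne).tendsto.comp ht1)
        tendsto_const_nhds
  have hB : Tendsto (fun n => ∫ t in (0 : ℝ)..1,
      inner ℝ (windingKernel (g n t - x n)) (deriv (g n) t - deriv Γ t)) atTop (𝓝 0) := by
    have hsq : Tendsto (fun n => ρ⁻¹ * Real.sqrt
        (∫ t in (0 : ℝ)..1, ‖deriv (g n) t - deriv Γ t‖ ^ 2)) atTop (𝓝 0) := by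
      simpa using h.tendsto_deriv.sqrt.const_mul ρ⁻¹
    refine squeeze_zero_norm' ?_ hsq
    filter_upwards [hkb] with n hn
    have hgn := hgc n
    have h1 : ‖∫ t in (0 : ℝ)..1,
        inner ℝ (windingKernel (g n t - x n)) (deriv (g n) t - deriv Γ t)‖ ≤
        ∫ t in (0 : ℝ)..1, ρ⁻¹ * ‖deriv (g n) t - deriv Γ t‖ := by
      refine intervalIntegral.norm_integral_le_of_norm_le zero_le_one
        (ae_of_all _ fun t ht => ?_) (Continuous.intervalIntegrable (by fun_prop) _ _)
      exact (norm_inner_le_norm _ _).trans (by gcongr; exact hn t ht)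
    refine h1.trans ?_
    rw [intervalIntegral.integral_const_mul]
    gcongr
    refine Real.le_sqrt_of_sq_le ?_
    simpa using sq_intervalIntegral_le (hgn.sub hΓ').norm zero_le_one
  have hsum := (hA.add hB).const_mul (1 / (2 * Real.pi))
  rw [add_zero, ← windingNumber_eq] at hsum
  refine hsum.congr' ?_
  filter_upwards [hkb] with n hn
  have hintg : ∀ {f : ℝ → Plane}, Continuous f → IntervalIntegrable
      (fun t => inner ℝ (windingKernel (g n t - x n)) (f t)) volume 0 1 := by
    intro f hf
    have hb : IntervalIntegrable (fun t => ρ⁻¹ * ‖f t‖) volume 0 1 :=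
      Continuous.intervalIntegrable (by fun_prop) _ _
    refine hb.mono_fun ((hkm n).inner hf.measurable).aestronglyMeasurable ?_
    rw [uIoc_of_le zero_le_one]
    filter_upwards [ae_restrict_mem measurableSet_Ioc] with t ht
    rw [norm_mul, norm_norm, Real.norm_eq_abs ρ⁻¹, abs_of_pos (by positivity)]
    exact (norm_inner_le_norm _ _).trans (by gcongr; exact hn t ht)
  rw [windingNumber_eq, ← intervalIntegral.integral_add (hintg hΓ')
    (hintg (f := fun t => deriv (g n) t - deriv Γ t) ((hgc n).sub hΓ'))]
  congr 1
  refine intervalIntegral.integral_congr fun t _ => ?_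
  simp only [← inner_add_right, add_sub_cancel]

theorem continuousAt_windingNumber {Γ : ℝ → Plane} (hΓ : ContDiff ℝ 1 Γ) {y : Plane}
    (hy : y ∉ curveImage Γ) : ContinuousAt (windingNumber Γ) y := by
  refine tendsto_of_seq_tendsto fun x hx => ?_
  have hconv : CurvesConverge (fun _ => Γ) Γ :=
    ⟨hΓ, fun u hu => Eventually.of_forall fun _ t _ => refl_mem_uniformity hu, by simp⟩
  exact hconv.tendsto_windingNumber (fun _ => hΓ) hx hy

/-! ### Local integrability of winding numbers and negligible sets. -/

theorem lintegral_ball_inv_enorm_lt_top : ∫⁻ z in Metric.ball (0 : Plane) 1, ‖z‖ₑ⁻¹ < ⊤ := by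
  have hi : Integrable (fun z : Plane => (Iio (1 : ℝ)).indicator (fun r => r⁻¹) ‖z‖) := by
    rw [integrable_fun_norm_addHaar]
    have hintg : IntegrableOn ((Ioo (0 : ℝ) 1).indicator fun _ => (1 : ℝ)) (Ioi 0) :=
      ((integrable_indicator_iff measurableSet_Ioo).2 (by simp)).integrableOn
    refine hintg.congr_fun (fun r hr => ?_) measurableSet_Ioi
    have hr0 : (0 : ℝ) < r := hr
    simp only [finrank_euclideanSpace, Fintype.card_fin, indicator, mem_Ioo, mem_Iio, hr0, true_and,
      smul_eq_mul]
    split_ifs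
    · simp [hr0.ne']
    · simp
  have h2 := hi.2
  rw [hasFiniteIntegral_iff_enorm] at h2
  refine lt_of_le_of_lt ?_ h2
  rw [← lintegral_indicator measurableSet_ball]
  refine lintegral_mono_ae ?_
  have h0 : ∀ᵐ z : Plane, z ≠ 0 := by simp [ae_iff]
  filter_upwards [h0] with z hz
  by_cases hzb : z ∈ Metric.ball (0 : Plane) 1
  · rw [indicator_of_mem hzb, indicator_of_mem (by simpa using hzb), enorm_inv
      (norm_ne_zero_iff.2 hz), enorm_norm]
  · rw [indicator_of_notMem hzb]; exact zero_le

/-- Within distance 1 of y the singularity is integrable and translation invariance applies;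
elsewhere the integrand is at most 1. The constant is independent of y, so the bound can be
integrated along any curve. -/
theorem exists_lintegral_inv_enorm_sub_le (R : ℝ) :
    ∃ C : ℝ≥0∞, C ≠ ⊤ ∧ ∀ y : Plane, ∫⁻ x in Metric.ball (0 : Plane) R, ‖y - x‖ₑ⁻¹ ≤ C := by
  refine ⟨(∫⁻ z in Metric.ball (0 : Plane) 1, ‖z‖ₑ⁻¹) + volume (Metric.ball (0 : Plane) R),
    ENNReal.add_ne_top.2 ⟨lintegral_ball_inv_enorm_lt_top.ne, measure_ball_lt_top.ne⟩,
    fun y => ?_⟩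
  set F : Plane → ℝ≥0∞ := (Metric.ball (0 : Plane) 1).indicator fun z => ‖z‖ₑ⁻¹ with hF
  have hFm : Measurable F := measurable_enorm.inv.indicator measurableSet_ball
  have hle : ∀ x, ‖y - x‖ₑ⁻¹ ≤ F (y - x) + 1 := by
    intro x
    by_cases hx : y - x ∈ Metric.ball (0 : Plane) 1
    · rw [hF, indicator_of_mem hx]; exact le_self_add
    · refine le_add_left ?_
      rw [ENNReal.inv_le_one, ← ofReal_norm, ← ENNReal.ofReal_one]
      rw [mem_ball_zero_iff, not_lt] at hx
      exact ENNReal.ofReal_le_ofReal hx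
  calc ∫⁻ x in Metric.ball (0 : Plane) R, ‖y - x‖ₑ⁻¹
      ≤ ∫⁻ x in Metric.ball (0 : Plane) R, (F (y - x) + 1) := lintegral_mono hle
    _ = (∫⁻ x in Metric.ball (0 : Plane) R, F (y - x)) + volume (Metric.ball (0 : Plane) R) := by
      rw [lintegral_add_right _ measurable_const, setLIntegral_one]
    _ ≤ (∫⁻ x, F (y - x)) + volume (Metric.ball (0 : Plane) R) := by
      gcongr; exact Measure.restrict_le_self
    _ = _ := by
      rw [lintegral_sub_left_eq_self F y, hF, lintegral_indicator measurableSet_ball]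

/-- A measurable bound for the winding numbers of curves of speed `L`. -/
noncomputable def windingMajorant (γ : ℝ → Plane) (L : ℝ) (x : Plane) : ℝ≥0∞ :=
  ENNReal.ofReal L * ∫⁻ t in Ioc (0 : ℝ) 1, ‖γ t - x‖ₑ⁻¹

theorem measurable_inv_enorm_sub {γ : ℝ → Plane} (hγ : Continuous γ) :
    Measurable fun p : Plane × ℝ => ‖γ p.2 - p.1‖ₑ⁻¹ :=
  ((hγ.comp continuous_snd).sub continuous_fst).enorm.measurable.inv

theorem measurable_windingMajorant {γ : ℝ → Plane} (hγ : Continuous γ) (L : ℝ) :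
    Measurable (windingMajorant γ L) :=
  (measurable_inv_enorm_sub hγ).lintegral_prod_right'.const_mul _

theorem enorm_windingNumber_le {γ : ℝ → Plane} {L : ℝ} (hL : ∀ t, ‖deriv γ t‖ = L) (x : Plane) :
    ‖windingNumber γ x‖ₑ ≤ windingMajorant γ L x := by
  have h1 : ‖windingNumber γ x‖ₑ ≤
      ‖∫ t in (0 : ℝ)..1, inner ℝ (windingKernel (γ t - x)) (deriv γ t)‖ₑ := by
    rw [windingNumber_eq, enorm_mul]
    refine mul_le_of_le_one_left zero_le ?_
    rw [← ofReal_norm, ← ENNReal.ofReal_one]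
    refine ENNReal.ofReal_le_ofReal ?_
    rw [Real.norm_eq_abs, abs_of_pos (by positivity), div_le_one (by positivity)]
    linarith [Real.pi_gt_three]
  refine h1.trans ?_
  rw [intervalIntegral.integral_of_le zero_le_one, windingMajorant,
    ← lintegral_const_mul' _ _ ENNReal.ofReal_ne_top]
  refine (enorm_integral_le_lintegral_enorm _).trans (lintegral_mono fun t => ?_)
  rw [← ofReal_norm, mul_comm]
  rcases eq_or_ne (γ t - x) 0 with h0 | h0
  · rw [h0]
    simp [windingKernel]
  · have hpos : 0 < ‖γ t - x‖ := norm_pos_iff.2 h0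
    calc ENNReal.ofReal ‖inner ℝ (windingKernel (γ t - x)) (deriv γ t)‖
        ≤ ENNReal.ofReal (‖γ t - x‖⁻¹ * L) := by
          refine ENNReal.ofReal_le_ofReal ((norm_inner_le_norm _ _).trans ?_)
          rw [norm_windingKernel, hL]
      _ = ‖γ t - x‖ₑ⁻¹ * ENNReal.ofReal L := by
          rw [ENNReal.ofReal_mul (by positivity), ENNReal.ofReal_inv_of_pos hpos, ofReal_norm]

/-- By Tonelli the integral over the ball is taken first, for each point of the curve. The bound is
linear in the length, so it can be summed over arbitrarily many short curves. -/
theorem lintegral_windingMajorant_le {γ : ℝ → Plane} (hγ : Continuous γ) (L : ℝ) {R : ℝ}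
    {C : ℝ≥0∞} (hC : ∀ y : Plane, ∫⁻ x in Metric.ball (0 : Plane) R, ‖y - x‖ₑ⁻¹ ≤ C) :
    ∫⁻ x in Metric.ball (0 : Plane) R, windingMajorant γ L x ≤ ENNReal.ofReal L * C := by
  simp only [windingMajorant]
  rw [lintegral_const_mul' _ _ ENNReal.ofReal_ne_top,
    lintegral_lintegral_swap (measurable_inv_enorm_sub hγ).aemeasurable]
  gcongr
  calc ∫⁻ t in Ioc (0 : ℝ) 1, ∫⁻ x in Metric.ball (0 : Plane) R, ‖γ t - x‖ₑ⁻¹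
      ≤ ∫⁻ _ in Ioc (0 : ℝ) 1, C := lintegral_mono fun t => hC (γ t)
    _ = C := by simp

/-- Images of curves of class `C¹` have measure zero. -/
theorem volume_curveImage {γ : ℝ → Plane} (hγ : ContDiff ℝ 1 γ) :
    volume (curveImage γ) = 0 := by
  have hd : dimH (curveImage γ) < ((2 : NNReal) : ℝ≥0∞) := by
    refine lt_of_le_of_lt ((dimH_mono (image_subset_range γ _)).trans hγ.dimH_range_le) ?_
    rw [Module.finrank_self]
    norm_num
  have hfr : Module.finrank ℝ Plane = 2 := by simp
  refine measure_zero_of_dimH_lt (d := 2) ?_ hd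
  have : Measure.IsAddHaarMeasure (Measure.hausdorffMeasure (X := Plane) ((2 : NNReal) : ℝ)) := by
    have := isAddHaarMeasure_hausdorffMeasure (E := Plane)
    rw [hfr] at this
    exact_mod_cast this
  exact Measure.absolutelyContinuous_isAddHaarMeasure _ _

theorem volume_familyImage {I : Finset ℕ} {γ : ℕ → ℝ → Plane}
    (hγ : ∀ i ∈ I, ContDiff ℝ 1 (γ i)) : volume (familyImage I γ) = 0 :=
  (measure_biUnion_null_iff I.countable_toSet).2 fun i hi => volume_curveImage (hγ i hi)

theorem IsBoundaryDecomposition.volume_frontier {Ω : Set Plane} {N : ℕ} {γ : ℕ → ℝ → Plane}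
    (h : IsBoundaryDecomposition Ω N γ) : volume (frontier Ω) = 0 := by
  rw [h.boundary]
  exact (measure_biUnion_null_iff (Set.finite_Iio N).countable).2 fun i hi =>
    volume_curveImage (h.contDiff_one hi)


/-! ### Boundary systems from winding numbers -/

section

variable {Ω : Set Plane} {I : Finset ℕ} {Γ : ℕ → ℝ → Plane}

theorem isClosed_familyImage (hC : ∀ i ∈ I, ContDiff ℝ 1 (Γ i)) : IsClosed (familyImage I Γ) :=
  (I.isCompact_biUnion fun i hi => isCompact_Icc.image (hC i hi).continuous).isClosed

theorem continuousAt_sum_windingNumber (hC : ∀ i ∈ I, ContDiff ℝ 1 (Γ i)) {y : Plane}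
    (hy : y ∉ familyImage I Γ) :
    ContinuousAt (fun x => ∑ i ∈ I, windingNumber (Γ i) x) y :=
  tendsto_finsetSum _ fun i hi => continuousAt_windingNumber (hC i hi) fun hmem =>
    hy (mem_biUnion hi hmem)

/-- The total winding number is continuous off the curves and a set of full measure is dense, so
membership in a closed set passes from almost every point to every point. -/
theorem sum_windingNumber_mem_of_ae (hC : ∀ i ∈ I, ContDiff ℝ 1 (Γ i)) {s : Set ℝ}
    (hs : IsClosed s) {y : Plane} (hy : y ∉ familyImage I Γ) {U : Set Plane} (hU : U ∈ 𝓝 y)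
    (hae : ∀ᵐ x, x ∈ U → x ∉ familyImage I Γ → ∑ i ∈ I, windingNumber (Γ i) x ∈ s) :
    ∑ i ∈ I, windingNumber (Γ i) y ∈ s := by
  have hfreq := mem_closure_iff_frequently.1 (Measure.dense_of_ae hae y)
  refine hs.mem_of_frequently_of_tendsto ?_ (continuousAt_sum_windingNumber hC hy)
  have hev : ∀ᶠ x in 𝓝 y, x ∈ U ∩ (familyImage I Γ)ᶜ :=
    inter_mem hU ((isClosed_familyImage hC).isOpen_compl.mem_nhds hy)
  refine (hfreq.and_eventually hev).mono ?_
  rintro x ⟨h1, h2, h3⟩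
  exact h1 h2 h3

theorem sum_windingNumber_eq_zero_or_one (hC : ∀ i ∈ I, ContDiff ℝ 1 (Γ i))
    (hae : ∀ᵐ x, x ∉ familyImage I Γ →
      Ω.indicator (fun _ => (1 : ℝ)) x = ∑ i ∈ I, windingNumber (Γ i) x)
    {y : Plane} (hy : y ∉ familyImage I Γ) :
    ∑ i ∈ I, windingNumber (Γ i) y = 0 ∨ ∑ i ∈ I, windingNumber (Γ i) y = 1 := by
  have hs : IsClosed ({0, 1} : Set ℝ) := (Set.toFinite _).isClosed
  have := sum_windingNumber_mem_of_ae hC hs hy (U := univ) univ_mem ?_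
  · simpa using this
  · filter_upwards [hae] with x hx _ hxΓ
    rw [← hx hxΓ]
    by_cases hxΩ : x ∈ Ω
    · simp [hxΩ]
    · simp [hxΩ]

/-- A continuous function with values in {0, 1} is locally constant; closeness within 1/2 separates
the two values. -/
theorem exists_ball_sum_windingNumber_eq (hC : ∀ i ∈ I, ContDiff ℝ 1 (Γ i))
    (hae : ∀ᵐ x, x ∉ familyImage I Γ →
      Ω.indicator (fun _ => (1 : ℝ)) x = ∑ i ∈ I, windingNumber (Γ i) x)
    {y : Plane} (hy : y ∉ familyImage I Γ) :
    ∃ r > 0, ∀ x ∈ Metric.ball y r, x ∉ familyImage I Γ ∧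
      ∑ i ∈ I, windingNumber (Γ i) x = ∑ i ∈ I, windingNumber (Γ i) y := by
  have h1 := Metric.tendsto_nhds.1 (continuousAt_sum_windingNumber hC hy) (1 / 2) (by norm_num)
  have h2 := (isClosed_familyImage hC).isOpen_compl.mem_nhds hy
  obtain ⟨r, hr, hball⟩ := Metric.eventually_nhds_iff_ball.1 (h1.and h2)
  refine ⟨r, hr, fun x hx => ⟨(hball x hx).2, ?_⟩⟩
  have h3 := (hball x hx).1
  rw [Real.dist_eq] at h3
  beta_reduce at h3
  rcases sum_windingNumber_eq_zero_or_one hC hae (hball x hx).2 with h4 | h4 <;>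
  rcases sum_windingNumber_eq_zero_or_one hC hae hy with h5 | h5 <;>
  rw [h4, h5] at h3 ⊢
  all_goals norm_num at h3

/-- If Ω fills a ball up to a null set, the total winding number there is 1 off the curves, by
density. Conversely an odd total excludes the value 0 of the indicator, and the curves themselves
are null. -/
theorem essInterior_eq_of_ae (hC : ∀ i ∈ I, ContDiff ℝ 1 (Γ i))
    (hae : ∀ᵐ x, x ∉ familyImage I Γ →
      Ω.indicator (fun _ => (1 : ℝ)) x = ∑ i ∈ I, windingNumber (Γ i) x) :
    essInterior Ω = interior (oddWindingSet I Γ ∪ familyImage I Γ) := by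
  ext x
  rw [mem_interior_iff_mem_nhds, Metric.mem_nhds_iff]
  constructor
  · rintro ⟨r, hr, hvol⟩
    refine ⟨r, hr, fun y hy => ?_⟩
    by_cases hyΓ : y ∈ familyImage I Γ
    · exact Or.inr hyΓ
    · refine Or.inl ⟨hyΓ, 0, ?_⟩
      have hn : ∀ᵐ z, z ∉ Metric.ball x r \ Ω := measure_eq_zero_iff_ae_notMem.1 hvol
      have : ∑ i ∈ I, windingNumber (Γ i) y ∈ ({1} : Set ℝ) := by
        refine sum_windingNumber_mem_of_ae hC isClosed_singleton hyΓ
          (Metric.isOpen_ball.mem_nhds hy) ?_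
        filter_upwards [hae, hn] with z h1 h2 h3 h4
        have hz : z ∈ Ω := by
          by_contra hcon
          exact h2 ⟨h3, hcon⟩
        rw [mem_singleton_iff, ← h1 h4, indicator_of_mem hz]
      rw [mem_singleton_iff.1 this]
      norm_num
  · rintro ⟨r, hr, hsub⟩
    refine ⟨r, hr, ?_⟩
    rw [measure_eq_zero_iff_ae_notMem]
    filter_upwards [hae, measure_eq_zero_iff_ae_notMem.1 (volume_familyImage hC)] with z h1 h2 h3
    have h4 := h1 h2
    rw [indicator_of_notMem h3.2] at h4
    rcases hsub h3.1 with ⟨-, k, hk⟩ | h5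
    · rw [← h4] at hk
      have : (0 : ℤ) = 2 * k + 1 := by exact_mod_cast hk
      omega
    · exact h2 h5

/-- The measure `|Dχ_Ω|` vanishes on open sets on which `χ_Ω` is a.e. constant. -/
theorem IsPolarDecomposition.measure_eq_zero {μ : Measure Plane} {ν : Plane → Plane}
    (h : IsPolarDecomposition Ω μ ν) (hΩ : NullMeasurableSet Ω volume) {U : Set Plane}
    (hU : IsOpen U) {c : ℝ} (hc : ∀ᵐ x, x ∈ U → Ω.indicator (fun _ => (1 : ℝ)) x = c) :
    μ U = 0 := by
  have := h.locallyFinite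
  have hloc : LocallyIntegrable ν μ := by
    refine (locallyIntegrable_const (1 : ℝ)).mono h.measurable.aestronglyMeasurable ?_
    filter_upwards [h.unit] with x hx
    simp [hx]
  -- For g supported in U, ∫ g ⟨ν, w⟩ dμ = -c ∫ div(g w) = 0. So ν vanishes μ-a.e. on U, which
  -- contradicts |ν| = 1 unless U is μ-null.
  have hzero := hU.ae_eq_zero_of_integral_contDiff_smul_eq_zero (hloc.locallyIntegrableOn U)
    fun g hg hgc hgU => ?_
  · rw [measure_eq_zero_iff_ae_notMem]
    filter_upwards [hzero, h.unit] with x h1 h2 h3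
    rw [h1 h3, norm_zero] at h2
    exact zero_ne_one h2
  · refine ext_inner_right ℝ fun w => ?_
    rw [inner_zero_left]
    have hX : ContDiff ℝ 1 fun x => g x • w := (hg.of_le (by norm_cast)).smul contDiff_const
    have hsub : tsupport (fun x => g x • w) ⊆ tsupport g :=
      closure_mono fun x hx hg0 => hx (by simp only [hg0, zero_smul])
    have hXc : HasCompactSupport fun x => g x • w :=
      HasCompactSupport.intro hgc fun x hx => by
        rw [image_eq_zero_of_notMem_tsupport hx, zero_smul]
    have hgg := h.gauss_green _ hX hXc
    have hleft : ∫ x in Ω, divergence (fun x => g x • w) x = 0 := by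
      rw [← integral_indicator₀ hΩ]
      have : Ω.indicator (divergence fun x => g x • w) =ᵐ[volume]
          fun x => c * divergence (fun x => g x • w) x := by
        filter_upwards [hc] with x hx
        by_cases hxU : x ∈ U
        · rw [← hx hxU]
          by_cases hxΩ : x ∈ Ω <;> simp [hxΩ]
        · have h0 := divergence_eq_zero_of_notMem_tsupport fun hmem => hxU (hgU (hsub hmem))
          rw [h0, mul_zero]
          by_cases hxΩ : x ∈ Ω <;> simp [hxΩ, h0]
      rw [integral_congr_ae this, integral_const_mul, integral_divergence_eq_zero hX hXc, mul_zero]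
    rw [hleft, zero_eq_neg] at hgg
    have hintg : Integrable (fun x => g x • ν x) μ := by
      have := hloc.integrable_smul_left_of_hasCompactSupport hg.continuous hgc
      exact this
    rw [real_inner_comm]
    have e := (innerSL ℝ w).integral_comp_comm hintg
    simp only [innerSL_apply_apply] at e
    rw [← e, ← hgg]
    refine integral_congr_ae (ae_of_all _ fun x => ?_)
    simp only [inner_smul_left, inner_smul_right]
    simp

/-- Near a point off the curves the indicator is a.e. constant, so |Dχ_Ω| vanishes there, whichever
polar decomposition represents it, whereas the reduced boundary lies in its support. -/
theorem reducedBoundary_subset_of_ae (hΩ : NullMeasurableSet Ω volume)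
    (hC : ∀ i ∈ I, ContDiff ℝ 1 (Γ i))
    (hae : ∀ᵐ x, x ∉ familyImage I Γ →
      Ω.indicator (fun _ => (1 : ℝ)) x = ∑ i ∈ I, windingNumber (Γ i) x) :
    reducedBoundary Ω ⊆ familyImage I Γ := by
  rintro y ⟨μ, ν, hpd, hpos, -⟩
  by_contra hy
  obtain ⟨r, hr, hball⟩ := exists_ball_sum_windingNumber_eq hC hae hy
  refine (hpos r hr).ne' (hpd.measure_eq_zero hΩ Metric.isOpen_ball
    (c := ∑ i ∈ I, windingNumber (Γ i) y) ?_)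
  filter_upwards [hae] with x h1 h2
  rw [h1 (hball x h2).1, (hball x h2).2]

theorem isBoundarySystem_of_ae (hΩ : NullMeasurableSet Ω volume)
    (hC : ∀ i ∈ I, ContDiff ℝ 1 (Γ i)) (hH : ∀ i ∈ I, MemH2 (Γ i))
    (hcs : ∀ i ∈ I, ConstantSpeed (Γ i))
    (hae : ∀ᵐ x, x ∉ familyImage I Γ →
      Ω.indicator (fun _ => (1 : ℝ)) x = ∑ i ∈ I, windingNumber (Γ i) x) :
    IsBoundarySystem Ω I Γ :=
  ⟨hH, reducedBoundary_subset_of_ae hΩ hC hae, essInterior_eq_of_ae hC hae,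
    fun i hi => ⟨_, hcs i hi⟩⟩

end


/-! ### The limit of the boundary curves -/

/-- In the limit the characteristic function is the sum of the winding numbers of the limits of
those boundary curves that do not escape. -/
theorem ae_indicator_eq_sum_windingNumber {Ω : ℕ → Set Plane} {N : ℕ → ℕ}
    {γ : ℕ → ℕ → ℝ → Plane} (hdec : ∀ k, IsBoundaryDecomposition (Ω k) (N k) (γ k))
    (hreg : ∀ k, RegularSet (Ω k)) {Ωinf : Set Plane} (hΩinf : NullMeasurableSet Ωinf volume)
    (hconv : Tendsto (fun n => eLpNorm
        (fun x => (Ω n).indicator (fun _ => (1 : ℝ)) x - Ωinf.indicator (fun _ => (1 : ℝ)) x)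
        1 volume) atTop (𝓝 0))
    {M : ℕ} {I : Finset ℕ} (hI : I ⊆ Finset.range M) (hMN : ∀ k, M ≤ N k) {Γ : ℕ → ℝ → Plane}
    (hΓ : ∀ i ∈ I, CurvesConverge (fun k => γ k i) (Γ i))
    (hesc : ∀ i ∈ Finset.range M \ I, ∀ x,
      Tendsto (fun k => windingNumber (γ k i) x) atTop (𝓝 0))
    {η : ℕ → ℝ} (hη : Tendsto η atTop (𝓝 0))
    (hshort : ∀ k, ∑ i ∈ Finset.Ico M (N k), curveLength (γ k i) ≤ η k) :
    ∀ᵐ x, x ∉ familyImage I Γ →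
      Ωinf.indicator (fun _ => (1 : ℝ)) x = ∑ i ∈ I, windingNumber (Γ i) x := by
  have hIN : ∀ i ∈ I, ∀ k, i < N k := fun i hi k =>
    (Finset.mem_range.1 (hI hi)).trans_le (hMN k)
  set H : ℕ → Plane → ℝ≥0∞ := fun k x =>
    ∑ i ∈ Finset.Ico M (N k), windingMajorant (γ k i) (curveLength (γ k i)) x with hH
  have hHm : ∀ k, Measurable (H k) := fun k => by
    refine Finset.measurable_fun_sum _ fun i hi => ?_
    exact measurable_windingMajorant
      ((hdec k).contDiff_one (Finset.mem_Ico.1 hi).2).continuous _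
  set D : ℕ → Plane → ℝ := fun k x =>
    (Ω k).indicator (fun _ => (1 : ℝ)) x - Ωinf.indicator (fun _ => (1 : ℝ)) x with hD
  have hDm : ∀ k, AEMeasurable (D k) volume := fun k =>
    (measurable_const.indicator (hreg k).isOpen.measurableSet).aemeasurable.sub
      (aemeasurable_const.indicator₀ hΩinf)
  -- For almost every x this dominates the distance from the limit indicator to the sum of the first
  -- M winding numbers, and it tends to 0 in L¹ on balls. Fatou's lemma makes its lower limit vanish
  -- a.e.; this suffices, because that sum converges at each point off the limit curves.
  set q : ℕ → Plane → ℝ≥0∞ := fun k x => ‖D k x‖ₑ + H k x with hq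
  have hqm : ∀ k, AEMeasurable (q k) volume := fun k =>
    (hDm k).enorm.add (hHm k).aemeasurable
  have hlim : ∀ R : ℕ, ∀ᵐ x, x ∈ Metric.ball (0 : Plane) R → liminf (fun k => q k x) atTop = 0 := by
    intro R
    obtain ⟨C, hC, hCR⟩ := exists_lintegral_inv_enorm_sub_le R
    have hintg : Tendsto (fun k => ∫⁻ x in Metric.ball (0 : Plane) R, q k x) atTop (𝓝 0) := by
      have hb : Tendsto (fun k => eLpNorm (D k) 1 volume + ENNReal.ofReal (η k) * C) atTop
          (𝓝 0) := by
        have h1 := ENNReal.Tendsto.mul_const (ENNReal.tendsto_ofReal hη) (Or.inr hC)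
        have h2 := hconv.add h1
        simpa using h2
      refine tendsto_of_tendsto_of_tendsto_of_le_of_le tendsto_const_nhds hb
        (fun k => zero_le) fun k => ?_
      simp only [hq]
      rw [lintegral_add_right _ (hHm k)]
      gcongr
      · rw [eLpNorm_one_eq_lintegral_enorm]
        exact setLIntegral_le_lintegral _ _
      · simp only [hH]
        rw [lintegral_finsetSum]
        · calc ∑ i ∈ Finset.Ico M (N k), ∫⁻ x in Metric.ball (0 : Plane) R,
                windingMajorant (γ k i) (curveLength (γ k i)) x
              ≤ ∑ i ∈ Finset.Ico M (N k), ENNReal.ofReal (curveLength (γ k i)) * C :=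
                Finset.sum_le_sum fun i hi => lintegral_windingMajorant_le
                  ((hdec k).contDiff_one (Finset.mem_Ico.1 hi).2).continuous _ hCR
            _ = ENNReal.ofReal (∑ i ∈ Finset.Ico M (N k), curveLength (γ k i)) * C := by
                rw [ENNReal.ofReal_sum_of_nonneg fun i hi =>
                  ((hdec k).curveLength_pos (Finset.mem_Ico.1 hi).2).le, Finset.sum_mul]
            _ ≤ ENNReal.ofReal (η k) * C := by gcongr; exact hshort k
        · intro i hi
          exact measurable_windingMajorant
            ((hdec k).contDiff_one (Finset.mem_Ico.1 hi).2).continuous _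
    have hF := lintegral_liminf_le' (μ := volume.restrict (Metric.ball (0 : Plane) R)) (u := atTop)
      fun k => (hqm k).restrict
    have hlm : AEMeasurable (fun x => liminf (fun k => q k x) atTop) volume := by
      refine ⟨_, Measurable.liminf fun k => (hqm k).measurable_mk, ?_⟩
      filter_upwards [ae_all_iff.2 fun k => (hqm k).ae_eq_mk] with x hx
      simp_rw [hx]
    rw [hintg.liminf_eq, nonpos_iff_eq_zero, lintegral_eq_zero_iff' hlm.restrict] at hF
    exact (ae_restrict_iff' measurableSet_ball).1 hF
  have hfr : ∀ᵐ x, ∀ k, x ∉ frontier (Ω k) :=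
    ae_all_iff.2 fun k => measure_eq_zero_iff_ae_notMem.1 (hdec k).volume_frontier
  filter_upwards [ae_all_iff.2 hlim, hfr] with x h1 h2 hxΓ
  obtain ⟨R, hR⟩ := exists_nat_gt ‖x‖
  have hq0 := h1 R (mem_ball_zero_iff.2 hR)
  set a : ℕ → ℝ := fun k => ∑ i ∈ Finset.range M, windingNumber (γ k i) x with ha
  have halim : Tendsto a atTop (𝓝 (∑ i ∈ I, windingNumber (Γ i) x)) := by
    have hA : Tendsto (fun k => ∑ i ∈ Finset.range M \ I, windingNumber (γ k i) x) atTop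
        (𝓝 (∑ i ∈ Finset.range M \ I, 0)) := tendsto_finsetSum _ fun i hi => hesc i hi x
    have hB : Tendsto (fun k => ∑ i ∈ I, windingNumber (γ k i) x) atTop
        (𝓝 (∑ i ∈ I, windingNumber (Γ i) x)) := tendsto_finsetSum _ fun i hi =>
      (hΓ i hi).tendsto_windingNumber (fun k => (hdec k).contDiff_one (hIN i hi k))
        tendsto_const_nhds fun hmem => hxΓ (mem_biUnion hi hmem)
    have hAB := hA.add hB
    simp only [Finset.sum_const_zero, zero_add] at hAB
    refine hAB.congr fun k => ?_
    exact Finset.sum_sdiff hI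
  have hle : ∀ k, ‖Ωinf.indicator (fun _ => (1 : ℝ)) x - a k‖ₑ ≤ q k x := by
    intro k
    have hw := (hdec k).sum_windingNumber (hreg k).isOpen (hreg k).bounded (h2 k)
    rw [← Finset.sum_range_add_sum_Ico _ (hMN k)] at hw
    have e : Ωinf.indicator (fun _ => (1 : ℝ)) x - a k =
        -D k x + ∑ i ∈ Finset.Ico M (N k), windingNumber (γ k i) x := by
      simp only [hD, ha]
      linarith
    rw [e]
    refine (enorm_add_le _ _).trans ?_
    rw [enorm_neg]
    simp only [hq, hH]
    gcongr
    refine (enorm_sum_le _ _).trans (Finset.sum_le_sum fun i hi => ?_)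
    exact enorm_windingNumber_le ((hdec k).constantSpeed i (Finset.mem_Ico.1 hi).2) x
  have hten : Tendsto (fun k => ‖Ωinf.indicator (fun _ => (1 : ℝ)) x - a k‖ₑ) atTop
      (𝓝 ‖Ωinf.indicator (fun _ => (1 : ℝ)) x - ∑ i ∈ I, windingNumber (Γ i) x‖ₑ) :=
    (tendsto_const_nhds.sub halim).enorm
  have hfin : ‖Ωinf.indicator (fun _ => (1 : ℝ)) x - ∑ i ∈ I, windingNumber (Γ i) x‖ₑ ≤ 0 := by
    rw [← hq0, ← hten.liminf_eq]
    exact liminf_le_liminf (Eventually.of_forall hle)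
  rw [nonpos_iff_eq_zero, enorm_eq_zero, sub_eq_zero] at hfin
  exact hfin

/-- Since the curves are enumerated by decreasing length, the long ones come first. -/
theorem IsBoundaryDecomposition.exists_long_iff_lt {Ω : Set Plane} {N : ℕ} {γ : ℕ → ℝ → Plane}
    (h : IsBoundaryDecomposition Ω N γ) {c K : ℝ}
    (hK : ∑ i ∈ Finset.range N, curveLength (γ i) ≤ K) :
    ∃ M ≤ N, M * c ≤ K ∧ ∀ i < N, c ≤ curveLength (γ i) ↔ i < M := by
  classical
  -- The first index that is out of range or belongs to a short curve; by monotonicity of the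
  -- lengths all later curves are short.
  have hex : ∃ i, N ≤ i ∨ curveLength (γ i) < c := ⟨N, Or.inl le_rfl⟩
  have hlt : ∀ i < Nat.find hex, i < N ∧ c ≤ curveLength (γ i) := fun i hi => by
    have := Nat.find_min hex hi
    push Not at this
    exact this
  have hMN : Nat.find hex ≤ N := Nat.find_min' hex (Or.inl le_rfl)
  refine ⟨Nat.find hex, hMN, ?_, fun i hi => ⟨fun hc => ?_, fun hiM => (hlt i hiM).2⟩⟩
  · calc (Nat.find hex : ℝ) * c = ∑ _i ∈ Finset.range (Nat.find hex), c := by simp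
      _ ≤ ∑ i ∈ Finset.range (Nat.find hex), curveLength (γ i) :=
        Finset.sum_le_sum fun i hi => (hlt i (Finset.mem_range.1 hi)).2
      _ ≤ ∑ i ∈ Finset.range N, curveLength (γ i) :=
        Finset.sum_le_sum_of_subset_of_nonneg (Finset.range_mono hMN) fun i hi _ =>
          (h.curveLength_pos (Finset.mem_range.1 hi)).le
      _ ≤ K := hK
  · by_contra hcon
    rw [not_lt] at hcon
    rcases Nat.find_spec hex with h1 | h1
    · omega
    · exact absurd (hc.trans (h.decreasing _ _ hcon hi)) (not_le.2 h1)

/-- Simultaneous compactness for finitely many sequences of closed curves of constant speed. -/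
theorem exists_subseq_family {γ : ℕ → ℕ → ℝ → Plane} {m : ℕ}
    (hC : ∀ i < m, ∀ k, ContDiff ℝ 1 (γ k i)) (hcs : ∀ i < m, ∀ k, ConstantSpeed (γ k i))
    {c K : ℝ} (hc : 0 < c) (hcL : ∀ i < m, ∀ k, c ≤ curveLength (γ k i))
    (hLK : ∀ i < m, ∀ k, curveLength (γ k i) ≤ K) {η : ℕ → ℝ} (hη : Tendsto η atTop (𝓝 0))
    (hS : ∀ i < m, ∀ k, ∃ S S' : ℝ → Plane, Continuous S' ∧
      (∀ t, HasDerivAt S (S' t) t) ∧ Function.Periodic S 1 ∧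
      (∀ t, ‖S t‖ ≤ 1) ∧ ∫ t in (0 : ℝ)..1, S t = 0 ∧
      ∫ t in (0 : ℝ)..1, ‖S' t‖ ^ 2 ≤ K ∧
      ∫ t in (0 : ℝ)..1, ‖(curveLength (γ k i))⁻¹ • deriv (γ k i) t - S t‖ ^ 2 ≤ η k) :
    ∃ φ : ℕ → ℕ, StrictMono φ ∧ ∀ i < m, Tendsto (fun k => ‖γ (φ k) i 0‖) atTop atTop ∨
      ∃ Γ, MemH2 Γ ∧ RegularCurve Γ ∧ ConstantSpeed Γ ∧
        CurvesConverge (fun k => γ (φ k) i) Γ := by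
  refine exists_common_subseq
    (P := fun i φ => Tendsto (fun k => ‖γ (φ k) i 0‖) atTop atTop ∨
      ∃ Γ, MemH2 Γ ∧ RegularCurve Γ ∧ ConstantSpeed Γ ∧
        CurvesConverge (fun k => γ (φ k) i) Γ) ?_ m ?_
  · rintro i φ θ hθ (h | ⟨Γ, h1, h2, h3, h4⟩)
    · exact Or.inl (h.comp hθ.tendsto_atTop)
    · exact Or.inr ⟨Γ, h1, h2, h3, h4.comp hθ⟩
  · intro i hi φ hφ
    exact exists_subseq_curve (g := fun k => γ (φ k) i) (fun k => hC i hi _)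
      (L := fun k => curveLength (γ (φ k) i)) (fun k => hcs i hi _) hc (fun k => hcL i hi _)
      (fun k => hLK i hi _) (η := fun k => η (φ k)) (hη.comp hφ.tendsto_atTop)
      fun k => hS i hi _

theorem proposition4p3
    (lam α : ℕ → ℝ) (σ : ℝ)
    (hlam_pos : ∀ n, 0 < lam n)
    (hlam : Tendsto lam atTop atTop)
    (hα : ∀ n, 1 / Real.sqrt (2 * Real.pi) < α n)
    (hσ_pos : 0 < σ)
    (hσ : Tendsto (fun n => lam n ^ 2 * (1 - 1 / (2 * Real.pi * α n ^ 2))) atTop (𝓝 σ))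
    (Ω : ℕ → Set Plane)
    (hΩ : ∀ n, Admissible Real.pi (Ω n))
    (hΩ_reg : ∀ n, RegularSet (Ω n))
    (hbdd : limsup (fun n => ((lam n ^ 2 * energy (lam n) (α n) (Ω n) : ℝ) : EReal)) atTop < ⊤)
    (N : ℕ → ℕ) (γ : ℕ → ℕ → ℝ → Plane)
    (hγ : ∀ n, IsBoundaryDecomposition (Ω n) (N n) (γ n))
    (Ωinf : Set Plane)
    (hΩinf : Admissible Real.pi Ωinf)
    (hconv : Tendsto (fun n => eLpNorm
        (fun x => (Ω n).indicator (fun _ => (1 : ℝ)) x - Ωinf.indicator (fun _ => (1 : ℝ)) x)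
        1 volume) atTop (𝓝 0)) :
    ∃ (φ : ℕ → ℕ) (I : Finset ℕ) (γinf : ℕ → ℝ → Plane),
      StrictMono φ ∧
      IsBoundarySystem Ωinf I γinf ∧
      (∀ i ∈ I, RegularCurve (γinf i) ∧ ConstantSpeed (γinf i)) ∧
      (∀ i ∈ I, (∀ k, i < N (φ k)) ∧
        Tendsto (fun k => h1Norm (fun t => γ (φ k) i t - γinf i t)) atTop (𝓝 0)) := by
  classical
  obtain ⟨K, hK, c, hc, η, hη, hev⟩ := exists_eventually_bounds hlam
    (fun n => lt_trans (by positivity) (hα n)) hσ_pos hσ (fun n => (hΩ n).finite_perimeter)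
    hΩ_reg hbdd hγ
  obtain ⟨n₀, hn₀⟩ := eventually_atTop.1 hev
  have hgood := fun n => hn₀ (n + n₀) (Nat.le_add_left _ _)
  choose M hMN hMc hMlt using fun n => (hγ (n + n₀)).exists_long_iff_lt (c := c) (hgood n).1
  -- The number of long curves lies in the finite set {0, …, ⌊K / c⌋}. A convergent subsequence in
  -- this discrete space is eventually constant.
  obtain ⟨m, -, φ₀, hφ₀, hm⟩ := (Set.finite_Iic ⌊K / c⌋₊).isCompact.tendsto_subseq fun n =>
    (Nat.le_floor ((le_div_iff₀ hc).2 (hMc n)) : M n ∈ Iic ⌊K / c⌋₊)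
  obtain ⟨k₀, hk₀⟩ := eventually_atTop.1 (tendsto_nhds.1 hm {m} (isOpen_discrete _) rfl)
  set ψ : ℕ → ℕ := fun k => φ₀ (k + k₀) with hψ
  have hMψ : ∀ k, M (ψ k) = m := fun k => hk₀ (k + k₀) (Nat.le_add_left _ _)
  have hψmono : StrictMono fun k => ψ k + n₀ := fun a b hab =>
    Nat.add_lt_add_right (hφ₀ (Nat.add_lt_add_right hab _)) _
  have hmN : ∀ k, m ≤ N (ψ k + n₀) := fun k => hMψ k ▸ hMN (ψ k)
  have hLK : ∀ k, ∀ i < m, curveLength (γ (ψ k + n₀) i) ≤ K := fun k i hi =>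
    (Finset.single_le_sum (f := fun i => curveLength (γ (ψ k + n₀) i)) (fun j hj =>
      ((hγ (ψ k + n₀)).curveLength_pos (Finset.mem_range.1 hj)).le)
      (Finset.mem_range.2 (hi.trans_le (hmN k)))).trans (hgood (ψ k)).1
  have hci : ∀ i < m, ∀ k, c ≤ curveLength (γ (ψ k + n₀) i) := fun i hi k =>
    (hMlt (ψ k) i (hi.trans_le (hmN k))).2 (by rw [hMψ]; exact hi)
  obtain ⟨φ, hφ, hP⟩ := exists_subseq_family (γ := fun k => γ (ψ k + n₀)) (m := m)
    (fun i hi k => (hγ _).contDiff_one (hi.trans_le (hmN k)))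
    (fun i hi k => (hγ _).constantSpeed i (hi.trans_le (hmN k))) hc hci
    (fun i hi k => hLK k i hi) (η := fun k => η (ψ k + n₀)) (hη.comp hψmono.tendsto_atTop)
    fun i hi k => (hgood (ψ k)).2.2 i (hi.trans_le (hmN k)) (hci i hi k)
  -- The indices of the long curves that converge; by the dichotomy all other long curves escape to
  -- infinity.
  set I : Finset ℕ := (Finset.range m).filter fun i => ∃ Γ, MemH2 Γ ∧ RegularCurve Γ ∧
    ConstantSpeed Γ ∧ CurvesConverge (fun k => γ (ψ (φ k) + n₀) i) Γ with hI
  have hex : ∀ i, ∃ Γ, i ∈ I → MemH2 Γ ∧ RegularCurve Γ ∧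
      ConstantSpeed Γ ∧ CurvesConverge (fun k => γ (ψ (φ k) + n₀) i) Γ := fun i => by
    by_cases hi : i ∈ I
    · obtain ⟨Γ, hΓ⟩ := (Finset.mem_filter.1 hi).2
      exact ⟨Γ, fun _ => hΓ⟩
    · exact ⟨0, fun h => absurd h hi⟩
  choose Γ hΓ using hex
  have hIm : I ⊆ Finset.range m := Finset.filter_subset _ _
  have hIN : ∀ i ∈ I, ∀ k, i < N (ψ (φ k) + n₀) := fun i hi k =>
    (Finset.mem_range.1 (hIm hi)).trans_le (hmN _)
  have hθ : StrictMono fun k => ψ (φ k) + n₀ := hψmono.comp hφ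
  have hae := ae_indicator_eq_sum_windingNumber (fun k => hγ (ψ (φ k) + n₀))
    (fun k => hΩ_reg _) hΩinf.measurable (hconv.comp hθ.tendsto_atTop) hIm (fun k => hmN (φ k))
    (Γ := Γ) (fun i hi => (hΓ i hi).2.2.2) (fun i hi x => by
      rw [Finset.mem_sdiff] at hi
      have him := Finset.mem_range.1 hi.1
      rcases hP i him with h1 | h1
      · exact tendsto_windingNumber_of_escape
          (fun k => (hγ _).contDiff_one (him.trans_le (hmN _)))
          (fun k => (hγ _).constantSpeed i (him.trans_le (hmN _))) (fun k => hLK _ i him) h1 x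
      · exact absurd (Finset.mem_filter.2 ⟨hi.1, h1⟩) hi.2)
    -- The indices from m on are exactly those of the curves shorter than c, so their total length
    -- is the negligible one.
    (hη.comp hθ.tendsto_atTop) (fun k => by
      refine le_trans (le_of_eq ?_) (hgood (ψ (φ k))).2.1
      refine Finset.sum_congr ?_ fun _ _ => rfl
      ext i
      simp only [Finset.mem_Ico, Finset.mem_filter, Finset.mem_range]
      constructor
      · rintro ⟨h1, h2⟩
        refine ⟨h2, not_le.1 fun h3 => ?_⟩
        have := (hMlt (ψ (φ k)) i h2).1 h3
        rw [hMψ] at this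
        omega
      · rintro ⟨h1, h2⟩
        refine ⟨?_, h1⟩
        by_contra hcon
        rw [not_le] at hcon
        exact absurd ((hMlt (ψ (φ k)) i h1).2 (by rw [hMψ]; exact hcon)) (not_le.2 h2))
  exact ⟨fun k => ψ (φ k) + n₀, I, Γ, hθ,
    isBoundarySystem_of_ae hΩinf.measurable (fun i hi => (hΓ i hi).2.2.2.contDiff)
      (fun i hi => (hΓ i hi).1) (fun i hi => (hΓ i hi).2.2.1) hae,
    fun i hi => ⟨(hΓ i hi).2.1, (hΓ i hi).2.2.1⟩,
    fun i hi => ⟨hIN i hi, (hΓ i hi).2.2.2.tendsto_h1Norm fun k =>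
      (hγ _).contDiff_one (hIN i hi k)⟩⟩
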